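/- \textbf{Conventions.} For a group $G$ and $S=\{x,y\}\subseteq G$ with $x\ne y$, put $\Sigma(S)=\bigcup_{t\in\{x,y,xy\}}\bigcup_{g\in G}\langle t^g\rangle$. Two 2-element generating sets $S_1,S_2$ of $G$ form a \emph{Beauville structure} of $G$ if $\Sigma(S_1)\cap\Sigma(S_2)=\{1\}$; a finite group is a \emph{Beauville group} if it has a Beauville structure. A Beauville $p$-group $G$ is of \emph{tame type} if every lift to $G$ of a Beauville structure of $G/\Phi(G)$ is a Beauville structure of $G$, and of \emph{wild type} otherwise. A group of order $p^n$ with $n\ge 2$ has \emph{maximal class} if its nilpotency class is $n-1$. For such a group let $G_1=C_G(G'/\gamma_4(G))$, let $B(M)=M\smallsetminus\Phi(G)$ for a maximal subgroup $M$ of $G$ (a \emph{maximal branch}), and let $\mu(G)$ be the number of maximal subgroups $M\neq G_1$ of $G$ such that all elements of $B(M)$ have order $p$. \textbf{Theorem.} Let $p$ be a prime and let $G$ be a $p$-group of maximal class of order $p^n$ with $n\ge p+1$. Suppose that $G$ is metabelian or has a maximal subgroup of nilpotency class at most $2$. Then $G$ is a Beauville group if and only if $p\ge 5$ and one of the following two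 cases holds: (a) $\mu(G)=p$; (b) $\mu(G)=2$, and either $n\not\equiv 2\pmod{p-1}$, or $n=p+1$ and all elements of $B(G_1)$ have order $p$. If $p\ge5$, then (a) holds if and only if the set of elements of $G\smallsetminus\Phi(G)$ of order $p$ is exactly $G\smallsetminus G_1$; every group in case (a) is a Beauville group of tame type; and every group in case (b) is a Beauville group of wild type. Moreover, for every prime $p\ge 5$, each of the cases (a) and (b) contains infinitely many such groups: there are infinitely many $n$ for which a group of order $p^n$ as above exists in case (a), and likewise in case (b). -/

import Mathlib

/-! ### Beauville structures -/

section Beauville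

variable {G : Type*} [Group G]

/-- The union of all conjugates of the cyclic subgroups generated by `x`, `y` and `x * y`, where
`S = (x, y)`. -/
def beauvilleSigma (S : G × G) : Set G :=
  ⋃ t ∈ ({S.1, S.2, S.1 * S.2} : Set G), ⋃ g : G, (Subgroup.zpowers (g⁻¹ * t * g) : Set G)

/-- `beauvilleSigma` depends only on the set `{x, y}`, not on the order of `x` and `y`. -/
theorem beauvilleSigma_swap (S : G × G) : beauvilleSigma S.swap = beauvilleSigma S := by
  have key : ∀ x y : G, (⋃ g : G, (Subgroup.zpowers (g⁻¹ * (x * y) * g) : Set G)) ⊆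
      ⋃ g : G, (Subgroup.zpowers (g⁻¹ * (y * x) * g) : Set G) := by
    intro x y
    refine Set.iUnion_subset fun g => ?_
    refine Set.subset_iUnion_of_subset (x⁻¹ * g) ?_
    have : (x⁻¹ * g)⁻¹ * (y * x) * (x⁻¹ * g) = g⁻¹ * (x * y) * g := by group
    rw [this]
  have h := Set.Subset.antisymm (key S.1 S.2) (key S.2 S.1)
  simp only [beauvilleSigma, Prod.fst_swap, Prod.snd_swap, Set.biUnion_insert,
    Set.biUnion_singleton]
  rw [h, ← Set.union_assoc, ← Set.union_assoc, Set.union_comm (⋃ g : G, _) (⋃ g : G, _)]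

/-- `{x, y}` is a two-element set of generators of `G`, where `S = (x, y)`. -/
def IsGeneratingPair (S : G × G) : Prop :=
  S.1 ≠ S.2 ∧ Subgroup.closure ({S.1, S.2} : Set G) = ⊤

/-- `S₁` and `S₂` form a Beauville structure for `G`. -/
def IsBeauvilleStructure (S₁ S₂ : G × G) : Prop :=
  IsGeneratingPair S₁ ∧ IsGeneratingPair S₂ ∧ beauvilleSigma S₁ ∩ beauvilleSigma S₂ = {1}

variable (G)

/-- A (finite) group is a Beauville group if it has a Beauville structure. -/
def IsBeauvilleGroup : Prop :=
  ∃ S₁ S₂ : G × G, IsBeauvilleStructure S₁ S₂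

/-- Every lift to `G` of a Beauville structure of `G ⧸ Φ(G)` is a Beauville structure of `G`. -/
def BeauvilleLiftingProperty : Prop :=
  ∀ S₁ S₂ : G × G,
    IsBeauvilleStructure
        (S₁.map (QuotientGroup.mk' (frattini G)) (QuotientGroup.mk' (frattini G)))
        (S₂.map (QuotientGroup.mk' (frattini G)) (QuotientGroup.mk' (frattini G))) →
      IsBeauvilleStructure S₁ S₂

/-- A Beauville `p`-group of tame type. -/
def IsTameBeauville : Prop :=
  IsBeauvilleGroup G ∧ BeauvilleLiftingProperty G

/-- A Beauville `p`-group of wild type. -/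
def IsWildBeauville : Prop :=
  IsBeauvilleGroup G ∧ ¬ BeauvilleLiftingProperty G

end Beauville

/-! ### Groups of maximal class -/

section MaximalClass

variable (G : Type*) [Group G]

/-- `G` is a `p`-group of maximal class of order `p ^ n`: it has class `n - 1`, with `n ≥ 2`. -/
def IsMaximalClass (p n : ℕ) : Prop :=
  2 ≤ n ∧ Nat.card G = p ^ n ∧ Group.IsNilpotent G ∧ Group.nilpotencyClass G = n - 1

/-- `G` is metabelian. -/
def IsMetabelianGroup : Prop :=
  derivedSeries G 2 = ⊥

/-- `G` has a maximal subgroup of nilpotency class at most `2`. -/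
def HasMaximalSubgroupOfClassLETwo : Prop :=
  ∃ M : Subgroup G, IsCoatom M ∧ Group.IsNilpotent M ∧ Group.nilpotencyClass M ≤ 2

/-- The `i`-th term `γ_i(G)` of the lower central series, indexed so that `γ_1(G) = G`. -/
def gammaSeries (i : ℕ) : Subgroup G :=
  (⊤ : Subgroup G).lowerCentralSeries (i - 1)

instance gammaSeries_normal (i : ℕ) : (gammaSeries G i).Normal := by
  unfold gammaSeries
  infer_instance

/-- The subgroup `G₁ = C_G(G' / γ_4(G))`. -/
def gOne : Subgroup G :=
  (Subgroup.centralizer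
    ((gammaSeries G 2).map (QuotientGroup.mk' (gammaSeries G 4)) :
      Set (G ⧸ gammaSeries G 4))).comap (QuotientGroup.mk' (gammaSeries G 4))

variable {G}

/-- The maximal branch `B(M) = M ∖ Φ(G)` of a maximal subgroup `M`. -/
def maximalBranch (M : Subgroup G) : Set G :=
  (M : Set G) \ (frattini G : Set G)

variable (G)

/-- `μ(G)`: the number of maximal subgroups `M ≠ G₁` such that all elements of `B(M)` have
order `p`. -/
noncomputable def muInvariant (p : ℕ) : ℕ :=
  {M : Subgroup G | IsCoatom M ∧ M ≠ gOne G ∧ ∀ g ∈ maximalBranch M, orderOf g = p}.ncard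

/-- The standing hypotheses: `G` has maximal class and order `p ^ n` with `n ≥ p + 1`, and is
metabelian or has a maximal subgroup of class at most `2`. -/
def InFamily (p n : ℕ) : Prop :=
  IsMaximalClass G p n ∧ p + 1 ≤ n ∧ (IsMetabelianGroup G ∨ HasMaximalSubgroupOfClassLETwo G)

/-- First case: `μ(G) = p`. -/
def CaseA (p : ℕ) : Prop :=
  muInvariant G p = p

/-- Second case: `μ(G) = 2`, and either `n ≢ 2 (mod p - 1)`, or `n = p + 1` and all elements of
`B(G₁)` have order `p`. -/
def CaseB (p n : ℕ) : Prop :=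
  muInvariant G p = 2 ∧
    (¬ n ≡ 2 [MOD p - 1] ∨ (n = p + 1 ∧ ∀ g ∈ maximalBranch (gOne G), orderOf g = p))

end MaximalClass

/-! Modulo γ₂ = Φ(G) the group is a plane over 𝔽_p whose p + 1 lines are the maximal subgroups. Fix
g in G₁ ∖ γ₂ and s outside G₁: then G₁ has slope ∞ and ⟨g^i s⟩γ₂ has slope i. The whole theorem is
read off from p-th powers, as collected in `PowerData`: (g^i s)^p = α^i β^(i²) s^p with α, β in
γ_{n-1}, a central subgroup of order p, and the p-th power of an element outside G₁ depends only on
its class modulo γ₂. So "slope i has exponent p on its branch" is an equation of degree at most two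
in i over 𝔽_p; μ(G) counts its roots (`PowerData.muInvariant_eq`), and three roots force all slopes
to be roots (`PowerData.forall_of_three`). Inside G₁ ∖ γ₂, for n ≥ p + 2, each p-th power descends
exactly p - 1 steps of the lower central series, so a nontrivial power in γ_{n-1} occurs precisely
when n ≡ 2 mod p - 1; the case n = p + 1 is treated separately.

Given a Beauville structure, one of its two triples has no nontrivial powers in γ_{n-1}, since
otherwise both Σ-sets contain that subgroup of order p. At least two elements of this triple have
finite slope, and these slopes are roots. A third root gives case (a); otherwise the third element
lies in G₁, and its lack of central powers is the condition in (b). Conversely, triples with slopes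
(i, j, ∞) and (a, b, c) work, where i, j are the roots in case (b) and arbitrary in case (a). In
case (a) any independent triples work, because two independent elements cannot both lie in G₁. In
case (b) a lift with non-roots in both triples fails. For p ≤ 3 the cosets of γ₂ outside a suitable
maximal subgroup are conjugacy classes, so the two triples would need four distinct finite slopes.

The key fact starts from uniserial elements s, which lie in no two-step centralizer:
`exists_conj_eq` shows that γ₂s is a conjugacy class, whence (as)^p = s^p for a in γ₂. A maximal
subgroup of class at most two other than G₁ makes G metabelian, so two cases remain. If G₁ has class
at most two, its Baer sum turns (as)^p into the trace of a plus a quadratic form in a, times s^p. If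
G is metabelian, γ₂ is a cyclic ℤ[S]-module for S = (conjugation by s) - 1, and (g^i s)^p becomes a
power sum in commuting operators; that this sum is quadratic in i is the ring identity
`powerSum_eq`.

For existence, let ZMod p translate the functions ZMod p → ZMod (p^e) modulo constants, and twist
both the action and the addition by ε times terms in a fixed socle element z. The element inl(k •
single) · gen then has p-th power ε(k² - k)z: ε = 0 gives case (a), and ε = 1 gives case (b) with
roots 0 and 1. -/

open scoped commutatorElement

/-! ### Commutators and the lower central series -/

section LowerCentralSeries

variable {G : Type*} [Group G]

theorem gammaSeries_succ {i : ℕ} (hi : 1 ≤ i) : gammaSeries G (i + 1) = ⁅gammaSeries G i, ⊤⁆ := by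
  obtain ⟨j, rfl⟩ := Nat.exists_eq_add_of_le' hi
  rfl

theorem gammaSeries_antitone : Antitone (gammaSeries G) := fun _ _ hij =>
  Subgroup.lowerCentralSeries_antitone _ (Nat.sub_le_sub_right hij 1)

theorem commutatorElement_mem_gammaSeries_succ {i : ℕ} {a : G} (ha : a ∈ gammaSeries G i) (x : G) :
    ⁅a, x⁆ ∈ gammaSeries G (i + 1) := by
  rcases Nat.eq_zero_or_pos i with rfl | hi
  · trivial
  · rw [gammaSeries_succ hi]
    exact Subgroup.commutator_mem_commutator ha (Subgroup.mem_top x)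

theorem commutatorElement_mem_gammaSeries_succ' {i : ℕ} {a : G} (ha : a ∈ gammaSeries G i) (x : G) :
    ⁅x, a⁆ ∈ gammaSeries G (i + 1) := by
  rw [← commutatorElement_inv]
  exact inv_mem (commutatorElement_mem_gammaSeries_succ ha x)

theorem conj_mem_gammaSeries {i : ℕ} {a : G} (ha : a ∈ gammaSeries G i) (x : G) :
    x * a * x⁻¹ ∈ gammaSeries G i :=
  (gammaSeries_normal G i).conj_mem a ha x

end LowerCentralSeries

/-! ### Sections of prime order and maximal subgroups -/

section PrimeIndex

variable {G : Type*} [Group G] {p : ℕ}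

theorem quotient_card_eq_of_card_eq_mul [Finite G] {N K : Subgroup G} (hNK : N ≤ K)
    (hcard : Nat.card K = p * Nat.card N) : Nat.card (K ⧸ N.subgroupOf K) = p := by
  have h1 := Subgroup.card_mul_index (N.subgroupOf K)
  have h2 : Nat.card (N.subgroupOf K) = Nat.card N :=
    Nat.card_congr (Subgroup.subgroupOfEquivOfLe hNK).toEquiv
  rw [h2, hcard, mul_comm] at h1
  exact Nat.eq_of_mul_eq_mul_right Nat.card_pos h1

theorem exists_pow_inv_mul_mem [Fact p.Prime] [Finite G] {N K : Subgroup G} [N.Normal] (hNK : N ≤ K)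
    (hcard : Nat.card K = p * Nat.card N) {a b : G} (ha : a ∈ K) (ha' : a ∉ N) (hb : b ∈ K) :
    ∃ k : ℕ, (a ^ k)⁻¹ * b ∈ N := by
  have hc := quotient_card_eq_of_card_eq_mul hNK hcard
  have h1 : (QuotientGroup.mk (⟨a, ha⟩ : K) : K ⧸ N.subgroupOf K) ≠ 1 := by
    rwa [Ne, QuotientGroup.eq_one_iff, Subgroup.mem_subgroupOf]
  obtain ⟨k, hk⟩ := mem_powers_of_prime_card hc h1 (g' := QuotientGroup.mk (⟨b, hb⟩ : K))
  refine ⟨k, ?_⟩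
  simp only at hk
  rw [← QuotientGroup.mk_pow, QuotientGroup.eq, Subgroup.mem_subgroupOf] at hk
  simpa using hk

theorem pow_prime_mem_of_card_eq_mul [Finite G] {N K : Subgroup G} [N.Normal] (hNK : N ≤ K)
    (hcard : Nat.card K = p * Nat.card N) {a : G} (ha : a ∈ K) : a ^ p ∈ N := by
  have hc := quotient_card_eq_of_card_eq_mul hNK hcard
  have h1 : (QuotientGroup.mk (⟨a, ha⟩ : K) : K ⧸ N.subgroupOf K) ^ p = 1 := by
    rw [← hc]; exact pow_card_eq_one'
  rw [← QuotientGroup.mk_pow, QuotientGroup.eq_one_iff, Subgroup.mem_subgroupOf] at h1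
  simpa using h1

/-- In a nilpotent group, maximal subgroups contain the commutator subgroup. -/
theorem gammaSeries_two_le_of_isCoatom [Group.IsNilpotent G] {M : Subgroup G} (hM : IsCoatom M) :
    gammaSeries G 2 ≤ M := by
  have hn : M.Normal := Subgroup.NormalizerCondition.normal_of_coatom M Group.normalizerCondition_of_isNilpotent hM
  obtain ⟨x, -, hx⟩ := Set.exists_of_ssubset hM.lt_top
  have : M ⊔ Subgroup.zpowers x = ⊤ := by
    refine hM.2 _ (lt_of_le_of_ne le_sup_left fun h => hx ?_)
    rw [SetLike.mem_coe, h]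
    exact (le_sup_right : Subgroup.zpowers x ≤ _) (Subgroup.mem_zpowers x)
  exact hn.commutator_le_of_self_sup_commutative_eq_top this inferInstance

theorem gammaSeries_two_le_frattini [Group.IsNilpotent G] : gammaSeries G 2 ≤ frattini G := by
  rw [frattini, Order.radical]
  exact le_iInf₂ fun M hM => gammaSeries_two_le_of_isCoatom hM

theorem normal_of_gammaSeries_two_le {M : Subgroup G} (hM : gammaSeries G 2 ≤ M) : M.Normal :=
  Subgroup.Normal.of_commutator_le G hM

end PrimeIndex

/-! ### Orders of lower central terms in finite p-groups -/

section PGroup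

variable {G : Type*} [Group G] {p n : ℕ} [hp : Fact p.Prime]

/-- Two equal consecutive terms make the series stationary from there on, so a nilpotent group
forces the repeated term to be trivial. -/
theorem gammaSeries_succ_lt_of_ne_bot [Group.IsNilpotent G] {i : ℕ} (hi : 1 ≤ i)
    (hne : gammaSeries G i ≠ ⊥) : gammaSeries G (i + 1) < gammaSeries G i := by
  refine lt_of_le_of_ne (gammaSeries_antitone (Nat.le_succ i)) fun heq => hne ?_
  have key : ∀ j, i ≤ j → gammaSeries G j = gammaSeries G i := by
    intro j hj
    induction j, hj using Nat.le_induction with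
    | base => rfl
    | succ j hj ih => rw [gammaSeries_succ (hi.trans hj), ih, ← gammaSeries_succ hi, heq]
  rw [← key (i + Group.nilpotencyClass G + 1) (by omega), gammaSeries,
    Subgroup.lowerCentralSeries_eq_bot_iff_nilpotencyClass_le]
  omega

theorem IsPGroup.mul_card_le_of_lt [Finite G] (hG : IsPGroup p G) {H K : Subgroup G} (hHK : H < K) :
    p * Nat.card H ≤ Nat.card K := by
  obtain ⟨a, ha⟩ := IsPGroup.iff_card.1 (hG.to_subgroup H)
  obtain ⟨b, hb⟩ := IsPGroup.iff_card.1 (hG.to_subgroup K)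
  have hlt : Nat.card H < Nat.card K := by
    refine lt_of_le_of_ne (Subgroup.card_le_of_le hHK.le) fun heq => hHK.ne ?_
    exact Subgroup.eq_of_le_of_card_ge hHK.le heq.ge
  rw [ha, hb] at *
  have := (Nat.pow_lt_pow_iff_right hp.out.one_lt).1 hlt
  rw [mul_comm, ← pow_succ]
  exact Nat.pow_le_pow_right hp.out.pos this

/-- γ₂ consists of non-generators, so a cyclic quotient by γ₂ would make the whole group cyclic and
γ₂ trivial. -/
theorem zpowers_sup_gammaSeries_two_ne_top [Finite G] [Group.IsNilpotent G]
    (hne : gammaSeries G 2 ≠ ⊥) (x : G) : Subgroup.zpowers x ⊔ gammaSeries G 2 ≠ ⊤ := by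
  intro hx
  have h1 : Subgroup.zpowers x = ⊤ := frattini_nongenerating
    (top_le_iff.1 (hx ▸ sup_le_sup_left gammaSeries_two_le_frattini _))
  refine hne ?_
  have hc : ∀ a b : G, a * b = b * a := by
    intro a b
    have ha : a ∈ Subgroup.zpowers x := h1 ▸ Subgroup.mem_top a
    have hb : b ∈ Subgroup.zpowers x := h1 ▸ Subgroup.mem_top b
    obtain ⟨i, rfl⟩ := ha
    obtain ⟨j, rfl⟩ := hb
    exact (Commute.refl x).zpow_zpow i j
  rw [gammaSeries_succ (i := 1) le_rfl, eq_bot_iff, Subgroup.commutator_le]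
  intro a _ b _
  rw [Subgroup.mem_bot, commutatorElement_eq_one_iff_mul_comm]
  exact hc a b

theorem IsPGroup.sq_mul_card_gammaSeries_two_le [Finite G] (hG : IsPGroup p G)
    (hne : gammaSeries G 2 ≠ ⊥) : p ^ 2 * Nat.card (gammaSeries G 2) ≤ Nat.card G := by
  have := hG.isNilpotent
  have hne1 : gammaSeries G 1 ≠ ⊥ := fun h =>
    hne (le_bot_iff.1 ((gammaSeries_antitone one_le_two).trans h.le))
  obtain ⟨x, -, hx⟩ := Set.exists_of_ssubset (gammaSeries_succ_lt_of_ne_bot le_rfl hne1)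
  have h1 : gammaSeries G 2 < Subgroup.zpowers x ⊔ gammaSeries G 2 :=
    lt_of_le_of_ne le_sup_right fun heq => hx (by
      rw [SetLike.mem_coe, heq]
      exact (le_sup_left : Subgroup.zpowers x ≤ _) (Subgroup.mem_zpowers x))
  have h2 := hG.mul_card_le_of_lt h1
  have h3 := hG.mul_card_le_of_lt (lt_top_iff_ne_top.2 (zpowers_sup_gammaSeries_two_ne_top hne x))
  rw [Subgroup.card_top] at h3
  calc p ^ 2 * Nat.card (gammaSeries G 2) = p * (p * Nat.card (gammaSeries G 2)) := by ring
    _ ≤ _ := (Nat.mul_le_mul_left p h2).trans h3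

/-- The top factor has order at least p² and every later strict inclusion costs a factor p. If
γ_{n-1} ≠ 1, these inclusions already use up all of p^n. This is how the examples constructed below
are recognised. -/
theorem isMaximalClass_of_gammaSeries_ne_bot (hn : 3 ≤ n) (hcard : Nat.card G = p ^ n)
    (hne : gammaSeries G (n - 1) ≠ ⊥) : IsMaximalClass G p n := by
  have hG : IsPGroup p G := IsPGroup.of_card hcard
  have : Finite G := Nat.finite_of_card_ne_zero (by rw [hcard]; exact pow_ne_zero _ hp.out.ne_zero)
  have := hG.isNilpotent
  have hne' : ∀ i ≤ n - 1, gammaSeries G i ≠ ⊥ := fun i hi h =>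
    hne (le_bot_iff.1 ((gammaSeries_antitone hi).trans h.le))
  have key : ∀ k ≤ n - 2, p ^ k * Nat.card (gammaSeries G (2 + k)) ≤ Nat.card (gammaSeries G 2) := by
    intro k
    induction k with
    | zero => simp
    | succ k ih =>
      intro hk
      refine le_trans ?_ (ih (by omega))
      rw [pow_succ, mul_assoc]
      exact Nat.mul_le_mul_left _ (hG.mul_card_le_of_lt
        (gammaSeries_succ_lt_of_ne_bot (i := 2 + k) (by omega) (hne' _ (by omega))))
  have h1 := hG.sq_mul_card_gammaSeries_two_le (hne' 2 (by omega))
  have h2 := (Nat.mul_le_mul_left (p ^ 2) (key (n - 2) le_rfl)).trans h1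
  rw [← mul_assoc, ← pow_add, hcard, Nat.add_sub_cancel' (by omega : 2 ≤ n)] at h2
  have h3 : gammaSeries G n = ⊥ := Subgroup.eq_bot_of_card_le _
    (Nat.le_of_mul_le_mul_left (by rwa [mul_one]) (pow_pos hp.out.pos n))
  refine ⟨by omega, hcard, this, le_antisymm ?_ ?_⟩
  · rwa [gammaSeries, Subgroup.lowerCentralSeries_eq_bot_iff_nilpotencyClass_le] at h3
  · rw [gammaSeries, Ne, Subgroup.lowerCentralSeries_eq_bot_iff_nilpotencyClass_le] at hne
    omega

end PGroup

/-! ### Maximal class: lower central factors, maximal subgroups, Frattini subgroup -/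

namespace IsMaximalClass

variable {G : Type*} [Group G] {p n : ℕ}

theorem isNilpotent (h : IsMaximalClass G p n) : Group.IsNilpotent G := h.2.2.1

theorem gammaSeries_eq_bot (h : IsMaximalClass G p n) {i : ℕ} (hi : n ≤ i) :
    gammaSeries G i = ⊥ := by
  have := h.isNilpotent
  rw [gammaSeries, Subgroup.lowerCentralSeries_eq_bot_iff_nilpotencyClass_le, h.2.2.2]
  omega

theorem eq_one_of_mem (h : IsMaximalClass G p n) {i : ℕ} (hi : n ≤ i) {a : G}
    (ha : a ∈ gammaSeries G i) : a = 1 := by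
  rwa [h.gammaSeries_eq_bot hi, Subgroup.mem_bot] at ha

theorem gammaSeries_ne_bot (h : IsMaximalClass G p n) {i : ℕ} (hi : i < n) :
    gammaSeries G i ≠ ⊥ := by
  have := h.isNilpotent
  have h2 := h.1
  rw [gammaSeries, Ne, Subgroup.lowerCentralSeries_eq_bot_iff_nilpotencyClass_le, h.2.2.2]
  omega

theorem gammaSeries_succ_lt (h : IsMaximalClass G p n) {i : ℕ} (hi : 1 ≤ i) (hin : i < n) :
    gammaSeries G (i + 1) < gammaSeries G i := by
  have := h.isNilpotent
  exact gammaSeries_succ_lt_of_ne_bot hi (h.gammaSeries_ne_bot hin)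

theorem isPGroup (h : IsMaximalClass G p n) : IsPGroup p G := IsPGroup.of_card h.2.1

variable [hp : Fact p.Prime]

theorem finite (h : IsMaximalClass G p n) : Finite G :=
  Nat.finite_of_card_ne_zero (by rw [h.2.1]; exact pow_ne_zero _ hp.out.ne_zero)

theorem mul_card_le_of_lt (h : IsMaximalClass G p n) {H K : Subgroup G} (hHK : H < K) :
    p * Nat.card H ≤ Nat.card K := by
  have := h.finite
  exact h.isPGroup.mul_card_le_of_lt hHK

theorem zpowers_sup_ne_top (h : IsMaximalClass G p n) (hn : 3 ≤ n) (x : G) :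
    Subgroup.zpowers x ⊔ gammaSeries G 2 ≠ ⊤ := by
  have := h.finite
  have := h.isNilpotent
  exact zpowers_sup_gammaSeries_two_ne_top (h.gammaSeries_ne_bot (by omega)) x

theorem card_gammaSeries_two_le (h : IsMaximalClass G p n) (hn : 3 ≤ n) :
    p ^ 2 * Nat.card (gammaSeries G 2) ≤ p ^ n := by
  have := h.finite
  exact (h.isPGroup.sq_mul_card_gammaSeries_two_le (h.gammaSeries_ne_bot (by omega))).trans_eq h.2.1

/-- Counting down from γ₂ bounds the order from above, counting up from γ_n = 1 bounds it from
below, and the two bounds agree. -/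
theorem card_gammaSeries (h : IsMaximalClass G p n) (hn : 3 ≤ n) {i : ℕ} (hi : 2 ≤ i)
    (hin : i ≤ n) : Nat.card (gammaSeries G i) = p ^ (n - i) := by
  have := h.finite
  have hpos := hp.out.pos
  refine le_antisymm ?_ ?_
  · induction i, hi using Nat.le_induction with
    | base =>
      have h1 := h.card_gammaSeries_two_le hn
      obtain ⟨m, rfl⟩ := Nat.exists_eq_add_of_le' (by omega : 2 ≤ n)
      rw [add_comm m 2, pow_add] at h1
      simpa using Nat.le_of_mul_le_mul_left h1 (pow_pos hpos 2)
    | succ i hi ih =>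
      have h1 := (h.mul_card_le_of_lt (h.gammaSeries_succ_lt (by omega : 1 ≤ i) (by omega))).trans
        (ih (by omega))
      rw [show n - i = (n - (i + 1)) + 1 by omega, pow_succ'] at h1
      exact Nat.le_of_mul_le_mul_left h1 hpos
  · have key : ∀ k, k ≤ n - 2 → p ^ k ≤ Nat.card (gammaSeries G (n - k)) := by
      intro k
      induction k with
      | zero => exact fun _ => Nat.card_pos
      | succ k ih =>
        intro hk
        have h1 := h.mul_card_le_of_lt (h.gammaSeries_succ_lt (i := n - (k + 1)) (by omega) (by omega))
        rw [show n - (k + 1) + 1 = n - k by omega] at h1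
        rw [pow_succ']
        exact (Nat.mul_le_mul_left p (ih (by omega))).trans h1
    simpa [show n - (n - i) = i by omega] using key (n - i) (by omega)

theorem card_gammaSeries_succ (h : IsMaximalClass G p n) (hn : 3 ≤ n) {i : ℕ} (hi : 2 ≤ i)
    (hin : i < n) : Nat.card (gammaSeries G i) = p * Nat.card (gammaSeries G (i + 1)) := by
  rw [h.card_gammaSeries hn hi hin.le, h.card_gammaSeries hn (by omega) hin, ← pow_succ']
  congr 1; omega

/-- If a maximal subgroup contains `γ₂`, its order is `p ^ (n - 1)`. -/
theorem card_of_gammaSeries_two_lt (h : IsMaximalClass G p n) (hn : 3 ≤ n) {M : Subgroup G}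
    (h1 : gammaSeries G 2 < M) (h2 : M < ⊤) : Nat.card M = p ^ (n - 1) := by
  have := h.finite
  have hpos := hp.out.pos
  have h3 := h.mul_card_le_of_lt h1
  have h4 := h.mul_card_le_of_lt h2
  rw [Subgroup.card_top, h.2.1, show n = n - 1 + 1 by omega, pow_succ'] at h4
  rw [h.card_gammaSeries hn le_rfl (by omega), ← pow_succ', show n - 2 + 1 = n - 1 by omega] at h3
  exact le_antisymm (Nat.le_of_mul_le_mul_left h4 hpos) h3

theorem isCoatom_of_gammaSeries_two_lt (h : IsMaximalClass G p n) (hn : 3 ≤ n) {M : Subgroup G}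
    (h1 : gammaSeries G 2 < M) (h2 : M < ⊤) : IsCoatom M := by
  have := h.finite
  refine ⟨h2.ne, fun K hK => ?_⟩
  by_contra hne
  have h3 := h.card_of_gammaSeries_two_lt hn (h1.trans hK) (lt_top_iff_ne_top.2 hne)
  exact hK.ne (Subgroup.eq_of_le_of_card_ge hK.le
    (h3.trans (h.card_of_gammaSeries_two_lt hn h1 h2).symm).le)

theorem gammaSeries_two_lt_of_isCoatom (h : IsMaximalClass G p n) (hn : 3 ≤ n) {M : Subgroup G}
    (hM : IsCoatom M) : gammaSeries G 2 < M := by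
  have := h.isNilpotent
  refine lt_of_le_of_ne (gammaSeries_two_le_of_isCoatom hM) fun heq => ?_
  obtain ⟨x, -, hx⟩ := Set.exists_of_ssubset hM.lt_top
  refine h.zpowers_sup_ne_top hn x (hM.2 _ (heq ▸ lt_of_le_of_ne le_sup_right fun h' => hx ?_))
  rw [SetLike.mem_coe, ← heq, h']
  exact (le_sup_left : Subgroup.zpowers x ≤ _) (Subgroup.mem_zpowers x)

theorem card_of_isCoatom (h : IsMaximalClass G p n) (hn : 3 ≤ n) {M : Subgroup G}
    (hM : IsCoatom M) : Nat.card M = p ^ (n - 1) :=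
  h.card_of_gammaSeries_two_lt hn (h.gammaSeries_two_lt_of_isCoatom hn hM) hM.lt_top

theorem isCoatom_zpowers_sup (h : IsMaximalClass G p n) (hn : 3 ≤ n) {x : G}
    (hx : x ∉ gammaSeries G 2) : IsCoatom (Subgroup.zpowers x ⊔ gammaSeries G 2) := by
  refine h.isCoatom_of_gammaSeries_two_lt hn (lt_of_le_of_ne le_sup_right fun heq => hx ?_)
    (lt_top_iff_ne_top.2 (h.zpowers_sup_ne_top hn x))
  rw [heq]
  exact (le_sup_left : Subgroup.zpowers x ≤ _) (Subgroup.mem_zpowers x)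

/-- Two maximal subgroups sharing an element outside `γ₂` are equal. -/
theorem isCoatom_eq_of_mem (h : IsMaximalClass G p n) (hn : 3 ≤ n) {M N : Subgroup G}
    (hM : IsCoatom M) (hN : IsCoatom N) {x : G} (hxM : x ∈ M) (hxN : x ∈ N)
    (hx : x ∉ gammaSeries G 2) : M = N := by
  have key : ∀ K : Subgroup G, IsCoatom K → x ∈ K → Subgroup.zpowers x ⊔ gammaSeries G 2 = K := by
    intro K hK hxK
    refine (h.isCoatom_zpowers_sup hn hx).le_iff_eq hK.1 |>.1 (sup_le ?_ ?_) |>.symm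
    · rwa [Subgroup.zpowers_le]
    · exact (h.gammaSeries_two_lt_of_isCoatom hn hK).le
  rw [← key M hM hxM, key N hN hxN]

/-- An element outside γ₂ lies in exactly one maximal subgroup, and there is more than one of these,
so it cannot lie in Φ(G). -/
theorem frattini_eq (h : IsMaximalClass G p n) (hn : 3 ≤ n) : frattini G = gammaSeries G 2 := by
  have := h.isNilpotent
  refine le_antisymm (fun x hx => ?_) gammaSeries_two_le_frattini
  by_contra hx2
  have hM := h.isCoatom_zpowers_sup hn hx2
  obtain ⟨y, -, hy⟩ := Set.exists_of_ssubset hM.lt_top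
  have hy2 : y ∉ gammaSeries G 2 := fun hy' => hy ((le_sup_right : gammaSeries G 2 ≤ _) hy')
  have hM' := h.isCoatom_zpowers_sup hn hy2
  have := h.isCoatom_eq_of_mem hn hM hM' ((le_sup_left : Subgroup.zpowers x ≤ _)
    (Subgroup.mem_zpowers x)) (frattini_le_coatom hM' hx) hx2
  apply hy
  rw [SetLike.mem_coe, this]
  exact (le_sup_left : Subgroup.zpowers y ≤ _) (Subgroup.mem_zpowers y)

theorem pow_prime_mem_gammaSeries_two (h : IsMaximalClass G p n) (hn : 3 ≤ n) (x : G) :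
    x ^ p ∈ gammaSeries G 2 := by
  have := h.finite
  by_cases hx : x ∈ gammaSeries G 2
  · exact pow_mem hx p
  have hM := h.isCoatom_zpowers_sup hn hx
  refine pow_prime_mem_of_card_eq_mul (h.gammaSeries_two_lt_of_isCoatom hn hM).le ?_
    ((le_sup_left : Subgroup.zpowers x ≤ _) (Subgroup.mem_zpowers x))
  rw [h.card_of_isCoatom hn hM, h.card_gammaSeries hn le_rfl (by omega), ← pow_succ']
  congr 1; omega

theorem card_isCoatom_eq (h : IsMaximalClass G p n) (hn : 3 ≤ n) {M : Subgroup G}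
    (hM : IsCoatom M) : Nat.card M = p * Nat.card (gammaSeries G 2) := by
  rw [h.card_of_isCoatom hn hM, h.card_gammaSeries hn le_rfl (by omega), ← pow_succ']
  congr 1; omega

theorem card_top_eq (h : IsMaximalClass G p n) (hn : 3 ≤ n) {M : Subgroup G}
    (hM : IsCoatom M) : Nat.card (⊤ : Subgroup G) = p * Nat.card M := by
  rw [h.card_of_isCoatom hn hM, Subgroup.card_top, h.2.1, ← pow_succ']
  congr 1; omega

end IsMaximalClass

/-! ### Two-step centralizers -/

section TwoStep

variable (G : Type*) [Group G]

/-- The two-step centralizer `C_G(γ_i / γ_{i+2})`. -/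
def twoStepCentralizer (i : ℕ) : Subgroup G where
  carrier := {x | ∀ a ∈ gammaSeries G i, ⁅a, x⁆ ∈ gammaSeries G (i + 2)}
  one_mem' a _ := by simp
  mul_mem' {x y} hx hy a ha := by
    rw [show ⁅a, x * y⁆ = ⁅a, x⁆ * (x * ⁅a, y⁆ * x⁻¹) by simp only [commutatorElement_def]; group]
    exact mul_mem (hx a ha) (conj_mem_gammaSeries (hy a ha) x)
  inv_mem' {x} hx a ha := by
    rw [show ⁅a, x⁻¹⁆ = x⁻¹ * ⁅a, x⁆⁻¹ * x⁻¹⁻¹ by simp only [commutatorElement_def]; group]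
    exact conj_mem_gammaSeries (inv_mem (hx a ha)) x⁻¹

variable {G}

theorem mem_twoStepCentralizer {i : ℕ} {x : G} :
    x ∈ twoStepCentralizer G i ↔ ∀ a ∈ gammaSeries G i, ⁅a, x⁆ ∈ gammaSeries G (i + 2) := Iff.rfl

theorem gOne_eq_twoStepCentralizer : gOne G = twoStepCentralizer G 2 := by
  ext x
  rw [gOne, Subgroup.mem_comap, Subgroup.mem_centralizer_iff, mem_twoStepCentralizer]
  simp only [Subgroup.coe_map, Set.forall_mem_image, SetLike.mem_coe]
  refine forall₂_congr fun a _ => ?_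
  rw [← commutatorElement_eq_one_iff_mul_comm, ← map_commutatorElement, ← MonoidHom.mem_ker,
    QuotientGroup.ker_mk']

theorem mk_mem_center_of_mem_gammaSeries {i : ℕ} {a : G} (ha : a ∈ gammaSeries G i) :
    (QuotientGroup.mk a : G ⧸ gammaSeries G (i + 1)) ∈ Subgroup.center _ := by
  rw [Subgroup.mem_center_iff]
  intro g
  obtain ⟨x, rfl⟩ := QuotientGroup.mk_surjective g
  rw [← QuotientGroup.mk_mul, ← QuotientGroup.mk_mul, QuotientGroup.eq]
  have := commutatorElement_mem_gammaSeries_succ (inv_mem ha) x⁻¹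
  rw [commutatorElement_def] at this
  simpa [mul_assoc] using this

/-- For `a ∈ γ_i`, the homomorphism `x ↦ [a, x]` modulo `γ_{i+2}`. -/
def commutatorHom {i : ℕ} {a : G} (ha : a ∈ gammaSeries G i) :
    G →* Subgroup.center (G ⧸ gammaSeries G (i + 2)) where
  toFun x := ⟨QuotientGroup.mk ⁅a, x⁆,
    mk_mem_center_of_mem_gammaSeries (commutatorElement_mem_gammaSeries_succ ha x)⟩
  map_one' := by ext; simp
  map_mul' x y := by
    ext
    have h1 := Subgroup.mem_center_iff.1 (mk_mem_center_of_mem_gammaSeries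
      (commutatorElement_mem_gammaSeries_succ ha y)) (QuotientGroup.mk x)
    have h2 : ⁅a, x * y⁆ = ⁅a, x⁆ * (x * ⁅a, y⁆ * x⁻¹) := by
      simp only [commutatorElement_def]; group
    change (QuotientGroup.mk ⁅a, x * y⁆ : G ⧸ gammaSeries G (i + 2)) =
      QuotientGroup.mk ⁅a, x⁆ * QuotientGroup.mk ⁅a, y⁆
    rw [h2, QuotientGroup.mk_mul, QuotientGroup.mk_mul, QuotientGroup.mk_mul, h1,
      QuotientGroup.mk_inv, mul_inv_cancel_right]

theorem mem_ker_commutatorHom {i : ℕ} {a : G} (ha : a ∈ gammaSeries G i) {x : G} :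
    x ∈ (commutatorHom ha).ker ↔ ⁅a, x⁆ ∈ gammaSeries G (i + 2) := by
  rw [MonoidHom.mem_ker, ← QuotientGroup.eq_one_iff]
  exact Subtype.ext_iff

theorem gammaSeries_two_le_ker_commutatorHom {i : ℕ} {a : G} (ha : a ∈ gammaSeries G i) :
    gammaSeries G 2 ≤ (commutatorHom ha).ker := by
  rw [gammaSeries_succ (i := 1) le_rfl, Subgroup.commutator_le]
  intro u _ v _
  rw [MonoidHom.mem_ker, map_commutatorElement, commutatorElement_eq_one_iff_mul_comm]
  exact Subtype.ext (Subgroup.mem_center_iff.1 (commutatorHom ha v).2 _)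

theorem gammaSeries_two_le_twoStepCentralizer {i : ℕ} :
    gammaSeries G 2 ≤ twoStepCentralizer G i := fun _ hx _ ha =>
  (mem_ker_commutatorHom ha).1 (gammaSeries_two_le_ker_commutatorHom ha hx)

end TwoStep

namespace IsMaximalClass

variable {G : Type*} [Group G] {p n : ℕ} [hp : Fact p.Prime]

theorem exists_pow_inv_mul_mem_gammaSeries (h : IsMaximalClass G p n) (hn : 3 ≤ n) {i : ℕ}
    (hi : 2 ≤ i) {a b : G} (ha : a ∈ gammaSeries G i) (ha' : a ∉ gammaSeries G (i + 1))
    (hb : b ∈ gammaSeries G i) : ∃ k : ℕ, (a ^ k)⁻¹ * b ∈ gammaSeries G (i + 1) := by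
  have := h.finite
  rcases lt_or_ge i n with hin | hin
  · exact exists_pow_inv_mul_mem (gammaSeries_antitone (Nat.le_succ i))
      (h.card_gammaSeries_succ hn hi hin) ha ha' hb
  · exact absurd (h.eq_one_of_mem hin ha ▸ one_mem _) ha'

/-- The factor γ_i / γ_{i+1} is cyclic, so the action on γ_i / γ_{i+2} can be tested on a single
generator a. -/
theorem mem_twoStepCentralizer_iff (h : IsMaximalClass G p n) (hn : 3 ≤ n) {i : ℕ}
    (hi : 2 ≤ i) {a x : G} (ha : a ∈ gammaSeries G i) (ha' : a ∉ gammaSeries G (i + 1)) :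
    x ∈ twoStepCentralizer G i ↔ ⁅a, x⁆ ∈ gammaSeries G (i + 2) := by
  refine ⟨fun hx => hx a ha, fun hx b hb => ?_⟩
  obtain ⟨k, hk⟩ := h.exists_pow_inv_mul_mem_gammaSeries hn hi ha ha' hb
  have key : ∀ u v : G, ⁅u, x⁆ ∈ gammaSeries G (i + 2) → ⁅v, x⁆ ∈ gammaSeries G (i + 2) →
      ⁅u * v, x⁆ ∈ gammaSeries G (i + 2) := by
    intro u v hu hv
    rw [commutatorElement_mul_left_eq_conj_mul]
    exact mul_mem (conj_mem_gammaSeries hv u) hu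
  have hpow : ∀ k : ℕ, ⁅a ^ k, x⁆ ∈ gammaSeries G (i + 2) := by
    intro k
    induction k with
    | zero => simp
    | succ k ih => rw [pow_succ]; exact key _ _ ih hx
  have := key _ _ (hpow k) (commutatorElement_mem_gammaSeries_succ hk x)
  rwa [mul_inv_cancel_left] at this

/-- For a generating γ_i modulo γ_{i+1}, the two-step centralizer is the kernel of x ↦ [a, x], a
nontrivial homomorphism to the group γ_{i+1} / γ_{i+2} of order p. -/
theorem isCoatom_twoStepCentralizer (h : IsMaximalClass G p n) {i : ℕ}
    (hi : 2 ≤ i) (hin : i + 2 ≤ n) : IsCoatom (twoStepCentralizer G i) := by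
  have := h.finite
  have hn : 3 ≤ n := by omega
  obtain ⟨a, ha, ha'⟩ := Set.exists_of_ssubset (h.gammaSeries_succ_lt (by omega : 1 ≤ i) (by omega))
  have hne : twoStepCentralizer G i ≠ ⊤ := by
    intro heq
    refine (h.gammaSeries_succ_lt (by omega : 1 ≤ i + 1) (by omega)).not_ge ?_
    rw [gammaSeries_succ (by omega : 1 ≤ i), Subgroup.commutator_le]
    intro b hb x _
    exact (heq ▸ Subgroup.mem_top x : x ∈ twoStepCentralizer G i) b hb
  refine h.isCoatom_of_gammaSeries_two_lt hn (lt_of_le_of_ne gammaSeries_two_le_twoStepCentralizer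
    fun heq => ?_) hne.lt_top
  obtain ⟨x, -, hx⟩ := Set.exists_of_ssubset hne.lt_top
  have hx' : ⁅a, x⁆ ∉ gammaSeries G (i + 2) :=
    fun h' => hx ((h.mem_twoStepCentralizer_iff hn hi ha ha').2 h')
  apply h.zpowers_sup_ne_top hn x
  rw [eq_top_iff]
  intro y _
  obtain ⟨k, hk⟩ := h.exists_pow_inv_mul_mem_gammaSeries hn (by omega : 2 ≤ i + 1)
    (commutatorElement_mem_gammaSeries_succ ha x) hx' (commutatorElement_mem_gammaSeries_succ ha y)
  have h1 : (x ^ k)⁻¹ * y ∈ twoStepCentralizer G i := by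
    rw [h.mem_twoStepCentralizer_iff hn hi ha ha', ← mem_ker_commutatorHom ha, MonoidHom.mem_ker,
      map_mul, map_inv, map_pow]
    ext
    have := (QuotientGroup.eq_one_iff _).2 hk
    simpa [commutatorHom] using this
  rw [← heq] at h1
  have := mul_mem ((le_sup_left : _ ≤ Subgroup.zpowers x ⊔ gammaSeries G 2)
    (pow_mem (Subgroup.mem_zpowers x) k)) ((le_sup_right : gammaSeries G 2 ≤ _) h1)
  simpa using this

theorem isCoatom_gOne (h : IsMaximalClass G p n) (hn : 4 ≤ n) : IsCoatom (gOne G) := by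
  rw [gOne_eq_twoStepCentralizer]
  exact h.isCoatom_twoStepCentralizer le_rfl hn

end IsMaximalClass

/-- `s` acts nontrivially on every section `γ_i / γ_{i+2}`. -/
def IsUniserialElement (n : ℕ) {G : Type*} [Group G] (s : G) : Prop :=
  ∀ i, 2 ≤ i → i + 2 ≤ n → s ∉ twoStepCentralizer G i

/-! ### Uniserial elements -/

namespace IsUniserialElement

variable {G : Type*} [Group G] {p n : ℕ} [hp : Fact p.Prime] {s : G}

theorem not_mem_gOne (hs : IsUniserialElement n s) (hn : 4 ≤ n) : s ∉ gOne G := by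
  rw [gOne_eq_twoStepCentralizer]
  exact hs 2 le_rfl hn

theorem mem_of_commutatorElement_mem (hs : IsUniserialElement n s) (h : IsMaximalClass G p n)
    {i : ℕ} (hi : 2 ≤ i) (hin : i + 2 ≤ n) {a : G} (ha : a ∈ gammaSeries G i)
    (has : ⁅a, s⁆ ∈ gammaSeries G (i + 2)) : a ∈ gammaSeries G (i + 1) := by
  by_contra ha'
  exact hs i hi hin ((h.mem_twoStepCentralizer_iff (by omega) hi ha ha').2 has)

end IsUniserialElement

/-- The three subgroups lemma modulo a normal subgroup. -/
theorem commutator_commutator_le_of_rotate {G : Type*} [Group G] {H₁ H₂ H₃ N : Subgroup G}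
    [hN : N.Normal] (h1 : ⁅⁅H₂, H₃⁆, H₁⁆ ≤ N) (h2 : ⁅⁅H₃, H₁⁆, H₂⁆ ≤ N) :
    ⁅⁅H₁, H₂⁆, H₃⁆ ≤ N := by
  have key : ∀ K : Subgroup G, K ≤ N ↔ K.map (QuotientGroup.mk' N) = ⊥ := by
    intro K
    rw [Subgroup.map_eq_bot_iff, QuotientGroup.ker_mk']
  rw [key, Subgroup.map_commutator, Subgroup.map_commutator] at *
  exact Subgroup.commutator_commutator_eq_bot_of_rotate h1 h2

theorem IsMetabelianGroup.commute {G : Type*} [Group G] (hG : IsMetabelianGroup G) {a b : G}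
    (ha : a ∈ gammaSeries G 2) (hb : b ∈ gammaSeries G 2) : a * b = b * a := by
  rw [← commutatorElement_eq_one_iff_mul_comm, ← Subgroup.mem_bot]
  have : ⁅a, b⁆ ∈ derivedSeries G 2 := Subgroup.commutator_mem_commutator
    (H₁ := derivedSeries G 1) (H₂ := derivedSeries G 1) ha hb
  rwa [hG] at this

/-! ### The centre and normal subgroups -/

namespace IsMaximalClass

variable {G : Type*} [Group G] {p n : ℕ}

theorem mul_comm_of_mem_last (h : IsMaximalClass G p n) {z : G}
    (hz : z ∈ gammaSeries G (n - 1)) (x : G) : z * x = x * z := by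
  have := h.1
  rw [← commutatorElement_eq_one_iff_mul_comm]
  exact h.eq_one_of_mem (by omega) (commutatorElement_mem_gammaSeries_succ hz x)

theorem conj_eq_of_mem_last (h : IsMaximalClass G p n) {z : G}
    (hz : z ∈ gammaSeries G (n - 1)) (x : G) : x * z * x⁻¹ = z := by
  rw [← h.mul_comm_of_mem_last hz x, mul_inv_cancel_right]

variable [hp : Fact p.Prime]

/-- A normal subgroup meeting `γ_m ∖ γ_{m+1}` contains `γ_m`. -/
theorem gammaSeries_le_of_mem (h : IsMaximalClass G p n) (hn : 3 ≤ n) {N : Subgroup G}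
    [hN : N.Normal] {m : ℕ} (hm : 2 ≤ m) {d : G} (hd : d ∈ gammaSeries G m)
    (hd' : d ∉ gammaSeries G (m + 1)) (hdN : d ∈ N) : gammaSeries G m ≤ N := by
  have := h.finite
  have key : ∀ j, m ≤ j → gammaSeries G j ≤ N ⊔ gammaSeries G (j + 1) := by
    intro j hj
    induction j, hj using Nat.le_induction with
    | base =>
      intro b hb
      obtain ⟨k, hk⟩ := h.exists_pow_inv_mul_mem_gammaSeries hn hm hd hd' hb
      have := mul_mem ((le_sup_left : N ≤ N ⊔ gammaSeries G (m + 1)) (pow_mem hdN k))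
        ((le_sup_right : _ ≤ N ⊔ gammaSeries G (m + 1)) hk)
      rwa [mul_inv_cancel_left] at this
    | succ j hj ih =>
      rw [gammaSeries_succ (by omega : 1 ≤ j), Subgroup.commutator_le]
      intro x hx y _
      obtain ⟨u, hu, v, hv, rfl⟩ := Subgroup.mem_sup_of_normal_left.1 (ih hx)
      rw [commutatorElement_mul_left_eq_conj_mul]
      refine mul_mem ((le_sup_right : _ ≤ N ⊔ gammaSeries G (j + 1 + 1)) ?_)
        ((le_sup_left : N ≤ _) ?_)
      · exact conj_mem_gammaSeries (commutatorElement_mem_gammaSeries_succ hv y) u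
      · rw [commutatorElement_def, mul_assoc, mul_assoc, ← mul_assoc y]
        exact mul_mem hu (hN.conj_mem _ (inv_mem hu) y)
  have key2 : ∀ j, m ≤ j → gammaSeries G m ≤ N ⊔ gammaSeries G j := by
    intro j hj
    induction j, hj using Nat.le_induction with
    | base => exact le_sup_right
    | succ j hj ih => exact ih.trans (sup_le le_sup_left (key j hj))
  have := key2 (max m n) (le_max_left _ _)
  rwa [h.gammaSeries_eq_bot (le_max_right _ _), sup_bot_eq] at this

end IsMaximalClass

/-! ### Conjugacy classes and p-th powers of uniserial elements -/

namespace IsUniserialElement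

variable {G : Type*} [Group G] {p n : ℕ} [hp : Fact p.Prime] {s : G}

/-- Commutation with s moves a element of γ_i ∖ γ_{i+1} exactly one step down, for i + 2 ≤ n; an
element that is killed must therefore sit in the last step. -/
theorem mem_last_of_commutator_eq_one (hs : IsUniserialElement n s) (h : IsMaximalClass G p n)
    {a : G} (ha : a ∈ gammaSeries G 2) (has : ⁅a, s⁆ = 1) : a ∈ gammaSeries G (n - 1) := by
  have key : ∀ i, 2 ≤ i → i ≤ n - 1 → a ∈ gammaSeries G i := by
    intro i hi
    induction i, hi using Nat.le_induction with
    | base => exact fun _ => ha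
    | succ i hi ih =>
      exact fun hin => hs.mem_of_commutatorElement_mem h hi (by omega) (ih (by omega))
        (has ▸ one_mem _)
  rcases le_or_gt 3 n with h3 | h3
  · exact key (n - 1) (by omega) le_rfl
  · exact gammaSeries_antitone (by omega) ha

/-- The first step of the descent, from G₁ / γ₂ to γ₂ / γ₃, needs its own argument: an a in G₁ ∖ γ₂
generates G together with s modulo γ₂, so [a, s] ∈ γ₃ would give γ₂ = γ₃. -/
theorem mem_two_of_commutatorElement_mem (hs : IsUniserialElement n s)
    (h : IsMaximalClass G p n) (hn : 4 ≤ n) {a : G} (ha : a ∈ gOne G)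
    (has : ⁅a, s⁆ ∈ gammaSeries G 3) : a ∈ gammaSeries G 2 := by
  by_contra ha2
  have hs1 := hs.not_mem_gOne hn
  have hs2 : s ∉ gammaSeries G 2 := fun h' =>
    hs1 ((h.gammaSeries_two_lt_of_isCoatom (by omega) (h.isCoatom_gOne hn)).le h')
  have htop : ∀ K : Subgroup G, gammaSeries G 2 ≤ K → a ∈ K → s ∈ K → K = ⊤ := by
    intro K hK haK hsK
    have hlt : ∀ x ∈ K, x ∉ gammaSeries G 2 → gammaSeries G 2 < K := fun x hx hx' =>
      lt_of_le_of_ne hK fun heq => hx' (heq ▸ hx)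
    by_contra hne
    have hc := h.isCoatom_of_gammaSeries_two_lt (by omega) (hlt a haK ha2) (lt_top_iff_ne_top.2 hne)
    exact hs1 (h.isCoatom_eq_of_mem (by omega) hc (h.isCoatom_gOne hn) haK ha ha2 ▸ hsK)
  have hmem : ∀ y x : G, ⁅y, a⁆ ∈ gammaSeries G 3 → ⁅y, s⁆ ∈ gammaSeries G 3 →
      ⁅y, x⁆ ∈ gammaSeries G 3 := by
    intro y x h1 h2
    have hy : y ∈ gammaSeries G 1 := Subgroup.mem_top y
    have := htop _ (gammaSeries_two_le_ker_commutatorHom hy) ((mem_ker_commutatorHom hy).2 h1)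
      ((mem_ker_commutatorHom hy).2 h2)
    exact (mem_ker_commutatorHom hy).1 (this ▸ Subgroup.mem_top x)
  have hinv : ∀ x y : G, ⁅x, y⁆ ∈ gammaSeries G 3 → ⁅y, x⁆ ∈ gammaSeries G 3 := by
    intro x y hxy
    rw [← commutatorElement_inv]; exact inv_mem hxy
  have ha' : ∀ x, ⁅a, x⁆ ∈ gammaSeries G 3 := fun x => hmem a x (by simp) has
  have hs' : ∀ x, ⁅s, x⁆ ∈ gammaSeries G 3 := fun x => hmem s x (hinv _ _ has) (by simp)
  refine (h.gammaSeries_succ_lt (by omega : 1 ≤ 2) (by omega)).not_ge ?_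
  rw [gammaSeries_succ (i := 1) le_rfl, Subgroup.commutator_le]
  exact fun y _ x _ => hmem y x (hinv _ _ (ha' y)) (hinv _ _ (hs' y))

theorem mem_last_of_commute (hs : IsUniserialElement n s) (h : IsMaximalClass G p n)
    (hn : 4 ≤ n) {a : G} (ha : a ∈ gOne G) (has : ⁅a, s⁆ = 1) : a ∈ gammaSeries G (n - 1) :=
  hs.mem_last_of_commutator_eq_one h
    (hs.mem_two_of_commutatorElement_mem h hn ha (has ▸ one_mem _)) has

theorem pow_prime_mem_last (hs : IsUniserialElement n s) (h : IsMaximalClass G p n)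
    (hn : 3 ≤ n) : s ^ p ∈ gammaSeries G (n - 1) :=
  hs.mem_last_of_commutator_eq_one h (h.pow_prime_mem_gammaSeries_two hn s)
    (commutatorElement_eq_one_iff_mul_comm.2 ((Commute.refl s).pow_left p))

/-- The coset `γ₂ s` of a uniserial element is a conjugacy class. -/
theorem exists_conj_eq (hs : IsUniserialElement n s) (h : IsMaximalClass G p n)
    (hn : 4 ≤ n) {a : G} (ha : a ∈ gammaSeries G 2) : ∃ x, x * s * x⁻¹ = a * s := by
  have := h.finite
  have hle : gammaSeries G (n - 1) ≤ gOne G := (gammaSeries_antitone (by omega)).trans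
    (h.gammaSeries_two_lt_of_isCoatom (by omega) (h.isCoatom_gOne hn)).le
  -- The map x ↦ [x, s] is well defined on G₁ / γ_{n-1} because γ_{n-1} is central, and injective
  -- because only γ_{n-1} centralizes s inside G₁. Source and target both have order p^(n-2), so it
  -- is onto γ₂.
  let f : gOne G ⧸ (gammaSeries G (n - 1)).subgroupOf (gOne G) → gammaSeries G 2 :=
    Quotient.lift (fun x : gOne G => ⟨⁅(x : G), s⁆,
      commutatorElement_mem_gammaSeries_succ (i := 1) (Subgroup.mem_top _) s⟩) fun x y hxy => by
        have hxy' := QuotientGroup.leftRel_apply.1 hxy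
        rw [Subgroup.mem_subgroupOf] at hxy'
        have h1 := h.conj_eq_of_mem_last hxy' s
        apply Subtype.ext
        simp only [Subgroup.coe_mul, Subgroup.coe_inv] at h1
        simp only [commutatorElement_def]
        have h3 : (x : G)⁻¹ * y * s * ((x : G)⁻¹ * y)⁻¹ = s := by
          rw [h.mul_comm_of_mem_last (by simpa using hxy') s, mul_inv_cancel_right]
        calc (x : G) * s * (x : G)⁻¹ * s⁻¹
            = x * ((x : G)⁻¹ * y * s * ((x : G)⁻¹ * y)⁻¹) * (x : G)⁻¹ * s⁻¹ := by rw [h3]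
          _ = y * s * (y : G)⁻¹ * s⁻¹ := by group
  have hf : Function.Injective f := by
    intro u v
    refine Quotient.inductionOn₂ u v fun x y hxy => ?_
    have h1 : ⁅(x : G), s⁆ = ⁅(y : G), s⁆ := congrArg Subtype.val hxy
    refine Quotient.sound (QuotientGroup.leftRel_apply.2 ?_)
    rw [Subgroup.mem_subgroupOf]
    refine hs.mem_last_of_commute h hn (x⁻¹ * y).2 ?_
    rw [commutatorElement_def, commutatorElement_def] at h1
    rw [commutatorElement_eq_one_iff_mul_comm]
    have h2 : (x : G) * s * (x : G)⁻¹ = y * s * (y : G)⁻¹ := mul_right_cancel h1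
    simp only [Subgroup.coe_mul, Subgroup.coe_inv]
    calc (x : G)⁻¹ * y * s = (x : G)⁻¹ * (y * s * (y : G)⁻¹) * y := by group
      _ = (x : G)⁻¹ * (x * s * (x : G)⁻¹) * y := by rw [h2]
      _ = _ := by group
  have hcard : Nat.card (gammaSeries G 2) ≤
      Nat.card (gOne G ⧸ (gammaSeries G (n - 1)).subgroupOf (gOne G)) := by
    have h1 := Subgroup.card_mul_index ((gammaSeries G (n - 1)).subgroupOf (gOne G))
    rw [Nat.card_congr (Subgroup.subgroupOfEquivOfLe hle).toEquiv,
      h.card_gammaSeries (by omega) (by omega) (by omega),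
      h.card_of_isCoatom (by omega) (h.isCoatom_gOne hn)] at h1
    rw [h.card_gammaSeries (by omega) le_rfl (by omega)]
    refine Nat.le_of_mul_le_mul_left (le_of_eq ?_) (pow_pos hp.out.pos (n - (n - 1)))
    refine Eq.trans ?_ h1.symm
    rw [← pow_add]; congr 1; omega
  obtain ⟨u, hu⟩ := ((Nat.bijective_iff_injective_and_card f).2
    ⟨hf, le_antisymm (Nat.card_le_card_of_injective f hf) hcard⟩).2 ⟨a, ha⟩
  revert hu
  refine Quotient.inductionOn u fun x hx => ⟨x, ?_⟩
  have h1 : ⁅(x : G), s⁆ = a := congrArg Subtype.val hx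
  rw [← h1, commutatorElement_def, inv_mul_cancel_right]

/-- The elements as and s are conjugate, and their p-th powers are central. -/
theorem mul_pow_prime (hs : IsUniserialElement n s) (h : IsMaximalClass G p n)
    (hn : 4 ≤ n) {a : G} (ha : a ∈ gammaSeries G 2) : (a * s) ^ p = s ^ p := by
  obtain ⟨x, hx⟩ := hs.exists_conj_eq h hn ha
  rw [← hx, conj_pow, h.conj_eq_of_mem_last (hs.pow_prime_mem_last h (by omega))]

theorem commutatorElement_notMem (hs : IsUniserialElement n s) (h : IsMaximalClass G p n)
    {i : ℕ} (hi : 2 ≤ i) (hin : i + 2 ≤ n) {a : G} (ha : a ∈ gammaSeries G i)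
    (ha' : a ∉ gammaSeries G (i + 1)) : ⁅s, a⁆ ∉ gammaSeries G (i + 2) := fun h' =>
  ha' (hs.mem_of_commutatorElement_mem h hi hin ha (by
    rw [← commutatorElement_inv]; exact inv_mem h'))

end IsUniserialElement

/-- `G₁` has nilpotency class at most two. -/
def GOneClassLETwo (G : Type*) [Group G] : Prop :=
  ∀ a ∈ gOne G, ∀ b ∈ gOne G, ∀ c ∈ gOne G, ⁅⁅a, b⁆, c⁆ = 1

theorem commutator_commutator_eq_one_of_class_le_two {G : Type*} [Group G] {M : Subgroup G}
    [Group.IsNilpotent M] (hM : Group.nilpotencyClass M ≤ 2) {a b c : G} (ha : a ∈ M) (hb : b ∈ M)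
    (hc : c ∈ M) : ⁅⁅a, b⁆, c⁆ = 1 := by
  have h1 := (Subgroup.lowerCentralSeries_eq_bot_iff_nilpotencyClass_le (G := M)).2 hM
  have h2 : ⁅⁅(⟨a, ha⟩ : M), (⟨b, hb⟩ : M)⁆, (⟨c, hc⟩ : M)⁆ ∈ (⊤ : Subgroup M).lowerCentralSeries 2 :=
    Subgroup.commutator_mem_commutator
      (Subgroup.commutator_mem_commutator (Subgroup.mem_top _) (Subgroup.mem_top _))
      (Subgroup.mem_top _)
  rw [h1, Subgroup.mem_bot] at h2
  exact congrArg Subtype.val h2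

/-! ### The two hypotheses: G metabelian, or G₁ of class at most two -/

namespace IsMaximalClass

variable {G : Type*} [Group G] {p n : ℕ} [hp : Fact p.Prime]

theorem gammaSeries_two_le_gOne (h : IsMaximalClass G p n) (hn : 4 ≤ n) :
    gammaSeries G 2 ≤ gOne G :=
  (h.gammaSeries_two_lt_of_isCoatom (by omega) (h.isCoatom_gOne hn)).le

theorem gOne_normal (h : IsMaximalClass G p n) (hn : 4 ≤ n) : (gOne G).Normal :=
  normal_of_gammaSeries_two_le (h.gammaSeries_two_le_gOne hn)

/-- Induction with the three subgroups lemma for γ_i, G, G₁: one rotation lies in [γ₂, γ₂] = 1, and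
the other is controlled by the previous step. -/
theorem commutator_gOne_le_of_metabelian (hG : IsMetabelianGroup G) {i : ℕ} (hi : 2 ≤ i) :
    ⁅gammaSeries G i, gOne G⁆ ≤ gammaSeries G (i + 2) := by
  induction i, hi using Nat.le_induction with
  | base =>
    rw [Subgroup.commutator_le, gOne_eq_twoStepCentralizer]
    exact fun a ha x hx => hx a ha
  | succ i hi ih =>
    rw [gammaSeries_succ (by omega : 1 ≤ i)]
    refine commutator_commutator_le_of_rotate ?_ ?_
    · rw [Subgroup.commutator_le]
      intro a ha b hb
      have ha' : a ∈ gammaSeries G 2 := by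
        rw [gammaSeries_succ (i := 1) le_rfl]
        exact Subgroup.commutator_mono le_rfl le_top ha
      rw [commutatorElement_eq_one_iff_mul_comm.2
        (hG.commute ha' (gammaSeries_antitone (by omega) hb))]
      exact one_mem _
    · rw [show i + 1 + 2 = (i + 2) + 1 by omega, gammaSeries_succ (by omega : 1 ≤ i + 2),
        Subgroup.commutator_comm (gOne G)]
      exact Subgroup.commutator_mono ih le_rfl

theorem isUniserialElement_of_metabelian (h : IsMaximalClass G p n) (hn : 4 ≤ n)
    (hG : IsMetabelianGroup G) {s : G} (hs : s ∉ gOne G) : IsUniserialElement n s := by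
  intro i hi hin hsi
  have hle : gOne G ≤ twoStepCentralizer G i := fun x hx a ha =>
    commutator_gOne_le_of_metabelian hG hi (Subgroup.commutator_mem_commutator ha hx)
  have := ((h.isCoatom_gOne hn).le_iff_eq (h.isCoatom_twoStepCentralizer hi hin).1).1 hle
  exact hs (this ▸ hsi)

/-- Suppose M ≠ G₁ has class at most two, with x in M ∖ G₁ and a in γ₂ ∖ γ₃. Then [a, x] lies
outside γ₄ and centralizes M, so the normal subgroup C_G(M) contains γ₃. Since γ₂ = ⟨a⟩γ₃ lies in M,
it is abelian. -/
theorem metabelian_or_gOneClassLETwo (h : IsMaximalClass G p n) (hn : 4 ≤ n)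
    (hM : HasMaximalSubgroupOfClassLETwo G) : IsMetabelianGroup G ∨ GOneClassLETwo G := by
  obtain ⟨M, hMc, hnil, hcl⟩ := hM
  have hcomm : ∀ {a b c : G}, a ∈ M → b ∈ M → c ∈ M → ⁅⁅a, b⁆, c⁆ = 1 := fun ha hb hc =>
    commutator_commutator_eq_one_of_class_le_two hcl ha hb hc
  by_cases hMG : M = gOne G
  · subst hMG
    exact Or.inr fun a ha b hb c hc => hcomm ha hb hc
  left
  have := h.finite
  have h2 := (h.gammaSeries_two_lt_of_isCoatom (by omega) hMc).le
  have hMn : M.Normal := normal_of_gammaSeries_two_le h2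
  obtain ⟨x, hxM, hx⟩ : ∃ x ∈ M, x ∉ gOne G := by
    by_contra hcon
    push Not at hcon
    exact hMG ((hMc.le_iff_eq (h.isCoatom_gOne hn).1).1 hcon).symm
  obtain ⟨a, ha, ha'⟩ := Set.exists_of_ssubset (h.gammaSeries_succ_lt (by omega : 1 ≤ 2) (by omega))
  rw [gOne_eq_twoStepCentralizer, h.mem_twoStepCentralizer_iff (by omega) le_rfl ha ha'] at hx
  have h3 : gammaSeries G 3 ≤ Subgroup.centralizer (M : Set G) := by
    refine h.gammaSeries_le_of_mem (by omega) (by omega)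
      (commutatorElement_mem_gammaSeries_succ ha x) hx ?_
    rw [Subgroup.mem_centralizer_iff]
    intro m hm
    exact (commutatorElement_eq_one_iff_mul_comm.1 (hcomm (h2 ha) hxM hm)).symm
  have h4 : ∀ u ∈ gammaSeries G 2, ∃ k : ℕ, ∃ v ∈ gammaSeries G 3, u = a ^ k * v := by
    intro u hu
    obtain ⟨k, hk⟩ := h.exists_pow_inv_mul_mem_gammaSeries (by omega) le_rfl ha ha' hu
    exact ⟨k, _, hk, by group⟩
  rw [IsMetabelianGroup, eq_bot_iff]
  change ⁅gammaSeries G 2, gammaSeries G 2⁆ ≤ ⊥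
  rw [Subgroup.commutator_le]
  intro u hu w hw
  rw [Subgroup.mem_bot, commutatorElement_eq_one_iff_commute]
  have hcen : ∀ v ∈ gammaSeries G 3, ∀ m ∈ M, Commute v m := fun v hv m hm =>
    (Subgroup.mem_centralizer_iff.1 (h3 hv) m hm).symm
  obtain ⟨k, v, hv, rfl⟩ := h4 u hu
  obtain ⟨l, v', hv', rfl⟩ := h4 w hw
  exact ((Commute.pow_pow_self a k l).mul_right (hcen v' hv' _ (pow_mem (h2 ha) k)).symm).mul_left
    (hcen v hv _ (h2 hw))

theorem metabelian_or_gOneClassLETwo_of_inFamily (h : InFamily G p n) (hn : 4 ≤ n) :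
    IsMetabelianGroup G ∨ GOneClassLETwo G :=
  h.2.2.elim Or.inl (h.1.metabelian_or_gOneClassLETwo hn)

/-- If `G₁` has class at most two and `[γ_i, G₁] ≰ γ_{i+2}`, then `G₁` centralizes `γ_{i+1}`. -/
theorem gammaSeries_succ_le_centralizer_gOne (h : IsMaximalClass G p n) (hn : 4 ≤ n)
    (hC : GOneClassLETwo G) {i : ℕ} (hi : 2 ≤ i) (hbad : ¬ gOne G ≤ twoStepCentralizer G i) :
    gammaSeries G (i + 1) ≤ Subgroup.centralizer (gOne G : Set G) := by
  have := h.gOne_normal hn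
  obtain ⟨g, hg, hgi⟩ := Set.not_subset.1 hbad
  simp only [SetLike.mem_coe, mem_twoStepCentralizer, not_forall] at hgi
  obtain ⟨a, ha, hag⟩ := hgi
  refine h.gammaSeries_le_of_mem (by omega) (by omega)
    (commutatorElement_mem_gammaSeries_succ ha g) hag ?_
  rw [Subgroup.mem_centralizer_iff]
  intro m hm
  exact (commutatorElement_eq_one_iff_mul_comm.1 (hC a
    (h.gammaSeries_two_le_gOne hn (gammaSeries_antitone hi ha)) g hg m hm)).symm

theorem le_twoStepCentralizer_of_le_centralizer {i : ℕ}
    (hle : gammaSeries G i ≤ Subgroup.centralizer (gOne G : Set G)) :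
    gOne G ≤ twoStepCentralizer G i := by
  intro g hg a ha
  rw [commutatorElement_eq_one_iff_mul_comm.2
    (Subgroup.mem_centralizer_iff.1 (hle ha) g hg).symm]
  exact one_mem _

theorem twoStepCentralizer_eq_gOne (h : IsMaximalClass G p n) (hn : 4 ≤ n) {i : ℕ} (hi : 2 ≤ i)
    (hin : i + 2 ≤ n) (hle : gOne G ≤ twoStepCentralizer G i) : twoStepCentralizer G i = gOne G :=
  ((h.isCoatom_gOne hn).le_iff_eq (h.isCoatom_twoStepCentralizer hi hin).1).1 hle

/-- All but at most one of the two-step centralizers are equal to `G₁`. -/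
theorem exists_isCoatom_isUniserialElement (h : IsMaximalClass G p n) (hn : 4 ≤ n)
    (hC : GOneClassLETwo G) : ∃ C : Subgroup G, IsCoatom C ∧
      ∀ s, s ∉ gOne G → s ∉ C → IsUniserialElement n s := by
  by_cases hb : ∃ i, 2 ≤ i ∧ i + 2 ≤ n ∧ ¬ gOne G ≤ twoStepCentralizer G i
  · obtain ⟨i, hi, hin, hbad⟩ := hb
    refine ⟨_, h.isCoatom_twoStepCentralizer hi hin, fun s hs hsC j hj hjn hsj => ?_⟩
    by_cases hbj : gOne G ≤ twoStepCentralizer G j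
    · exact hs (h.twoStepCentralizer_eq_gOne hn hj hjn hbj ▸ hsj)
    -- At an exceptional index k the subgroup G₁ centralizes γ_{k+1}, so no later index can be
    -- exceptional.
    have key : ∀ {k l : ℕ}, 2 ≤ k → k < l → ¬ gOne G ≤ twoStepCentralizer G k →
        gOne G ≤ twoStepCentralizer G l := fun hk hkl hbk =>
      le_twoStepCentralizer_of_le_centralizer ((gammaSeries_antitone hkl).trans
        (h.gammaSeries_succ_le_centralizer_gOne hn hC hk hbk))
    rcases lt_trichotomy i j with hij | rfl | hij
    · exact hbj (key hi hij hbad)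
    · exact hsC hsj
    · exact hbad (key hj hij hbj)
  · push Not at hb
    refine ⟨_, h.isCoatom_gOne hn, fun s hs _ j hj hjn hsj => ?_⟩
    exact hs (h.twoStepCentralizer_eq_gOne hn hj hjn (hb j hj hjn) ▸ hsj)

theorem exists_notMem_notMem {M N : Subgroup G} (hM : IsCoatom M) (hN : IsCoatom N) :
    ∃ s, s ∉ M ∧ s ∉ N := by
  by_contra hcon
  push Not at hcon
  obtain ⟨x, -, hx⟩ := Set.exists_of_ssubset hM.lt_top
  have hxN := hcon x hx
  obtain ⟨y, -, hy⟩ := Set.exists_of_ssubset hN.lt_top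
  have hyM : y ∈ M := by
    by_contra hyM; exact hy (hcon y hyM)
  have h1 : x * y ∉ M := fun h' => hx ((Subgroup.mul_mem_cancel_right _ hyM).1 h')
  exact hy ((Subgroup.mul_mem_cancel_left _ hxN).1 (hcon _ h1))

/-- Because γ₂ is generated by one element modulo γ₃, [γ₂, γ₂] already lies in [γ₂, γ₃]-type
commutators, hence in γ₅. The three subgroups lemma for γ₂, G, G₁ then gives [γ₃, G₁] ≤ γ₅. -/
theorem gOne_le_twoStepCentralizer_three (h : IsMaximalClass G p n) (hn : 4 ≤ n) :
    gOne G ≤ twoStepCentralizer G 3 := by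
  have := h.finite
  have h22 : ⁅gammaSeries G 2, gammaSeries G 2⁆ ≤ gammaSeries G 5 := by
    obtain ⟨a, ha, ha'⟩ :=
      Set.exists_of_ssubset (h.gammaSeries_succ_lt (by omega : 1 ≤ 2) (by omega))
    have h32 : ∀ u ∈ gammaSeries G 3, ∀ v ∈ gammaSeries G 2, ⁅u, v⁆ ∈ gammaSeries G 5 :=
      fun u hu v hv => gammaSeries_two_le_twoStepCentralizer hv u hu
    have h23 : ∀ u ∈ gammaSeries G 2, ∀ v ∈ gammaSeries G 3, ⁅u, v⁆ ∈ gammaSeries G 5 := by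
      intro u hu v hv
      rw [← commutatorElement_inv]; exact inv_mem (h32 v hv u hu)
    have h4 : ∀ u ∈ gammaSeries G 2, ∃ k : ℕ, ∃ v ∈ gammaSeries G 3, u = a ^ k * v := by
      intro u hu
      obtain ⟨k, hk⟩ := h.exists_pow_inv_mul_mem_gammaSeries (by omega) le_rfl ha ha' hu
      exact ⟨k, _, hk, by group⟩
    rw [Subgroup.commutator_le]
    intro u hu w hw
    obtain ⟨k, v, hv, rfl⟩ := h4 u hu
    obtain ⟨l, v', hv', rfl⟩ := h4 w hw
    rw [commutatorElement_mul_left_eq_conj_mul]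
    refine mul_mem (conj_mem_gammaSeries (h32 v hv _ hw) _) ?_
    rw [commutatorElement_mul_right_eq_mul_conj,
      (Commute.pow_pow_self a k l).commutator_eq, one_mul]
    exact conj_mem_gammaSeries (h23 _ (pow_mem ha k) _ hv') _
  intro x hx a ha
  rw [gammaSeries_succ (i := 2) (by omega)] at ha
  refine (commutator_commutator_le_of_rotate (N := gammaSeries G 5) ?_ ?_)
    (Subgroup.commutator_mem_commutator ha hx)
  · refine (Subgroup.commutator_mono ?_ le_rfl).trans h22
    rw [gammaSeries_succ (i := 1) le_rfl]
    exact Subgroup.commutator_mono le_rfl le_top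
  · rw [gammaSeries_succ (i := 4) (by omega)]
    refine Subgroup.commutator_mono ?_ le_rfl
    rw [Subgroup.commutator_comm, Subgroup.commutator_le, gOne_eq_twoStepCentralizer]
    exact fun a ha x hx => hx a ha

/-- For `p ≤ 3`, every element outside `G₁` is uniserial. -/
theorem isUniserialElement_of_le_three (h : IsMaximalClass G p n) (hn : 4 ≤ n) (hp3 : p ≤ 3)
    (hC : GOneClassLETwo G) {s : G} (hs : s ∉ gOne G) : IsUniserialElement n s := by
  have hfin := h.finite
  have hle2 := h.gammaSeries_two_le_gOne hn
  have hgn := h.gOne_normal hn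
  intro i hi hin hsi
  have hbad : ¬ gOne G ≤ twoStepCentralizer G i := fun hle =>
    hs (h.twoStepCentralizer_eq_gOne hn hi hin hle ▸ hsi)
  have hi4 : 4 ≤ i := by
    rcases (by omega : i = 2 ∨ i = 3 ∨ 4 ≤ i) with rfl | rfl | hi4
    · exact absurd gOne_eq_twoStepCentralizer.le hbad
    · exact absurd (h.gOne_le_twoStepCentralizer_three hn) hbad
    · exact hi4
  obtain ⟨C, hCc, hCu⟩ := h.exists_isCoatom_isUniserialElement hn hC
  obtain ⟨t, ht, htC⟩ := exists_notMem_notMem (h.isCoatom_gOne hn) hCc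
  have htu := hCu t ht htC
  -- A commutator of G₁ in γ_j ∖ γ_{j+1} with j ≤ i would, by class two, force G₁ to centralize γ_j
  -- and thus γ_i, contrary to i being exceptional.
  have hD : ∀ a ∈ gOne G, ∀ b ∈ gOne G, ⁅a, b⁆ ∈ gammaSeries G (i + 1) := by
    intro a ha b hb
    have key : ∀ j, 2 ≤ j → j ≤ i + 1 → ⁅a, b⁆ ∈ gammaSeries G j := by
      intro j hj
      induction j, hj using Nat.le_induction with
      | base => exact fun _ => commutatorElement_mem_gammaSeries_succ (i := 1) (Subgroup.mem_top a) b
      | succ j hj ih =>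
        intro hji
        by_contra hcon
        refine hbad (le_twoStepCentralizer_of_le_centralizer
          ((gammaSeries_antitone (by omega : j ≤ i)).trans
            (h.gammaSeries_le_of_mem (by omega) hj (ih (by omega)) hcon ?_)))
        rw [Subgroup.mem_centralizer_iff]
        intro m hm
        exact (commutatorElement_eq_one_iff_mul_comm.1 (hC a ha b hb m hm)).symm
    exact key (i + 1) (by omega) le_rfl
  have hDp : ∀ a ∈ gOne G, ∀ b ∈ gOne G, ⁅a, b⁆ ^ p ∈ gammaSeries G (i + 2) := fun a ha b hb =>
    pow_prime_mem_of_card_eq_mul (gammaSeries_antitone (Nat.le_succ _))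
      (h.card_gammaSeries_succ (by omega) (by omega) (by omega)) (hD a ha b hb)
  have hf : ∀ g ∈ gOne G, ∃ f : gOne G →* Subgroup.center (gOne G),
      ∀ a, ((f a : gOne G) : G) = ⁅(a : G), g⁆ := by
    intro g hg
    have hcen : ∀ a : gOne G, ⁅a, ⟨g, hg⟩⁆ ∈ Subgroup.center (gOne G) := fun a => by
      rw [Subgroup.mem_center_iff]
      exact fun b => (commutatorElement_eq_one_iff_mul_comm.1
        (Subtype.ext (hC a a.2 g hg b b.2) : ⁅⁅a, (⟨g, hg⟩ : gOne G)⁆, b⁆ = 1)).symm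
    refine ⟨MonoidHom.mk' (fun a => ⟨⁅a, ⟨g, hg⟩⁆, hcen a⟩) fun a b => Subtype.ext ?_, fun a => rfl⟩
    change ⁅a * b, _⁆ = ⁅a, _⁆ * ⁅b, _⁆
    rw [commutatorElement_mul_left_eq_conj_mul, Subgroup.mem_center_iff.1 (hcen b) a,
      mul_inv_cancel_right, Subgroup.mem_center_iff.1 (hcen a)]
  -- With u in γ_{i-p+1} ∖ γ_{i-p+2}, take v to be the commutator of u with t, iterated p - 1 times.
  -- Expanding (ut)^p = t^p expresses a product of u, [t, u], … as 1. Applying the homomorphism [·,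
  -- g] on G₁ shows that [v, g] is an inverse product of p-th powers of commutators, which lie in
  -- γ_{i+2}.
  obtain ⟨v, hv, hv', hvf⟩ : ∃ v ∈ gammaSeries G i, v ∉ gammaSeries G (i + 1) ∧
      ∀ g ∈ gOne G, ⁅v, g⁆ ∈ gammaSeries G (i + 2) := by
    have h23 : p = 2 ∨ p = 3 := by
      have := hp.out.two_le; omega
    rcases h23 with rfl | rfl
    · obtain ⟨u, hu, hu'⟩ := Set.exists_of_ssubset
        (h.gammaSeries_succ_lt (by omega : 1 ≤ i - 1) (by omega))
      have hu2 : u ∈ gammaSeries G 2 := gammaSeries_antitone (by omega) hu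
      have e1 : i - 1 + 1 = i := by omega
      have e2 : i - 1 + 2 = i + 1 := by omega
      refine ⟨⁅t, u⁆, e1 ▸ commutatorElement_mem_gammaSeries_succ' hu t,
        e2 ▸ htu.commutatorElement_notMem h (by omega) (by omega) hu hu', fun g hg => ?_⟩
      have h1 := htu.mul_pow_prime h hn hu2
      have h2 : u * (⁅t, u⁆ * u) = 1 := by
        rw [pow_two, pow_two] at h1
        calc u * (⁅t, u⁆ * u) = (u * t * (u * t)) * t⁻¹ * t⁻¹ := by
              rw [commutatorElement_def]; group
          _ = 1 := by rw [h1]; group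
      have htu1 : ⁅t, u⁆ ∈ gOne G :=
        hle2 (commutatorElement_mem_gammaSeries_succ (i := 1) (Subgroup.mem_top t) u)
      obtain ⟨f, hf⟩ := hf g hg
      have h3 : f (⟨u, hle2 hu2⟩ * (⟨⁅t, u⁆, htu1⟩ * ⟨u, hle2 hu2⟩)) = 1 := by
        rw [← f.map_one]; exact congrArg f (Subtype.ext h2)
      have h4 : f ⟨⁅t, u⁆, htu1⟩ = (f ⟨u, hle2 hu2⟩ ^ 2)⁻¹ := by
        rw [eq_inv_iff_mul_eq_one, ← h3, map_mul, map_mul, pow_two]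
        ac_rfl
      have h5 := hf ⟨⁅t, u⁆, htu1⟩
      rw [h4] at h5
      rw [← h5]
      simpa [hf] using hDp u (hle2 hu2) g hg
    · obtain ⟨u, hu, hu'⟩ := Set.exists_of_ssubset
        (h.gammaSeries_succ_lt (by omega : 1 ≤ i - 2) (by omega))
      have hu2 : u ∈ gammaSeries G 2 := gammaSeries_antitone (by omega) hu
      have e1 : i - 2 + 1 = i - 1 := by omega
      have e2 : i - 2 + 2 = i := by omega
      have e3 : i - 1 + 1 = i := by omega
      have e4 : i - 1 + 2 = i + 1 := by omega
      have hw : ⁅t, u⁆ ∈ gammaSeries G (i - 1) := e1 ▸ commutatorElement_mem_gammaSeries_succ' hu t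
      have hw' : ⁅t, u⁆ ∉ gammaSeries G (i - 1 + 1) := by
        have := htu.commutatorElement_notMem h (by omega) (by omega) hu hu'
        rwa [e2] at this
      refine ⟨⁅t, ⁅t, u⁆⁆, e3 ▸ commutatorElement_mem_gammaSeries_succ' hw t,
        e4 ▸ htu.commutatorElement_notMem h (by omega) (by omega) hw hw', fun g hg => ?_⟩
      have h1 := htu.mul_pow_prime h hn hu2
      have h2 : u * (⁅t, u⁆ * u) * (⁅t, ⁅t, u⁆⁆ * ⁅t, u⁆ * (⁅t, u⁆ * u)) = 1 := by
        rw [pow_succ, pow_two, pow_succ, pow_two] at h1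
        calc u * (⁅t, u⁆ * u) * (⁅t, ⁅t, u⁆⁆ * ⁅t, u⁆ * (⁅t, u⁆ * u))
            = (u * t * (u * t) * (u * t)) * t⁻¹ * t⁻¹ * t⁻¹ := by
              simp only [commutatorElement_def]; group
          _ = 1 := by rw [h1]; group
      have htu1 : ⁅t, u⁆ ∈ gOne G :=
        hle2 (commutatorElement_mem_gammaSeries_succ (i := 1) (Subgroup.mem_top t) u)
      have htu2 : ⁅t, ⁅t, u⁆⁆ ∈ gOne G :=
        hle2 (commutatorElement_mem_gammaSeries_succ (i := 1) (Subgroup.mem_top t) _)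
      obtain ⟨f, hf⟩ := hf g hg
      have h3 : f (⟨u, hle2 hu2⟩ * (⟨⁅t, u⁆, htu1⟩ * ⟨u, hle2 hu2⟩) * (⟨⁅t, ⁅t, u⁆⁆, htu2⟩ *
          ⟨⁅t, u⁆, htu1⟩ * (⟨⁅t, u⁆, htu1⟩ * ⟨u, hle2 hu2⟩))) = 1 := by
        rw [← f.map_one]; exact congrArg f (Subtype.ext h2)
      have h4 : f ⟨⁅t, ⁅t, u⁆⁆, htu2⟩ =
          (f ⟨u, hle2 hu2⟩ ^ 3 * f ⟨⁅t, u⁆, htu1⟩ ^ 3)⁻¹ := by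
        rw [eq_inv_iff_mul_eq_one, ← h3]
        simp only [map_mul, pow_succ, pow_zero, one_mul]
        ac_rfl
      have h5 := hf ⟨⁅t, ⁅t, u⁆⁆, htu2⟩
      rw [h4] at h5
      rw [← h5]
      simp only [Subgroup.coe_inv, Subgroup.coe_mul, Subgroup.coe_pow, hf]
      exact inv_mem (mul_mem (hDp u (hle2 hu2) g hg) (hDp _ htu1 g hg))
  exact hbad fun g hg => (h.mem_twoStepCentralizer_iff (by omega) hi hv hv').2 (hvf g hg)

end IsMaximalClass

/-! ### Binomial sums and power sums with nilpotent elements -/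

section Ring

variable {R : Type*} [CommRing R]

open Finset

/-- `∑_{b} (m choose (a + b + 2)) π ^ b`. -/
def chooseTail (π : R) (m a : ℕ) : R := ∑ b ∈ range m, (m.choose (a + b + 2) : R) * π ^ b

theorem chooseTail_eq_sum (π : R) {m N a : ℕ} (hN : m ≤ N) :
    chooseTail π m a = ∑ b ∈ range N, (m.choose (a + b + 2) : R) * π ^ b := by
  refine sum_subset (range_subset_range.2 hN) fun b _ hb => ?_
  rw [mem_range, not_lt] at hb
  rw [Nat.choose_eq_zero_of_lt (by omega), Nat.cast_zero, zero_mul]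

theorem geom_sum_one_add (π : R) (m : ℕ) :
    ∑ l ∈ range m, (1 + π) ^ l = ∑ b ∈ range m, (m.choose (b + 1) : R) * π ^ b := by
  induction m with
  | zero => simp
  | succ m ih =>
    rw [sum_range_succ, ih, add_comm 1 π, add_pow]
    have : ∑ b ∈ range m, (m.choose (b + 1) : R) * π ^ b =
        ∑ b ∈ range (m + 1), (m.choose (b + 1) : R) * π ^ b := by
      rw [sum_range_succ, Nat.choose_succ_self, Nat.cast_zero, zero_mul, add_zero]
    rw [this, ← sum_add_distrib]
    refine sum_congr rfl fun b _ => ?_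
    rw [Nat.choose_succ_succ' m b]; push_cast; ring

theorem chooseTail_succ_zero (π : R) (m : ℕ) :
    chooseTail π (m + 1) 0 = chooseTail π m 0 + ∑ l ∈ range m, (1 + π) ^ l := by
  rw [geom_sum_one_add, chooseTail_eq_sum π (Nat.le_succ m), chooseTail, sum_range_succ,
    sum_range_succ, Nat.choose_eq_zero_of_lt (by omega : m + 1 < 0 + m + 2),
    Nat.choose_eq_zero_of_lt (by omega : m < 0 + m + 2)]
  simp only [Nat.cast_zero, zero_mul, add_zero]
  rw [← sum_add_distrib]
  refine sum_congr rfl fun b _ => ?_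
  rw [show 0 + b + 2 = b + 1 + 1 by omega, Nat.choose_succ_succ' m (b + 1)]; push_cast; ring

theorem chooseTail_succ_succ (π : R) (m a : ℕ) :
    chooseTail π (m + 1) (a + 1) = chooseTail π m (a + 1) + chooseTail π m a := by
  rw [chooseTail_eq_sum π (Nat.le_succ m), chooseTail_eq_sum π (a := a) (Nat.le_succ m), chooseTail,
    ← sum_add_distrib]
  refine sum_congr rfl fun b _ => ?_
  rw [show a + 1 + b + 2 = a + b + 2 + 1 by omega, Nat.choose_succ_succ' m (a + b + 2)]
  push_cast; ring

theorem chooseTail_eq_zero (π : R) {m a : ℕ} (h : m < a + 2) : chooseTail π m a = 0 :=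
  sum_eq_zero fun b _ => by
    rw [Nat.choose_eq_zero_of_lt (by omega), Nat.cast_zero, zero_mul]

/-- Both sides are the second divided difference of X^m at the points 1, 1 + t, 1 + π: the left side
directly, the right side after expanding X^m around 1. The induction on m is Pascal's rule for
`chooseTail`. -/
theorem sum_pow_mul_geom_sum (t π : R) (m : ℕ) :
    ∑ j ∈ range m, (1 + t) ^ (m - 1 - j) * ∑ l ∈ range j, (1 + π) ^ l =
      ∑ a ∈ range m, t ^ a * chooseTail π m a := by
  induction m with
  | zero => simp
  | succ m ih =>
    have h1 : ∑ j ∈ range m, (1 + t) ^ (m + 1 - 1 - j) * ∑ l ∈ range j, (1 + π) ^ l =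
        (1 + t) * ∑ j ∈ range m, (1 + t) ^ (m - 1 - j) * ∑ l ∈ range j, (1 + π) ^ l := by
      rw [mul_sum]
      refine sum_congr rfl fun j hj => ?_
      rw [mem_range] at hj
      rw [show m + 1 - 1 - j = (m - 1 - j) + 1 by omega, pow_succ]; ring
    rw [sum_range_succ, h1, ih, sum_range_succ', chooseTail_succ_zero,
      Nat.add_sub_cancel, Nat.sub_self]
    simp only [chooseTail_succ_succ, mul_add, sum_add_distrib, pow_zero, one_mul, add_mul]
    have h2 : ∑ a ∈ range m, t ^ a * chooseTail π m a =
        ∑ a ∈ range m, t ^ (a + 1) * chooseTail π m (a + 1) + chooseTail π m 0 := by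
      have := sum_range_succ' (fun a => t ^ a * chooseTail π m a) m
      rw [sum_range_succ, chooseTail_eq_zero π (by omega : m < m + 2), mul_zero, add_zero] at this
      simpa using this
    have h3 : t * ∑ a ∈ range m, t ^ a * chooseTail π m a =
        ∑ a ∈ range m, t ^ (a + 1) * chooseTail π m a := by
      rw [mul_sum]; exact sum_congr rfl fun a _ => by ring
    rw [h3, h2]; ring

theorem exists_choose_eq_mul {p : ℕ} (hp : p.Prime) :
    ∃ d : ℕ → ℕ, d 1 = 1 ∧ ∀ k, 0 < k → k < p → p.choose k = p * d k := by
  refine ⟨fun k => p.choose k / p, ?_, fun k hk hkp => ?_⟩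
  · simp [Nat.div_self hp.pos]
  · exact (Nat.mul_div_cancel' (hp.dvd_choose_self hk.ne' hkp)).symm

/-- `∑_{l < p} (1 + π) ^ l = p (1 + π w) + π ^ (p - 1)` for some `w`. -/
theorem exists_geom_sum_eq {p : ℕ} (hp : p.Prime) (π : R) :
    ∃ w : R, ∑ l ∈ range p, (1 + π) ^ l = p * (1 + π * w) + π ^ (p - 1) := by
  obtain ⟨d, hd1, hd⟩ := exists_choose_eq_mul hp
  obtain ⟨m, rfl⟩ : ∃ m, p = m + 2 := ⟨p - 2, by have := hp.two_le; omega⟩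
  refine ⟨∑ b ∈ range m, (d (b + 2) : R) * π ^ b, ?_⟩
  rw [geom_sum_one_add, sum_range_succ, sum_range_succ']
  simp only [zero_add, Nat.choose_self, Nat.choose_one_right, pow_zero, mul_one, Nat.cast_one,
    one_mul, mul_add, mul_sum, show m + 2 - 1 = m + 1 by omega]
  rw [add_comm (((m + 2 : ℕ) : R))]
  congr 2
  refine sum_congr rfl fun b hb => ?_
  rw [mem_range] at hb
  rw [hd _ (by omega) (by omega)]
  push_cast; ring

theorem isUnit_one_add_mul {π : R} (hπ : IsNilpotent π) (w : R) : IsUnit (1 + π * w) :=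
  IsNilpotent.isUnit_one_add (Commute.isNilpotent_mul_right (Commute.all _ _) hπ)

/-- If `∑_{l < p} (1 + π) ^ l = 0` with `π` nilpotent, then `p` is a multiple of `π ^ (p - 1)`. -/
theorem exists_natCast_eq_of_geom_sum_eq_zero {p : ℕ} (hp : p.Prime) {π : R} (hπ : IsNilpotent π)
    (hν : ∑ l ∈ range p, (1 + π) ^ l = 0) :
    ∃ u : Rˣ, (p : R) = -(π ^ (p - 1) * (↑u⁻¹ : R)) := by
  obtain ⟨w, hw⟩ := exists_geom_sum_eq hp π
  obtain ⟨u, hu⟩ := isUnit_one_add_mul hπ w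
  refine ⟨u, ?_⟩
  rw [hν, ← hu] at hw
  have : (p : R) * u = -π ^ (p - 1) := by linear_combination -hw
  rw [← Units.eq_mul_inv_iff_mul_eq] at this
  rw [this]; ring

theorem exists_chooseTail_zero_eq {p : ℕ} (hp : p.Prime) (π : R) :
    ∃ d : R, chooseTail π p 0 = π ^ (p - 2) + p * d := by
  obtain ⟨d, -, hd⟩ := exists_choose_eq_mul hp
  obtain ⟨m, rfl⟩ : ∃ m, p = m + 2 := ⟨p - 2, by have := hp.two_le; omega⟩
  refine ⟨∑ b ∈ range m, (d (b + 2) : R) * π ^ b, ?_⟩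
  rw [chooseTail, sum_range_succ, sum_range_succ, Nat.choose_eq_zero_of_lt
    (by omega : m + 2 < 0 + (m + 1) + 2), zero_add m, Nat.choose_self, mul_sum]
  simp only [Nat.cast_zero, zero_mul, add_zero, Nat.cast_one, one_mul, zero_add, Nat.add_sub_cancel]
  rw [add_comm]
  congr 1
  refine sum_congr rfl fun b hb => ?_
  rw [mem_range] at hb
  rw [hd _ (by omega) (by omega)]
  push_cast; ring

theorem one_add_pow_eq_second_order (τ : R) (i : ℕ) :
    (∃ e, (1 + τ) ^ i = 1 + τ * (i + τ * e)) ∧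
      ∃ f, ∑ k ∈ range i, (1 + τ) ^ k = i + (i.choose 2) * τ + τ ^ 2 * f := by
  constructor
  · induction i with
    | zero => exact ⟨0, by simp⟩
    | succ i ih =>
      obtain ⟨e, he⟩ := ih
      exact ⟨i + e + τ * e, by rw [pow_succ, he]; push_cast; ring⟩
  · have key : ∃ f, ∑ k ∈ range i, (1 + τ) ^ k = i + (i.choose 2) * τ + τ ^ 2 * f := by
      induction i with
      | zero => exact ⟨0, by simp⟩
      | succ i ih =>
        obtain ⟨f, hf⟩ := ih
        have he : ∃ e, (1 + τ) ^ i = 1 + i * τ + τ ^ 2 * e := by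
          clear hf
          induction i with
          | zero => exact ⟨0, by simp⟩
          | succ i ih =>
            obtain ⟨e, he⟩ := ih
            exact ⟨i + e + τ * e, by rw [pow_succ, he]; push_cast; ring⟩
        obtain ⟨e, he⟩ := he
        refine ⟨f + e, ?_⟩
        rw [sum_range_succ, hf, he, Nat.choose_succ_succ' i 1, Nat.choose_one_right]
        push_cast; ring
    exact key

/-- The power sum `∑_{j < p} x ^ (i (p - 1 - j)) [j]_y [i]_x`, where `x = 1 + τ`, `y = 1 + π`. -/
def powerSum {R : Type*} [Ring R] (p : ℕ) (π τ : R) (i : ℕ) : R :=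
  ∑ j ∈ range p, ((1 + τ) ^ i) ^ (p - 1 - j) *
    ((∑ l ∈ range j, (1 + π) ^ l) * ∑ k ∈ range i, (1 + τ) ^ k)

variable {p : ℕ} {π τ τ' : R}

/-- From (1 + τ)^p = 1 one gets τ(p · unit + τ^(p-1)) = 0. Here p is π^(p-1) times a unit, and
τ^(p-1) is divisible by π^p because τ is divisible by π²; so τπ^(p-1) times a unit vanishes. -/
theorem mul_pow_pred_eq_zero (hp : p.Prime) (hp3 : 3 ≤ p) (hπ : IsNilpotent π) (hτ : τ = π ^ 2 * τ')
    (hν : ∑ l ∈ range p, (1 + π) ^ l = 0) (hx : (1 + τ) ^ p = 1) :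
    τ * π ^ (p - 1) = 0 ∧ (p : R) * τ = 0 := by
  have hτn : IsNilpotent τ := by
    rw [hτ]
    exact Commute.isNilpotent_mul_right (Commute.all _ _) (hπ.pow_of_pos (by omega))
  obtain ⟨v, hv⟩ := exists_geom_sum_eq hp τ
  have hvu := isUnit_one_add_mul hτn v
  obtain ⟨u, hpe⟩ := exists_natCast_eq_of_geom_sum_eq_zero hp hπ hν
  have h1 : τ * (p * (1 + τ * v) + τ ^ (p - 1)) = 0 := by
    rw [← hv]
    have := geom_sum_mul (1 + τ) p
    rw [hx] at this
    linear_combination this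
  have h2 : τ ^ (p - 1) = π ^ (p - 1) * (π * (π ^ (p - 2) * τ' ^ (p - 1))) := by
    obtain ⟨m, rfl⟩ : ∃ m, p = m + 2 := ⟨p - 2, by omega⟩
    rw [hτ, Nat.add_sub_cancel, show m + 2 - 1 = m + 1 by omega]; ring
  have h3 : τ * π ^ (p - 1) *
      ((1 + τ * v) * (↑u⁻¹ : R) - π * (π ^ (p - 2) * τ' ^ (p - 1))) = 0 := by
    rw [h2, hpe] at h1
    linear_combination -h1
  have h4 : IsUnit ((1 + τ * v) * (↑u⁻¹ : R) - π * (π ^ (p - 2) * τ' ^ (p - 1))) := by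
    refine IsNilpotent.isUnit_add_left_of_commute (u := (1 + τ * v) * (↑u⁻¹ : R))
      (r := -(π * (π ^ (p - 2) * τ' ^ (p - 1)))) ?_ (hvu.mul u⁻¹.isUnit) (Commute.all _ _) |> fun h => by
        rwa [sub_eq_add_neg]
    exact (Commute.isNilpotent_mul_right (Commute.all _ _) hπ).neg
  have h5 := (h4.mul_left_eq_zero).1 h3
  exact ⟨h5, by rw [hpe]; linear_combination (-(↑u⁻¹ : R)) * h5⟩

/-- All binomial coefficients in the tail are divisible by p except the last one, and p annihilates
τ. -/
theorem mul_chooseTail_eq (hp : p.Prime) (hpτ : (p : R) * τ = 0) {a : ℕ} (ha : a + 2 ≤ p) :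
    τ * chooseTail π p a = τ * π ^ (p - 2 - a) := by
  rw [chooseTail, mul_sum, sum_eq_single (p - 2 - a)]
  · rw [show a + (p - 2 - a) + 2 = p by omega, Nat.choose_self, Nat.cast_one, one_mul]
  · intro b _ hb
    rcases lt_or_ge p (a + b + 2) with hlt | hge
    · rw [Nat.choose_eq_zero_of_lt hlt]; simp
    · obtain ⟨k, hk⟩ := hp.dvd_choose_self (k := a + b + 2) (by omega) (by omega)
      rw [hk]; push_cast
      linear_combination (k * π ^ b) * hpτ
  · intro hb; exact absurd (mem_range.2 (by have := hp.pos; omega)) hb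

/-- Apply `sum_pow_mul_geom_sum` with t = (1 + τ)^i - 1, a multiple of τ. Each further factor τ
contributes two factors π, so the terms with a ≥ 3 vanish and the terms a ≤ 2 need expansion only to
low order in τ. -/
theorem powerSum_eq_aux (hp : p.Prime) (hp5 : 5 ≤ p) (hτ : τ = π ^ 2 * τ')
    (h1 : τ * π ^ (p - 1) = 0) (hpτ : (p : R) * τ = 0) (i : ℕ) :
    powerSum p π τ i = i * chooseTail π p 0 + i.choose 2 * (τ * π ^ (p - 2)) +
      i ^ 2 * (τ * π ^ (p - 3)) + i ^ 3 * (τ ^ 2 * π ^ (p - 4)) := by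
  obtain ⟨⟨e, he⟩, f, hf⟩ := one_add_pow_eq_second_order τ i
  have hsum : powerSum p π τ i = (∑ a ∈ range p, (τ * (i + τ * e)) ^ a * chooseTail π p a) *
      ∑ k ∈ range i, (1 + τ) ^ k := by
    rw [← sum_pow_mul_geom_sum, powerSum, sum_mul, he]
    exact sum_congr rfl fun j _ => by ring
  have hE1 := mul_chooseTail_eq (π := π) hp hpτ (a := 1) (by omega)
  have hE2 := mul_chooseTail_eq (π := π) hp hpτ (a := 2) (by omega)
  have hE0 := mul_chooseTail_eq (π := π) hp hpτ (a := 0) (by omega)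
  have hE : ∀ a, 3 ≤ a → τ ^ a * chooseTail π p a = 0 := by
    intro a ha
    rcases lt_or_ge p (a + 2) with hlt | hge
    · rw [chooseTail_eq_zero π hlt, mul_zero]
    · have h2 := mul_chooseTail_eq (π := π) hp hpτ hge
      obtain ⟨b, rfl⟩ : ∃ b, a = b + 3 := ⟨a - 3, by omega⟩
      obtain ⟨m, rfl⟩ : ∃ m, p = m + (b + 5) := ⟨p - (b + 5), by omega⟩
      rw [show m + (b + 5) - 2 - (b + 3) = m by omega] at h2
      rw [show m + (b + 5) - 1 = m + b + 4 by omega] at h1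
      have h3 : τ ^ (b + 3) = τ * (π ^ (2 * b + 4) * τ' ^ (b + 2)) := by
        rw [show b + 3 = (b + 2) + 1 by omega, pow_succ']
        nth_rewrite 2 [hτ]
        ring
      rw [h3]
      linear_combination (π ^ (2 * b + 4) * τ' ^ (b + 2)) * h2 + π ^ b * τ' ^ (b + 2) * h1
  have hinner : ∑ a ∈ range p, (τ * (i + τ * e)) ^ a * chooseTail π p a =
      chooseTail π p 0 + τ * (i + τ * e) * chooseTail π p 1 +
        (τ * (i + τ * e)) ^ 2 * chooseTail π p 2 := by
    obtain ⟨m, hm⟩ : ∃ m, p = m + 3 := ⟨p - 3, by omega⟩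
    rw [show range p = range (m + 3) by rw [hm], sum_range_succ', sum_range_succ', sum_range_succ',
      sum_eq_zero]
    · simp only [zero_add, pow_zero, pow_one]; ring
    · intro a _
      rw [mul_pow]
      linear_combination ((i + τ * e) ^ (a + 1 + 1 + 1)) * hE (a + 1 + 1 + 1) (by omega)
  rw [hsum, hinner, hf]
  obtain ⟨m, rfl⟩ : ∃ m, p = m + 5 := ⟨p - 5, by omega⟩
  simp only [show m + 5 - 1 = m + 4 by omega, show m + 5 - 2 = m + 3 by omega,
    show m + 5 - 3 = m + 2 by omega, show m + 5 - 4 = m + 1 by omega,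
    show m + 3 - 1 = m + 2 by omega, show m + 3 - 2 = m + 1 by omega, Nat.sub_zero] at *
  have t1 : τ * π ^ (m + 5) = 0 := by linear_combination π * h1
  have t2 : τ ^ 2 * π ^ (m + 2) = 0 := by
    rw [pow_two]; nth_rewrite 2 [hτ]; linear_combination τ' * h1
  have t3 : τ ^ 3 * π ^ (m + 1) = 0 := by
    rw [show τ ^ 3 = τ * τ * τ by ring]; nth_rewrite 2 [hτ]; nth_rewrite 2 [hτ]
    linear_combination τ' ^ 2 * t1
  have t4 : τ ^ 2 * π ^ (m + 3) = 0 := by linear_combination π * t2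
  set c : R := ((i.choose 2 : ℕ) : R)
  linear_combination (c + τ * f) * hE0 + f * t4 +
    (i + τ * e) * (i + c * τ + τ ^ 2 * f) * hE1 +
    (i * c + i * τ * f + e * (i + c * τ + τ ^ 2 * f)) * t2 +
    (i + τ * e) ^ 2 * (i + c * τ + τ ^ 2 * f) * τ * hE2 +
    ((i + τ * e) ^ 2 * (c + τ * f) + i * e * (i + τ * e + i)) * t3

/-- If `π (i γ + powerSum i) = 0` for `i = 1, 2`, then `powerSum i` is quadratic in `i`. -/
theorem powerSum_eq (hp : p.Prime) (hp5 : 5 ≤ p) (hπ : IsNilpotent π) (hτ : τ = π ^ 2 * τ')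
    (hν : ∑ l ∈ range p, (1 + π) ^ l = 0) (hx : (1 + τ) ^ p = 1) {g : R}
    (hg1 : π * (g + powerSum p π τ 1) = 0) (hg2 : π * (2 * g + powerSum p π τ 2) = 0) (i : ℕ) :
    powerSum p π τ i = i * chooseTail π p 0 + i ^ 2 * (τ * π ^ (p - 3)) := by
  obtain ⟨h1, hpτ⟩ := mul_pow_pred_eq_zero hp (by omega) hπ hτ hν hx
  have hW := powerSum_eq_aux hp hp5 hτ h1 hpτ
  have hodd : ∃ m, p = 2 * m + 1 := (hp.eq_two_or_odd'.resolve_left (by omega))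
  obtain ⟨k, hk⟩ := hodd
  rw [hW] at hg1 hg2 ⊢
  obtain ⟨m, hm⟩ : ∃ m, p = m + 5 := ⟨p - 5, by omega⟩
  simp only [show p - 1 = m + 4 by omega, show p - 2 = m + 3 by omega,
    show p - 3 = m + 2 by omega, show p - 4 = m + 1 by omega] at *
  have t2 : τ ^ 2 * π ^ (m + 2) = 0 := by
    rw [pow_two]; nth_rewrite 2 [hτ]; linear_combination τ' * h1
  -- Subtracting twice the hypothesis for i = 1 from that for i = 2 eliminates g and the linear
  -- part. What survives is 2τπ^(p-2); since p is odd and pτ = 0, the factor 2 can be removed, which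
  -- kills both the term with `i.choose 2` and the cubic term.
  have h2 : 2 * (τ * π ^ (m + 3)) = 0 := by
    simp only [Nat.choose_self, Nat.choose_succ_self] at hg1 hg2
    push_cast at hg1 hg2
    linear_combination hg2 - 2 * hg1 - h1 - 6 * t2
  have h3 : τ * π ^ (m + 3) = 0 := by
    have hk' : (p : R) = 2 * k + 1 := by rw [hk]; push_cast; ring
    rw [hk'] at hpτ
    linear_combination π ^ (m + 3) * hpτ - k * h2
  have h4 : τ ^ 2 * π ^ (m + 1) = 0 := by
    rw [pow_two]; nth_rewrite 2 [hτ]; linear_combination τ' * h3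
  rw [h3, h4]; ring

theorem exists_chooseTail_zero_eq_pow_mul (hp : p.Prime) (hπ : IsNilpotent π)
    (hν : ∑ l ∈ range p, (1 + π) ^ l = 0) :
    ∃ d : R, chooseTail π p 0 = π ^ (p - 2) + π ^ (p - 1) * d := by
  obtain ⟨u, hu⟩ := exists_natCast_eq_of_geom_sum_eq_zero hp hπ hν
  obtain ⟨d, hd⟩ := exists_chooseTail_zero_eq hp π
  exact ⟨-((↑u⁻¹ : R) * d), by rw [hd, hu]; ring⟩

end Ring

theorem AddMonoid.End.add_apply' {A : Type*} [AddCommGroup A] (f g : AddMonoid.End A) (a : A) :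
    (f + g) a = f a + g a := rfl

theorem AddMonoid.End.sum_apply' {A ι : Type*} [AddCommGroup A] (s : Finset ι)
    (f : ι → AddMonoid.End A) (a : A) : (∑ i ∈ s, f i) a = ∑ i ∈ s, f i a :=
  AddMonoidHom.finsetSum_apply f s a

/-- A finite uniserial filtration `A = F 0 > F 1 > ⋯ > F e = 0` with cyclic quotients, permuted by
an endomorphism `S` which maps `F i / F (i + 1)` injectively to `F (i + 1) / F (i + 2)`. -/
structure IsUniserialFiltration {A : Type*} [AddCommGroup A] (e : ℕ) (S : AddMonoid.End A)
    (F : ℕ → AddSubgroup A) : Prop where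
  zero : F 0 = ⊤
  bot : F e = ⊥
  succ_le : ∀ i, F (i + 1) ≤ F i
  map_mem : ∀ {i a}, a ∈ F i → S a ∈ F (i + 1)
  strict : ∀ {i a}, i + 2 ≤ e → a ∈ F i → S a ∈ F (i + 2) → a ∈ F (i + 1)
  gen : ∀ {i a b}, a ∈ F i → a ∉ F (i + 1) → b ∈ F i → ∃ k : ℕ, b - k • a ∈ F (i + 1)

/-! ### Uniserial filtrations and multiplication by p -/

namespace IsUniserialFiltration

variable {A : Type*} [AddCommGroup A] {p e : ℕ} {S : AddMonoid.End A} {F : ℕ → AddSubgroup A}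

open Polynomial

theorem antitone (hF : IsUniserialFiltration e S F) : Antitone F := antitone_nat_of_succ_le hF.succ_le

theorem pow_mem (hF : IsUniserialFiltration e S F) {i : ℕ} {a : A} (ha : a ∈ F i) (k : ℕ) :
    (S ^ k) a ∈ F (i + k) := by
  induction k with
  | zero => simpa using ha
  | succ k ih => rw [pow_succ']; exact hF.map_mem ih

theorem aeval_mem (hF : IsUniserialFiltration e S F) {i : ℕ} {a : A} (ha : a ∈ F i) (f : ℤ[X]) :
    (aeval S f) a ∈ F i := by
  induction f using Polynomial.induction_on' with
  | add f g hf hg => rw [map_add]; exact add_mem hf hg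
  | monomial k c =>
    have h1 : aeval S (monomial k c) = c • S ^ k := by simp [aeval_monomial, Algebra.smul_def]
    rw [h1]
    exact (F i).zsmul_mem (hF.antitone (Nat.le_add_right i k) (hF.pow_mem ha k)) c

theorem pow_notMem (hF : IsUniserialFiltration e S F) {i : ℕ} {a : A} (ha : a ∈ F i)
    (ha' : a ∉ F (i + 1)) {k : ℕ} (hk : i + k < e) : (S ^ k) a ∉ F (i + k + 1) := by
  induction k with
  | zero => simpa using ha'
  | succ k ih =>
    intro h
    rw [pow_succ'] at h
    exact ih (by omega) (hF.strict (by omega) (hF.pow_mem ha k) h)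

theorem pow_eq_zero (hF : IsUniserialFiltration e S F) : S ^ e = 0 := by
  ext a
  have : a ∈ F 0 := hF.zero ▸ AddSubgroup.mem_top a
  have := hF.pow_mem this e
  rw [zero_add, hF.bot, AddSubgroup.mem_bot] at this
  exact this

/-- The group is a cyclic ℤ[S]-module on any c outside F 1: S^j c generates F j modulo F (j + 1),
and the remainder is treated by descending induction from F e = 0. -/
theorem exists_eq_aeval (hF : IsUniserialFiltration e S F) {c : A} (hc : c ∉ F 1) {j : ℕ} {a : A}
    (ha : a ∈ F j) : ∃ f : ℤ[X], a = (S ^ j) ((aeval S f) c) := by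
  have hc0 : c ∈ F 0 := hF.zero ▸ AddSubgroup.mem_top c
  have key : ∀ k, ∀ j, j + k = e → ∀ a ∈ F j, ∃ f : ℤ[X], a = (S ^ j) ((aeval S f) c) := by
    intro k
    induction k with
    | zero =>
      intro j hj a ha
      rw [show j = e by omega, hF.bot, AddSubgroup.mem_bot] at ha
      exact ⟨0, by simp [ha]⟩
    | succ k ih =>
      intro j hj a ha
      have h1 := hF.pow_mem hc0 j
      have h2 := hF.pow_notMem hc0 hc (by omega : 0 + j < e)
      rw [zero_add] at h1 h2
      obtain ⟨m, hm⟩ := hF.gen h1 h2 ha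
      obtain ⟨f, hf⟩ := ih (j + 1) (by omega) _ hm
      refine ⟨X * f + C (m : ℤ), ?_⟩
      rw [sub_eq_iff_eq_add] at hf
      have h3 : (algebraMap ℤ (AddMonoid.End A) (m : ℤ)) c = m • c := by
        rw [map_natCast, AddMonoid.End.natCast_apply]
      rw [hf, map_add, map_mul, aeval_X, aeval_C, pow_succ, AddMonoid.End.add_apply', map_add, h3,
        map_nsmul]
      rfl
  rcases le_or_gt j e with hj | hj
  · exact key (e - j) j (by omega) a ha
  · have := hF.antitone hj.le ha
    rw [hF.bot, AddSubgroup.mem_bot] at this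
    exact ⟨0, by simp [this]⟩

theorem mem_of_map_eq_zero (hF : IsUniserialFiltration e S F) {a : A} (ha : S a = 0) :
    a ∈ F (e - 1) := by
  have key : ∀ i, i ≤ e - 1 → a ∈ F i := by
    intro i
    induction i with
    | zero => exact fun _ => hF.zero ▸ AddSubgroup.mem_top a
    | succ i ih => exact fun hi => hF.strict (by omega) (ih (by omega)) (ha ▸ zero_mem _)
  exact key _ le_rfl

/-- The operator 1 + S f(S) is the identity plus something that lowers the filtration, so it
preserves the exact level of every element. -/
theorem mem_of_add_map_mem (hF : IsUniserialFiltration e S F) {a : A} (f : ℤ[X]) {m : ℕ}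
    (h : a + S ((aeval S f) a) ∈ F m) : a ∈ F m := by
  have key : ∀ i, i ≤ m → a ∈ F i := by
    intro i
    induction i with
    | zero => exact fun _ => hF.zero ▸ AddSubgroup.mem_top a
    | succ i ih =>
      intro hi
      have := sub_mem (hF.antitone hi h) (hF.map_mem (hF.aeval_mem (ih (by omega)) f))
      rwa [add_sub_cancel_right] at this
  exact key m le_rfl

theorem exists_geom_sum_apply (hp : p.Prime) (S : AddMonoid.End A) : ∃ f : ℤ[X], ∀ a,
    (∑ l ∈ Finset.range p, (1 + S) ^ l) a =
      p • a + S ((aeval S f) (p • a)) + (S ^ (p - 1)) a := by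
  obtain ⟨w, hw⟩ := exists_geom_sum_eq hp (X : ℤ[X])
  refine ⟨w, fun a => ?_⟩
  have := congrArg (aeval S) hw
  simp only [map_sum, map_pow, map_add, map_mul, map_one, aeval_X, map_natCast] at this
  rw [this, mul_add, mul_one, AddMonoid.End.add_apply', AddMonoid.End.add_apply',
    AddMonoid.End.natCast_apply, (Nat.cast_commute p _).eq, map_nsmul, map_nsmul]
  change p • a + S (aeval S w ((p : AddMonoid.End A) a)) + _ = _
  rw [AddMonoid.End.natCast_apply, map_nsmul, map_nsmul]

/-- By `exists_geom_sum_eq`, p times an operator 1 + S f(S) equals the trace minus S^(p-1). Where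
the trace is negligible, multiplication by p thus descends like S^(p-1), that is, by p - 1 levels.
-/
theorem prime_nsmul_mem (hF : IsUniserialFiltration e S F) (hp : p.Prime) {j : ℕ} {a : A}
    (ha : a ∈ F j) (hν : (∑ l ∈ Finset.range p, (1 + S) ^ l) a ∈ F (j + p - 1)) :
    p • a ∈ F (j + p - 1) := by
  obtain ⟨f, hf⟩ := exists_geom_sum_apply hp S
  refine hF.mem_of_add_map_mem f ?_
  rw [hf] at hν
  have := hF.pow_mem ha (p - 1)
  rw [← Nat.add_sub_assoc hp.one_le] at this
  simpa using sub_mem hν this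

theorem prime_nsmul_notMem (hF : IsUniserialFiltration e S F) (hp : p.Prime) {j : ℕ} {a : A}
    (ha : a ∈ F j) (ha' : a ∉ F (j + 1)) (hj : j + p ≤ e)
    (hν : (∑ l ∈ Finset.range p, (1 + S) ^ l) a ∈ F (j + p)) : p • a ∉ F (j + p) := by
  obtain ⟨f, hf⟩ := exists_geom_sum_apply hp S
  intro h
  rw [hf] at hν
  have h1 := sub_mem hν (add_mem h (hF.succ_le _ (hF.map_mem (hF.aeval_mem h f))))
  rw [add_sub_cancel_left] at h1
  have h2 := hF.pow_notMem ha ha' (k := p - 1) (by have := hp.one_le; omega)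
  rw [show j + (p - 1) + 1 = j + p by have := hp.one_le; omega] at h2
  exact h2 h1

end IsUniserialFiltration

/-! ### The Baer sum on a group of class at most two -/

section Baer

variable {N : Type*} [Group N]

/-- The commutator of a group of class at most two, as a central element. -/
def centralCommutator (hN : ∀ a b c : N, ⁅⁅a, b⁆, c⁆ = 1) (a b : N) : Subgroup.center N :=
  ⟨⁅a, b⁆, Subgroup.mem_center_iff.2 fun c =>
    (commutatorElement_eq_one_iff_mul_comm.1 (hN a b c)).symm⟩

variable (hN : ∀ a b c : N, ⁅⁅a, b⁆, c⁆ = 1)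

theorem center_mul_comm (z : Subgroup.center N) (a : N) : (z : N) * a = a * z :=
  (Subgroup.mem_center_iff.1 z.2 a).symm

theorem center_mul_comm' (z w : Subgroup.center N) : z * w = w * z :=
  Subtype.ext (center_mul_comm z w)

theorem center_mul_pow (z w : Subgroup.center N) (m : ℕ) : (z * w) ^ m = z ^ m * w ^ m :=
  Commute.mul_pow (center_mul_comm' z w) m

theorem center_mul_inv (z w : Subgroup.center N) : (z * w)⁻¹ = z⁻¹ * w⁻¹ := by
  rw [mul_inv_rev, center_mul_comm']

theorem centralCommutator_mul_left (a b c : N) : centralCommutator hN (a * b) c =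
    centralCommutator hN a c * centralCommutator hN b c := by
  ext
  change ⁅a * b, c⁆ = ⁅a, c⁆ * ⁅b, c⁆
  have h1 : ⁅b, c⁆ * a = a * ⁅b, c⁆ := center_mul_comm (centralCommutator hN b c) a
  rw [commutatorElement_mul_left_eq_conj_mul, ← h1, mul_inv_cancel_right]
  exact center_mul_comm (centralCommutator hN b c) _

theorem centralCommutator_inv (a b : N) :
    (centralCommutator hN a b)⁻¹ = centralCommutator hN b a :=
  Subtype.ext (commutatorElement_inv a b)

theorem centralCommutator_mul_right (a b c : N) : centralCommutator hN a (b * c) =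
    centralCommutator hN a b * centralCommutator hN a c := by
  rw [← centralCommutator_inv, centralCommutator_mul_left, center_mul_inv, centralCommutator_inv,
    centralCommutator_inv]

theorem centralCommutator_center_left (z : Subgroup.center N) (a : N) :
    centralCommutator hN z a = 1 :=
  Subtype.ext (commutatorElement_eq_one_iff_mul_comm.2 (center_mul_comm z a))

theorem centralCommutator_center_right (z : Subgroup.center N) (a : N) :
    centralCommutator hN a z = 1 :=
  Subtype.ext (commutatorElement_eq_one_iff_mul_comm.2 (center_mul_comm z a).symm)

/-- The Baer sum `a b [a, b]^{-r}`; here `r` is meant to be an inverse of `2`. -/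
def baerAdd (r : ℕ) (a b : N) : N := a * b * ((centralCommutator hN a b ^ r)⁻¹ : Subgroup.center N)

theorem baerAdd_assoc (r : ℕ) (a b c : N) :
    baerAdd hN r (baerAdd hN r a b) c = baerAdd hN r a (baerAdd hN r b c) := by
  simp only [baerAdd, centralCommutator_mul_left, centralCommutator_mul_right,
    centralCommutator_center_left, centralCommutator_center_right, mul_one]
  have h1 : ∀ (z : Subgroup.center N) (x y : N), x * z * y = x * y * z := fun z x y => by
    rw [mul_assoc, center_mul_comm, mul_assoc]
  have h2 : ∀ (x : N) (z w : Subgroup.center N), x * z * w = x * ((z * w : Subgroup.center N) : N) :=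
    fun x z w => by rw [Subgroup.coe_mul, mul_assoc]
  rw [h1, h2, ← mul_assoc a, h2, mul_assoc a b c]
  congr 2
  simp only [center_mul_pow, center_mul_inv]
  rw [center_mul_comm' _ (_ * _), center_mul_comm' (_ * _) _, ← mul_assoc]
  exact center_mul_comm' _ _

theorem baerAdd_comm {r : ℕ} (hr : ∀ a b : N, ⁅a, b⁆ ^ (2 * r) = ⁅a, b⁆) (a b : N) :
    baerAdd hN r a b = baerAdd hN r b a := by
  have h1 : a * b = b * a * centralCommutator hN a b := by
    rw [← center_mul_comm]; simp [centralCommutator, commutatorElement_def]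
  have h2 : centralCommutator hN a b ^ (2 * r) = centralCommutator hN a b := Subtype.ext (hr a b)
  rw [baerAdd, baerAdd, h1, mul_assoc, ← Subgroup.coe_mul, ← centralCommutator_inv hN a b, inv_pow,
    inv_inv]
  congr 2
  nth_rewrite 1 [← h2]
  rw [two_mul, pow_add, mul_inv_cancel_right]

/-- The abelian group attached by Baer to a group of class at most two. -/
@[reducible]
def baerAddCommGroup {r : ℕ} (hr : ∀ a b : N, ⁅a, b⁆ ^ (2 * r) = ⁅a, b⁆) : AddCommGroup N where
  add := baerAdd hN r
  add_assoc := baerAdd_assoc hN r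
  zero := 1
  zero_add a := by
    change baerAdd hN r 1 a = a
    simp [baerAdd, centralCommutator]
  add_zero a := by
    change baerAdd hN r a 1 = a
    simp [baerAdd, centralCommutator]
  neg a := a⁻¹
  neg_add_cancel a := by
    change baerAdd hN r a⁻¹ a = 1
    have : ⁅a⁻¹, a⁆ = 1 := commutatorElement_eq_one_iff_mul_comm.2 (by simp)
    simp [baerAdd, centralCommutator, this]
  add_comm := baerAdd_comm hN hr
  nsmul n a := a ^ n
  nsmul_zero a := pow_zero a
  nsmul_succ n a := by
    have : ⁅a ^ n, a⁆ = 1 := commutatorElement_eq_one_iff_mul_comm.2 ((Commute.refl a).pow_left n)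
    change a ^ (n + 1) = baerAdd hN r (a ^ n) a
    simp [baerAdd, centralCommutator, this, pow_succ]
  zsmul n a := a ^ n
  zsmul_zero' a := zpow_zero a
  zsmul_succ' n a := by
    have : ⁅a ^ n, a⁆ = 1 := commutatorElement_eq_one_iff_mul_comm.2 ((Commute.refl a).pow_left n)
    change a ^ ((n.succ : ℕ) : ℤ) = baerAdd hN r (a ^ (n : ℤ)) a
    rw [zpow_natCast, zpow_natCast]
    simp [baerAdd, centralCommutator, this, pow_succ]
  zsmul_neg' n a := by
    change a ^ Int.negSucc n = (a ^ ((n.succ : ℕ) : ℤ))⁻¹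
    rw [zpow_negSucc, zpow_natCast]

end Baer

/-! ### Powers as ordered products of conjugates -/

section OrderedProduct

/-- The ordered product `f 0 * f 1 * ⋯ * f (m - 1)`. -/
def orderedProd {N : Type*} [Monoid N] (f : ℕ → N) : ℕ → N
  | 0 => 1
  | m + 1 => orderedProd f m * f m

theorem mul_pow_eq_orderedProd {G : Type*} [Group G] (a s : G) (m : ℕ) :
    (a * s) ^ m = orderedProd (fun j => s ^ j * a * (s ^ j)⁻¹) m * s ^ m := by
  induction m with
  | zero => simp [orderedProd]
  | succ m ih => rw [pow_succ, ih, orderedProd, pow_succ]; group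

theorem map_orderedProd {M N : Type*} [Monoid M] [Monoid N] (φ : M →* N) (f : ℕ → M) (m : ℕ) :
    φ (orderedProd f m) = orderedProd (fun j => φ (f j)) m := by
  induction m with
  | zero => exact map_one φ
  | succ m ih => rw [orderedProd, map_mul, ih, orderedProd]

end OrderedProduct

section BaerProduct

variable {N : Type*} [Group N] (hN : ∀ a b c : N, ⁅⁅a, b⁆, c⁆ = 1) {r : ℕ}
  (hr : ∀ a b : N, ⁅a, b⁆ ^ (2 * r) = ⁅a, b⁆)

theorem baer_add_eq (a b : N) :
    letI := baerAddCommGroup hN hr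
    a + b = a * b * ((centralCommutator hN a b ^ r)⁻¹ : Subgroup.center N) := rfl

/-- The half commutator `[a, b] ^ r` is biadditive for the Baer sum. -/
def halfCommutator :
    letI := baerAddCommGroup hN hr
    N →+ N →+ N :=
  letI := baerAddCommGroup hN hr
  AddMonoidHom.mk' (fun a => AddMonoidHom.mk' (fun b => ((centralCommutator hN a b ^ r :
    Subgroup.center N) : N)) fun b c => by
      rw [baer_add_eq, baer_add_eq, centralCommutator_mul_right, centralCommutator_mul_right,
        centralCommutator_center_right, mul_one, center_mul_pow, centralCommutator_center_left]
      simp) fun a b => by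
    ext c
    change ((centralCommutator hN (a + b) c ^ r : Subgroup.center N) : N) =
      (centralCommutator hN a c ^ r : Subgroup.center N) + (centralCommutator hN b c ^ r :
        Subgroup.center N)
    rw [baer_add_eq, baer_add_eq, centralCommutator_mul_left, centralCommutator_mul_left,
      centralCommutator_center_left, mul_one, center_mul_pow, centralCommutator_center_left]
    simp

theorem halfCommutator_apply (a b : N) :
    halfCommutator hN hr a b = ((centralCommutator hN a b ^ r : Subgroup.center N) : N) := rfl

theorem baer_add_center (a : N) (z : Subgroup.center N) :
    letI := baerAddCommGroup hN hr
    a + (z : N) = a * z := by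
  rw [baer_add_eq, centralCommutator_center_right]; simp

theorem baer_mul_eq (a b : N) :
    letI := baerAddCommGroup hN hr
    a * b = a + b + halfCommutator hN hr a b := by
  rw [halfCommutator_apply, baer_add_center, baer_add_eq, mul_assoc, ← Subgroup.coe_mul]
  simp

theorem halfCommutator_center_left (z : Subgroup.center N) (b : N) :
    letI := baerAddCommGroup hN hr
    halfCommutator hN hr z b = 0 := by
  rw [halfCommutator_apply, centralCommutator_center_left, one_pow]; rfl

/-- Each new factor contributes its half commutator with the sum of the earlier factors; half
commutators are central, hence invisible to later ones. -/
theorem orderedProd_eq_sum (f : ℕ → N) (m : ℕ) :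
    letI := baerAddCommGroup hN hr
    orderedProd f m = ∑ j ∈ Finset.range m, f j +
      ∑ k ∈ Finset.range m, halfCommutator hN hr (∑ j ∈ Finset.range k, f j) (f k) := by
  let := baerAddCommGroup hN hr
  have hc : ∀ m, ∃ z : Subgroup.center N, ∑ k ∈ Finset.range m,
      halfCommutator hN hr (∑ j ∈ Finset.range k, f j) (f k) = (z : N) := by
    intro m
    induction m with
    | zero => exact ⟨1, rfl⟩
    | succ m ih =>
      obtain ⟨z, hz⟩ := ih
      rw [Finset.sum_range_succ, hz, halfCommutator_apply, baer_add_center, ← Subgroup.coe_mul]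
      exact ⟨_, rfl⟩
  induction m with
  | zero => simp [orderedProd]; rfl
  | succ m ih =>
    obtain ⟨z, hz⟩ := hc m
    rw [orderedProd, baer_mul_eq hN hr, ih, Finset.sum_range_succ, Finset.sum_range_succ, map_add, hz,
      AddMonoidHom.add_apply, halfCommutator_center_left, add_zero]
    abel

/-- A group endomorphism is additive for the Baer sum. -/
def baerEnd (φ : N →* N) :
    letI := baerAddCommGroup hN hr
    AddMonoid.End N :=
  letI := baerAddCommGroup hN hr
  AddMonoidHom.mk' φ fun a b => by
    rw [baer_add_eq, baer_add_eq, map_mul, map_mul]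
    congr 1
    simp [centralCommutator, map_commutatorElement]

end BaerProduct

/-- The properties of the Baer sum on a group of class at most two, where `z a b` is the half of
the commutator `[a, b]`. -/
structure IsBaerSum (N : Type*) [Group N] [AddCommGroup N] (z : N →+ N →+ N) : Prop where
  zero_eq : (0 : N) = 1
  neg_eq : ∀ a : N, -a = a⁻¹
  nsmul_eq : ∀ (k : ℕ) (a : N), k • a = a ^ k
  mul_eq : ∀ a b : N, a * b = a + b + z a b
  half_mem : ∀ (H : Subgroup N) (a b : N), ⁅a, b⁆ ∈ H → z a b ∈ H
  orderedProd_eq : ∀ (f : ℕ → N) (m : ℕ), orderedProd f m = ∑ j ∈ Finset.range m, f j +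
    ∑ k ∈ Finset.range m, z (∑ j ∈ Finset.range k, f j) (f k)
  map_add : ∀ (φ : N →* N) (a b : N), φ (a + b) = φ a + φ b
  add_eq : ∀ a b : N, a + b = a * b * (z a b)⁻¹

theorem exists_isBaerSum {N : Type*} [Group N] (hN : ∀ a b c : N, ⁅⁅a, b⁆, c⁆ = 1) {r : ℕ}
    (hr : ∀ a b : N, ⁅a, b⁆ ^ (2 * r) = ⁅a, b⁆) :
    ∃ (_ : AddCommGroup N) (z : N →+ N →+ N), IsBaerSum N z := by
  let _ := baerAddCommGroup hN hr
  exact ⟨baerAddCommGroup hN hr, halfCommutator hN hr,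
    { zero_eq := rfl
      neg_eq := fun _ => rfl
      nsmul_eq := fun _ _ => rfl
      mul_eq := baer_mul_eq hN hr
      half_mem := fun H a b hab => by
        rw [halfCommutator_apply]; exact pow_mem hab r
      orderedProd_eq := orderedProd_eq_sum hN hr
      map_add := fun φ => (baerEnd hN hr φ).map_add
      add_eq := fun _ _ => rfl }⟩

theorem mem_of_pow_mem_of_coprime {G : Type*} [Group G] [Finite G] {p n : ℕ}
    (hG : Nat.card G = p ^ n) {H : Subgroup G} {x : G} {k : ℕ} (hk : k.Coprime p)
    (hx : x ^ k ∈ H) : x ∈ H := by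
  have h1 : k.Coprime (orderOf x) :=
    (hk.pow_right n).coprime_dvd_right (hG ▸ orderOf_dvd_natCard x)
  obtain ⟨m, hm⟩ := exists_pow_eq_self_of_coprime h1
  rw [← hm]
  exact pow_mem hx m

/-- The facts about `p`-th powers in a group of maximal class on which everything else rests. -/
structure PowerData (p n : ℕ) {G : Type*} [Group G] (s g α β : G) : Prop where
  s_notMem : s ∉ gOne G
  g_mem : g ∈ gOne G
  g_notMem : g ∉ gammaSeries G 2
  pow_prime_mem : ∀ a ∈ gOne G, (a * s) ^ p ∈ gammaSeries G (n - 1)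
  pow_prime_eq : ∀ a ∈ gOne G, ∀ b ∈ gammaSeries G 2, (a * b * s) ^ p = (a * s) ^ p
  α_mem : α ∈ gammaSeries G (n - 1)
  β_mem : β ∈ gammaSeries G (n - 1)
  pow_mul_eq : ∀ i : ℕ, (g ^ i * s) ^ p = α ^ i * β ^ (i ^ 2) * s ^ p
  gamma_pow_mem : ∀ i a, 2 ≤ i → a ∈ gammaSeries G i → a ^ p ∈ gammaSeries G (i + p - 1)
  gamma_pow_notMem : ∀ i a, 2 ≤ i → a ∈ gammaSeries G i → a ∉ gammaSeries G (i + 1) → i + p ≤ n →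
    a ^ p ∉ gammaSeries G (i + p)
  gOne_pow_mem : ∀ a ∈ gOne G, a ^ p ∈ gammaSeries G p
  gOne_pow_notMem : ∀ a ∈ gOne G, a ∉ gammaSeries G 2 → p + 2 ≤ n → a ^ p ∉ gammaSeries G (p + 1)
  gOne_pow_eq : n = p + 1 → ∀ a ∈ gOne G, ∀ b ∈ gammaSeries G 2, (a * b) ^ p = a ^ p
  α_ne : n = p + 1 → g ^ p = 1 → α ≠ 1

/-! ### p-th powers when G₁ has class at most two -/

section BaerGOne

variable {G : Type*} [Group G] {p n : ℕ} [hp : Fact p.Prime]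

/-- The subgroup of `G₁` corresponding to `γ_{j+1}`, as an additive subgroup for the Baer sum. -/
def baerGamma [AddCommGroup (gOne G)] {z : gOne G →+ gOne G →+ gOne G}
    (hz : IsBaerSum (gOne G) z) (j : ℕ) : AddSubgroup (gOne G) where
  carrier := {a | (a : G) ∈ gammaSeries G (j + 1)}
  zero_mem' := by
    rw [Set.mem_ofPred_eq, hz.zero_eq]; exact one_mem _
  add_mem' {a b} ha hb := by
    rw [Set.mem_ofPred_eq] at *
    rw [hz.add_eq]
    have h1 : z a b ∈ (gammaSeries G (j + 1)).subgroupOf (gOne G) := by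
      apply hz.half_mem
      rw [Subgroup.mem_subgroupOf]
      exact gammaSeries_antitone (Nat.le_succ _) (commutatorElement_mem_gammaSeries_succ ha _)
    rw [Subgroup.mem_subgroupOf] at h1
    exact mul_mem (mul_mem ha hb) (inv_mem h1)
  neg_mem' {a} ha := by
    rw [Set.mem_ofPred_eq] at *
    rw [hz.neg_eq]; exact inv_mem ha

variable [AddCommGroup (gOne G)] {z : gOne G →+ gOne G →+ gOne G} (hz : IsBaerSum (gOne G) z)

theorem mem_baerGamma {j : ℕ} {a : gOne G} :
    a ∈ baerGamma hz j ↔ (a : G) ∈ gammaSeries G (j + 1) := Iff.rfl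

/-- If `[a, b] ∈ γ_{j+1}`, then `a + b` and `a b` agree modulo `γ_{j+1}`. -/
theorem add_mem_baerGamma_iff {j : ℕ} {a b : gOne G} (hab : ⁅(a : G), (b : G)⁆ ∈ gammaSeries G (j + 1)) :
    a + b ∈ baerGamma hz j ↔ (a : G) * b ∈ gammaSeries G (j + 1) := by
  have h1 : z a b ∈ (gammaSeries G (j + 1)).subgroupOf (gOne G) := hz.half_mem _ _ _ hab
  rw [mem_baerGamma, hz.add_eq]
  exact Subgroup.mul_mem_cancel_right _ (inv_mem h1)

/-- Conjugation by `s`, as an additive endomorphism for the Baer sum. -/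
def baerConj (hz : IsBaerSum (gOne G) z) [(gOne G).Normal] (s : G) : AddMonoid.End (gOne G) :=
  AddMonoidHom.mk' (MulAut.conjNormal (H := gOne G) s).toMonoidHom (hz.map_add _)

theorem coe_baerConj [(gOne G).Normal] (s : G) (a : gOne G) :
    (baerConj hz s a : G) = s * a * s⁻¹ := MulAut.conjNormal_apply s a

theorem coe_baerConj_pow [(gOne G).Normal] (s : G) (j : ℕ) (a : gOne G) :
    ((baerConj hz s ^ j) a : G) = s ^ j * a * (s ^ j)⁻¹ := by
  induction j with
  | zero => simp
  | succ j ih =>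
    rw [pow_succ', show (baerConj hz s * baerConj hz s ^ j) a = baerConj hz s ((baerConj hz s ^ j) a) from
      rfl, coe_baerConj, ih, pow_succ']
    group

/-- The Baer difference of sas⁻¹ and a differs from [s, a] by a power of [[s, a], a⁻¹], which lies
in γ_{j+3} when a is in γ_{j+1}; this is the source of the bound on k. -/
theorem baerConj_sub_one_mem [(gOne G).Normal] {s : G} {j k : ℕ} {a : gOne G}
    (ha : a ∈ baerGamma hz j) (hk : k ≤ j + 2) :
    (baerConj hz s - 1) a ∈ baerGamma hz k ↔ ⁅s, (a : G)⁆ ∈ gammaSeries G (k + 1) := by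
  have h1 : (baerConj hz s - 1) a = baerConj hz s a + -a := sub_eq_add_neg _ _
  rw [h1, add_mem_baerGamma_iff hz]
  · rw [coe_baerConj, hz.neg_eq]; rfl
  · rw [coe_baerConj, hz.neg_eq, Subgroup.coe_inv]
    have h2 : ⁅s * (a : G) * s⁻¹, (a : G)⁻¹⁆ = ⁅⁅s, (a : G)⁆, (a : G)⁻¹⁆ := by
      simp only [commutatorElement_def]; group
    rw [h2]
    exact gammaSeries_antitone (by omega) (commutatorElement_mem_gammaSeries_succ
      (commutatorElement_mem_gammaSeries_succ' ha s) _)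

theorem baer_isUniserialFiltration [(gOne G).Normal] (h : IsMaximalClass G p n) (hn : 4 ≤ n)
    {s : G} (hs : IsUniserialElement n s) :
    IsUniserialFiltration (n - 1) (baerConj hz s - 1) (baerGamma hz) where
  zero := top_le_iff.1 fun a _ => (Subgroup.mem_top (a : G) : (a : G) ∈ gammaSeries G 1)
  bot := by
    rw [eq_bot_iff]
    intro a ha
    rw [mem_baerGamma, show n - 1 + 1 = n by omega] at ha
    rw [AddSubgroup.mem_bot, hz.zero_eq]
    exact Subtype.ext (h.eq_one_of_mem le_rfl ha)
  succ_le i a ha := gammaSeries_antitone (Nat.le_succ _) ha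
  map_mem {i a} ha := (baerConj_sub_one_mem hz ha (by omega)).2
    (commutatorElement_mem_gammaSeries_succ' ha s)
  strict {i a} hi ha hSa := by
    rw [baerConj_sub_one_mem hz ha le_rfl] at hSa
    have h1 : ⁅(a : G), s⁆ ∈ gammaSeries G (i + 2 + 1) := by
      rw [← commutatorElement_inv]; exact inv_mem hSa
    -- Level i is γ_{i+1}, so level 0 is all of G₁, where the descent is not covered by the
    -- definition of a uniserial element.
    rcases Nat.eq_zero_or_pos i with rfl | hi0
    · exact hs.mem_two_of_commutatorElement_mem h hn a.2 h1
    · exact hs.mem_of_commutatorElement_mem h (i := i + 1) (by omega) (by omega) ha h1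
  gen {i a b} ha ha' hb := by
    have hfin := h.finite
    obtain ⟨k, hk⟩ : ∃ k : ℕ, ((a : G) ^ k)⁻¹ * b ∈ gammaSeries G (i + 1 + 1) := by
      rcases Nat.eq_zero_or_pos i with rfl | hi0
      · exact exists_pow_inv_mul_mem (h.gammaSeries_two_le_gOne hn)
          (h.card_isCoatom_eq (by omega) (h.isCoatom_gOne hn)) a.2 ha' b.2
      · exact h.exists_pow_inv_mul_mem_gammaSeries (by omega) (by omega) ha ha' hb
    refine ⟨k, ?_⟩
    rw [sub_eq_add_neg, add_mem_baerGamma_iff hz (commutatorElement_mem_gammaSeries_succ hb _),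
      hz.neg_eq, hz.nsmul_eq]
    have := conj_mem_gammaSeries hk ((a : G) ^ k)
    simpa using this

end BaerGOne

section BaerPower

set_option linter.unusedSectionVars false

variable {G : Type*} [Group G] {p n : ℕ} [hp : Fact p.Prime] [AddCommGroup (gOne G)]
  {z : gOne G →+ gOne G →+ gOne G} (hz : IsBaerSum (gOne G) z) [(gOne G).Normal]

/-- The trace `ν = 1 + σ + ⋯ + σ^{p-1}` of the conjugation `σ` by `s`. -/
def baerTrace (p : ℕ) (s : G) : AddMonoid.End (gOne G) :=
  ∑ l ∈ Finset.range p, baerConj hz s ^ l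

/-- The biadditive map whose associated quadratic map is the non-additive part of `(a * s) ^ p`. -/
def baerForm (p : ℕ) (s : G) (a b : gOne G) : gOne G :=
  ∑ k ∈ Finset.range p, z (∑ j ∈ Finset.range k, (baerConj hz s ^ j) a) ((baerConj hz s ^ k) b)

theorem baerForm_add_left (s : G) (a a' b : gOne G) :
    baerForm hz p s (a + a') b = baerForm hz p s a b + baerForm hz p s a' b := by
  simp only [baerForm, map_add, Finset.sum_add_distrib, AddMonoidHom.add_apply]

theorem baerForm_add_right (s : G) (a b b' : gOne G) :
    baerForm hz p s a (b + b') = baerForm hz p s a b + baerForm hz p s a b' := by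
  simp only [baerForm, map_add, Finset.sum_add_distrib]

theorem baerForm_nsmul_left (s : G) (a b : gOne G) (k : ℕ) :
    baerForm hz p s (k • a) b = k • baerForm hz p s a b := by
  simp only [baerForm, map_nsmul, ← Finset.smul_sum, AddMonoidHom.smul_apply]

theorem baerForm_nsmul_right (s : G) (a b : gOne G) (k : ℕ) :
    baerForm hz p s a (k • b) = k • baerForm hz p s a b := by
  simp only [baerForm, map_nsmul, ← Finset.smul_sum]

theorem coe_mul_pow_prime (s : G) (a : gOne G) :
    ((a : G) * s) ^ p = ((baerTrace hz p s a + baerForm hz p s a a : gOne G) : G) * s ^ p := by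
  have h1 : orderedProd (fun j => s ^ j * (a : G) * (s ^ j)⁻¹) p =
      ((orderedProd (fun j => (baerConj hz s ^ j) a) p : gOne G) : G) := by
    rw [← Subgroup.coe_subtype, map_orderedProd]
    congr 1
    funext j
    exact (coe_baerConj_pow hz s j a).symm
  rw [mul_pow_eq_orderedProd, h1, hz.orderedProd_eq, baerTrace, AddMonoid.End.sum_apply']
  rfl

variable (h : IsMaximalClass G p n) (hn : 4 ≤ n) {s : G} (hs : IsUniserialElement n s)

include h hn hs

theorem baerConj_pow_prime : baerConj hz s ^ p = 1 := by
  ext a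
  change ((baerConj hz s ^ p) a : G) = a
  rw [coe_baerConj_pow, h.mul_comm_of_mem_last (hs.pow_prime_mem_last h (by omega)),
    mul_inv_cancel_right]

theorem map_baerTrace (a : gOne G) : baerTrace hz p s ((baerConj hz s - 1) a) = 0 := by
  have h1 : baerTrace hz p s * (baerConj hz s - 1) = 0 := by
    rw [baerTrace, geom_sum_mul, baerConj_pow_prime hz h hn hs, sub_self]
  exact DFunLike.congr_fun h1 a

/-- With σ the conjugation by s, (σ - 1)ν = σ^p - 1 = 0, and the kernel of σ - 1 is the last step of
the filtration. -/
theorem baerTrace_mem (a : gOne G) : baerTrace hz p s a ∈ baerGamma hz (n - 2) := by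
  have h1 : (baerConj hz s - 1) * baerTrace hz p s = 0 := by
    rw [baerTrace, mul_geom_sum, baerConj_pow_prime hz h hn hs, sub_self]
  have := (baer_isUniserialFiltration hz h hn hs).mem_of_map_eq_zero
    (a := baerTrace hz p s a) (DFunLike.congr_fun h1 a)
  rwa [show n - 1 - 1 = n - 2 by omega] at this

theorem exists_notMem_baerGamma_one : ∃ c : gOne G, c ∉ baerGamma hz 1 := by
  obtain ⟨c, hc, hc'⟩ := Set.exists_of_ssubset
    (h.gammaSeries_two_lt_of_isCoatom (by omega) (h.isCoatom_gOne hn))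
  exact ⟨⟨c, hc⟩, hc'⟩

/-- Every element of γ₂ has the form (σ - 1)b with b in G₁, and ν(σ - 1) = 0. -/
theorem baerTrace_eq_zero {a : gOne G} (ha : a ∈ baerGamma hz 1) : baerTrace hz p s a = 0 := by
  obtain ⟨c, hc⟩ := exists_notMem_baerGamma_one hz h hn hs
  obtain ⟨f, rfl⟩ := (baer_isUniserialFiltration hz h hn hs).exists_eq_aeval hc ha
  rw [pow_one, map_baerTrace hz h hn hs]

theorem one_add_baerConj_sub_one (a : gOne G) :
    (∑ l ∈ Finset.range p, (1 + (baerConj hz s - 1)) ^ l) a = baerTrace hz p s a := by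
  rw [add_sub_cancel, baerTrace]

variable (hu : ∀ a ∈ gOne G, ∃ k : ℕ, k.Coprime p ∧ IsUniserialElement n (a ^ k * s))

include hu

theorem mem_of_nsmul_mem_baerGamma {k j : ℕ} (hk : k.Coprime p) {a : gOne G}
    (ha : k • a ∈ baerGamma hz j) : a ∈ baerGamma hz j := by
  have := h.finite
  rw [mem_baerGamma, hz.nsmul_eq, Subgroup.coe_pow] at ha
  exact mem_of_pow_mem_of_coprime h.2.1 hk ha

/-- The element as itself need not be uniserial, but some a^k s with k prime to p is. Its p-th power
is in γ_{n-1}, which puts k² times the form in the last step, and k² can be cancelled. -/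
theorem baerForm_mem (a : gOne G) : baerForm hz p s a a ∈ baerGamma hz (n - 2) := by
  obtain ⟨k, hk, hks⟩ := hu a a.2
  have h1 := hks.pow_prime_mem_last h (by omega)
  have h2 := coe_mul_pow_prime (p := p) hz s (k • a)
  rw [hz.nsmul_eq, Subgroup.coe_pow] at h2
  rw [h2, Subgroup.mul_mem_cancel_right _ (hs.pow_prime_mem_last h (by omega)), ← hz.nsmul_eq,
    baerForm_nsmul_left, baerForm_nsmul_right, smul_smul] at h1
  have h3 : baerTrace hz p s (k • a) + (k * k) • baerForm hz p s a a ∈ baerGamma hz (n - 2) := by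
    rwa [mem_baerGamma, show n - 2 + 1 = n - 1 by omega]
  have h4 := sub_mem h3 (baerTrace_mem hz h hn hs (k • a))
  rw [add_sub_cancel_left] at h4
  exact mem_of_nsmul_mem_baerGamma hz h hn hs hu (hk.mul_left hk) h4

/-- For b in γ₂ the elements bs and s have the same p-th power, while the trace of b vanishes. -/
theorem baerForm_self_eq_zero {b : gOne G} (hb : b ∈ baerGamma hz 1) : baerForm hz p s b b = 0 := by
  have h1 := coe_mul_pow_prime (p := p) hz s b
  rw [hs.mul_pow_prime h hn hb, baerTrace_eq_zero hz h hn hs hb, zero_add] at h1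
  rw [hz.zero_eq]
  exact Subtype.ext (mul_eq_right.1 h1.symm)

/-- Polarization: after replacing a by a multiple that makes a^k s uniserial, adding b in γ₂ leaves
the p-th power unchanged, so the mixed terms cancel up to the factor k. -/
theorem baerForm_add_swap_eq_zero (a : gOne G) {b : gOne G} (hb : b ∈ baerGamma hz 1) :
    baerForm hz p s a b + baerForm hz p s b a = 0 := by
  obtain ⟨k, hk, hks⟩ := hu a a.2
  have key : ((k • a + b : gOne G) : G) * s = ((k • a + b : gOne G) * (k • a : gOne G)⁻¹ : G) *
      ((k • a : gOne G) * s) := by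
    rw [mul_assoc, Subgroup.coe_inv, inv_mul_cancel_left]
  have hmem : ((k • a + b : gOne G) * (k • a : gOne G)⁻¹ : G) ∈ gammaSeries G 2 := by
    have : (k • a + b : gOne G) + -(k • a) ∈ baerGamma hz 1 := by
      rwa [← sub_eq_add_neg, add_sub_cancel_left]
    rw [add_mem_baerGamma_iff hz (commutatorElement_mem_gammaSeries_succ (i := 1) trivial _),
      hz.neg_eq] at this
    exact this
  have hks' : IsUniserialElement n (((k • a : gOne G) : G) * s) := by
    rwa [hz.nsmul_eq, Subgroup.coe_pow]
  have h1 := hks'.mul_pow_prime h hn hmem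
  rw [← key, coe_mul_pow_prime hz, coe_mul_pow_prime hz] at h1
  have h2 := Subtype.ext (mul_right_cancel h1)
  rw [map_add, baerTrace_eq_zero hz h hn hs hb, add_zero, add_right_inj, baerForm_add_left,
    baerForm_add_right, baerForm_add_right, baerForm_self_eq_zero hz h hn hs hu hb, add_zero,
    add_assoc, add_eq_left, baerForm_nsmul_left, baerForm_nsmul_right, ← smul_add] at h2
  have h3 := (baer_isUniserialFiltration hz h hn hs).bot
  rw [← AddSubgroup.mem_bot, ← h3]
  exact mem_of_nsmul_mem_baerGamma hz h hn hs hu hk (h2 ▸ zero_mem _)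

theorem add_eq_mul_of_mem_last {a b : gOne G} (ha : a ∈ baerGamma hz (n - 2)) :
    ((a + b : gOne G) : G) = a * b := by
  rw [mem_baerGamma, show n - 2 + 1 = n - 1 by omega] at ha
  have h1 : z a b ∈ (⊥ : Subgroup (gOne G)) := by
    apply hz.half_mem
    rw [Subgroup.mem_bot, commutatorElement_eq_one_iff_mul_comm]
    exact Subtype.ext (h.mul_comm_of_mem_last ha b)
  rw [Subgroup.mem_bot] at h1
  rw [hz.add_eq, h1, inv_one, mul_one]
  rfl

theorem exists_add_eq_mul (a : gOne G) {b : gOne G} (hb : b ∈ baerGamma hz 1) :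
    ∃ b' ∈ baerGamma hz 1, a * b = a + b' := by
  refine ⟨b + z a b, add_mem hb ?_, by rw [hz.mul_eq, add_assoc]⟩
  exact hz.half_mem ((gammaSeries G 2).subgroupOf (gOne G)) a b
    (commutatorElement_mem_gammaSeries_succ (i := 1) trivial _)

/-- In (g^i s)^p the trace is linear in i and the form is quadratic, which produces α as the trace
of g and β as the value of the form at g. The statements about powers within G₁ are those about
multiplication by p in the filtration. -/
theorem powerData_of_isBaerSum (hn' : p + 1 ≤ n) {g : G} (hg : g ∈ gOne G)
    (hg' : g ∉ gammaSeries G 2) : PowerData p n s g (baerTrace hz p s ⟨g, hg⟩)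
      (baerForm hz p s ⟨g, hg⟩ ⟨g, hg⟩) := by
  have hF := baer_isUniserialFiltration hz h hn hs
  have hp2 := hp.out.two_le
  have hsp := hs.pow_prime_mem_last h (by omega)
  have hν := one_add_baerConj_sub_one (p := p) hz h hn hs
  have hF0 : ∀ a : gOne G, a ∈ baerGamma hz 0 := fun a => Subgroup.mem_top (a : G)
  have hlast : ∀ a : gOne G, a ∈ baerGamma hz (n - 2) ↔ (a : G) ∈ gammaSeries G (n - 1) := fun a => by
    rw [mem_baerGamma, show n - 2 + 1 = n - 1 by omega]
  have hle2 := h.gammaSeries_two_le_gOne hn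
  refine ⟨hs.not_mem_gOne hn, hg, hg', fun a ha => ?_, fun a ha b hb => ?_,
    (hlast _).1 (baerTrace_mem hz h hn hs _), (hlast _).1 (baerForm_mem hz h hn hs hu _),
    fun i => ?_, fun i a hi ha => ?_, fun i a hi ha ha' hin => ?_, fun a ha => ?_,
    fun a ha ha' hpn => ?_, fun hnp a ha b hb => ?_, fun hnp hgp => ?_⟩
  · rw [coe_mul_pow_prime hz s ⟨a, ha⟩, Subgroup.mul_mem_cancel_right _ hsp, ← hlast]
    exact add_mem (baerTrace_mem hz h hn hs _) (baerForm_mem hz h hn hs hu _)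
  · obtain ⟨b', hb', heq⟩ := exists_add_eq_mul hz h hn hs hu ⟨a, ha⟩ (b := ⟨b, hle2 hb⟩) hb
    have h1 : a * b = ((⟨a, ha⟩ * ⟨b, hle2 hb⟩ : gOne G) : G) := rfl
    rw [h1, heq, coe_mul_pow_prime hz, coe_mul_pow_prime hz s ⟨a, ha⟩, map_add,
      baerTrace_eq_zero hz h hn hs hb', add_zero, baerForm_add_left, baerForm_add_right,
      baerForm_add_right, baerForm_self_eq_zero hz h hn hs hu hb', add_zero,
      add_assoc (baerForm hz p s _ _), baerForm_add_swap_eq_zero hz h hn hs hu _ hb', add_zero]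
  · have h1 : g ^ i = ((i • ⟨g, hg⟩ : gOne G) : G) := by rw [hz.nsmul_eq]; rfl
    rw [h1, coe_mul_pow_prime hz, map_nsmul, baerForm_nsmul_left, baerForm_nsmul_right, smul_smul,
      add_eq_mul_of_mem_last hz h hn hs hu
        ((baerGamma hz (n - 2)).nsmul_mem (baerTrace_mem hz h hn hs _) i),
      hz.nsmul_eq, hz.nsmul_eq, ← pow_two]
    rfl
  · have ha1 : (⟨a, hle2 (gammaSeries_antitone hi ha)⟩ : gOne G) ∈ baerGamma hz (i - 1) := by
      rw [mem_baerGamma, show i - 1 + 1 = i by omega]; exact ha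
    have := hF.prime_nsmul_mem hp.out ha1 (by
      rw [hν, baerTrace_eq_zero hz h hn hs (hF.antitone (by omega : 1 ≤ i - 1) ha1)]
      exact zero_mem _)
    rw [mem_baerGamma, hz.nsmul_eq, show i - 1 + p - 1 + 1 = i + p - 1 by omega] at this
    exact this
  · have ha1 : (⟨a, hle2 (gammaSeries_antitone hi ha)⟩ : gOne G) ∈ baerGamma hz (i - 1) := by
      rw [mem_baerGamma, show i - 1 + 1 = i by omega]; exact ha
    have ha2 : (⟨a, hle2 (gammaSeries_antitone hi ha)⟩ : gOne G) ∉ baerGamma hz (i - 1 + 1) := by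
      rw [mem_baerGamma, show i - 1 + 1 + 1 = i + 1 by omega]; exact ha'
    have := hF.prime_nsmul_notMem hp.out ha1 ha2 (by omega) (by
      rw [hν, baerTrace_eq_zero hz h hn hs (hF.antitone (by omega : 1 ≤ i - 1) ha1)]
      exact zero_mem _)
    rw [mem_baerGamma, hz.nsmul_eq, show i - 1 + p + 1 = i + p by omega] at this
    exact this
  · have := hF.prime_nsmul_mem hp.out (hF0 ⟨a, ha⟩) (by
      rw [hν]
      exact hF.antitone (by omega) (baerTrace_mem hz h hn hs _))
    rw [mem_baerGamma, hz.nsmul_eq, show 0 + p - 1 + 1 = p by omega] at this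
    exact this
  · have := hF.prime_nsmul_notMem hp.out (hF0 ⟨a, ha⟩) ha' (by omega) (by
      rw [hν]
      exact hF.antitone (by omega) (baerTrace_mem hz h hn hs _))
    rw [mem_baerGamma, hz.nsmul_eq, show 0 + p + 1 = p + 1 by omega] at this
    exact this
  · obtain ⟨b', hb', heq⟩ := exists_add_eq_mul hz h hn hs hu ⟨a, ha⟩ (b := ⟨b, hle2 hb⟩) hb
    have h1 := hF.prime_nsmul_mem hp.out hb' (by
      rw [hν, baerTrace_eq_zero hz h hn hs hb']; exact zero_mem _)
    rw [show 1 + p - 1 = n - 1 by omega, hF.bot, AddSubgroup.mem_bot] at h1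
    have h2 : (a * b) ^ p = (((⟨a, ha⟩ * ⟨b, hle2 hb⟩ : gOne G) ^ p : gOne G) : G) := rfl
    rw [h2, heq, ← hz.nsmul_eq, smul_add, h1, add_zero, hz.nsmul_eq]
    rfl
  -- When p kills g, the trace of g is S^(p-1)g with S = σ - 1. The filtration has length n - 1 = p
  -- and g lies outside F 1, so this is nonzero.
  · obtain ⟨f, hf⟩ := IsUniserialFiltration.exists_geom_sum_apply hp.out (baerConj hz s - 1)
    have h1 : p • (⟨g, hg⟩ : gOne G) = 0 := by
      rw [hz.nsmul_eq, hz.zero_eq]; exact Subtype.ext hgp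
    have h2 := hf ⟨g, hg⟩
    rw [hν, h1, map_zero, map_zero, add_zero, zero_add] at h2
    have h3 := hF.pow_notMem (hF0 ⟨g, hg⟩) hg' (k := p - 1) (by omega)
    rw [show 0 + (p - 1) + 1 = n - 1 by omega, hF.bot, AddSubgroup.mem_bot, ← h2, hz.zero_eq] at h3
    exact fun h' => h3 (Subtype.ext h')

end BaerPower

theorem IsMaximalClass.exists_powerData_of_gOneClassLETwo {G : Type*} [Group G] {p n : ℕ}
    [hp : Fact p.Prime] (h : IsMaximalClass G p n) (hp3 : 3 ≤ p) (hn : p + 1 ≤ n)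
    (hC : GOneClassLETwo G) : ∃ s g α β : G, PowerData p n s g α β := by
  have hn4 : 4 ≤ n := by omega
  have := h.gOne_normal hn4
  obtain ⟨C, hCc, hCu⟩ := h.exists_isCoatom_isUniserialElement hn4 hC
  obtain ⟨s, hs1, hs2⟩ := exists_notMem_notMem (h.isCoatom_gOne hn4) hCc
  -- Only the exceptional subgroup C has to be avoided. If both as and a²s were in C, then a and s
  -- would be too; k = 2 is allowed since p is odd.
  have hu : ∀ a ∈ gOne G, ∃ k : ℕ, k.Coprime p ∧ IsUniserialElement n (a ^ k * s) := by
    intro a ha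
    have hns : ∀ k : ℕ, a ^ k * s ∉ gOne G := fun k hk =>
      hs1 ((Subgroup.mul_mem_cancel_left _ (pow_mem ha k)).1 hk)
    by_cases h1 : a * s ∈ C
    · refine ⟨2, (Nat.coprime_primes Nat.prime_two hp.out).2 (by omega), hCu _ (hns 2) fun h2 => ?_⟩
      have h3 := mul_mem h2 (inv_mem h1)
      rw [show a ^ 2 * s * (a * s)⁻¹ = a by group] at h3
      exact hs2 ((Subgroup.mul_mem_cancel_left _ h3).1 h1)
    · exact ⟨1, Nat.coprime_one_left p, hCu _ (hns 1) (by rwa [pow_one])⟩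
  obtain ⟨g, hg, hg'⟩ := Set.exists_of_ssubset
    (h.gammaSeries_two_lt_of_isCoatom (by omega) (h.isCoatom_gOne hn4))
  have hodd : Odd (p ^ n) := (hp.out.odd_of_ne_two (by omega)).pow
  -- The exponent (p^n + 1)/2 is an inverse of 2 modulo the order of G.
  have hr : ∀ a b : gOne G, ⁅a, b⁆ ^ (2 * ((p ^ n + 1) / 2)) = ⁅a, b⁆ := by
    intro a b
    rw [Nat.mul_div_cancel' hodd.add_one.two_dvd, pow_succ]
    have : (⁅a, b⁆ : gOne G) ^ p ^ n = 1 := by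
      ext
      rw [Subgroup.coe_pow, ← h.2.1, pow_card_eq_one']; rfl
    rw [this, one_mul]
  obtain ⟨_, z, hz⟩ := exists_isBaerSum (N := gOne G)
    (fun a b c => Subtype.ext (hC a a.2 b b.2 c c.2)) hr
  exact ⟨s, g, _, _, powerData_of_isBaerSum hz h hn4 (hCu s hs1 hs2) hu hn hg hg'⟩

/-! ### p-th powers in the metabelian case -/

section PowerSum

open Polynomial

theorem map_powerSum {R S : Type*} [Ring R] [Ring S] (φ : R →+* S) (p : ℕ) (π τ : R) (i : ℕ) :
    φ (powerSum p π τ i) = powerSum p (φ π) (φ τ) i := by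
  simp only [powerSum, map_sum, map_mul, map_pow, map_add, map_one]

/-- The endomorphism ring is not commutative, but the identity only involves polynomials in S. It is
proved in the quotient of ℤ[X] by the kernel of X ↦ S, which embeds in E. -/
theorem exists_powerSum_eq {E : Type*} [Ring E] {p : ℕ} (hp : p.Prime) (hp5 : 5 ≤ p) {S T : E}
    (hS : IsNilpotent S) (t g : ℤ[X]) (hT : T = S ^ 2 * aeval S t)
    (hν : ∑ l ∈ Finset.range p, (1 + S) ^ l = 0) (hx : (1 + T) ^ p = 1)
    (h1 : S * (aeval S g + powerSum p S T 1) = 0)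
    (h2 : S * (2 * aeval S g + powerSum p S T 2) = 0) :
    ∃ d : ℤ[X], ∀ i : ℕ, powerSum p S T i =
      i * (S ^ (p - 2) + S ^ (p - 1) * aeval S d) + (i : E) ^ 2 * (T * S ^ (p - 3)) := by
  let f : ℤ[X] →+* E := (aeval S : ℤ[X] →ₐ[ℤ] E)
  let φ := RingHom.kerLift f
  have hφ : Function.Injective φ := RingHom.kerLift_injective f
  let mk := Ideal.Quotient.mk (RingHom.ker f)
  have hmk : ∀ q, φ (mk q) = aeval S q := fun q => RingHom.kerLift_mk f q
  have hπ : φ (mk X) = S := by rw [hmk, aeval_X]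
  obtain ⟨τ, hτ0⟩ : ∃ τ, τ = mk (X ^ 2 * t) := ⟨_, rfl⟩
  have hτ : φ τ = T := by rw [hτ0, hmk, map_mul, map_pow, aeval_X, hT]
  have hn : IsNilpotent (mk X) := by
    obtain ⟨k, hk⟩ := hS
    exact ⟨k, hφ (by rw [map_pow, hπ, hk, map_zero])⟩
  have hν' : ∑ l ∈ Finset.range p, (1 + mk X) ^ l = 0 := hφ (by
    simp only [map_sum, map_pow, map_add, map_one, hπ, hν, map_zero])
  have key := powerSum_eq (g := mk g) hp hp5 hn (τ := τ) (τ' := mk t)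
    (by rw [hτ0, map_mul, map_pow]) hν'
    (hφ (by simp only [map_pow, map_add, map_one, hτ, hx]))
    (hφ (by rw [map_mul, map_add, map_powerSum, hmk g, hπ, hτ, h1, map_zero]))
    (hφ (by rw [map_mul, map_add, map_mul, map_ofNat, map_powerSum, hmk g, hπ, hτ, h2, map_zero]))
  obtain ⟨d, hd⟩ := exists_chooseTail_zero_eq_pow_mul hp hn hν'
  obtain ⟨d, rfl⟩ := Ideal.Quotient.mk_surjective d
  refine ⟨d, fun i => ?_⟩
  have := congrArg φ (key i)
  rw [hd] at this
  simp only [map_powerSum, map_add, map_mul, map_pow, map_natCast, hπ, hτ] at this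
  rw [this]
  congr 4

end PowerSum

theorem exists_addCommGroup_mul_eq_add {N : Type*} [Group N] (hN : ∀ a b : N, a * b = b * a) :
    ∃ _ : AddCommGroup N, ∀ a b : N, a * b = a + b := by
  let _ : CommGroup N := { ‹Group N› with mul_comm := hN }
  exact ⟨(inferInstance : AddCommGroup (Additive N)), fun _ _ => rfl⟩

section AddGroup

variable {N : Type*} [Group N] [AddCommGroup N] (hN : ∀ a b : N, a * b = a + b)

include hN

theorem zero_eq_one_of_mul_eq_add : (0 : N) = 1 := by
  have := hN 1 0
  rwa [one_mul, add_zero] at this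

theorem neg_eq_inv_of_mul_eq_add (a : N) : -a = a⁻¹ := by
  rw [neg_eq_iff_add_eq_zero, ← hN, mul_inv_cancel, zero_eq_one_of_mul_eq_add hN]

theorem nsmul_eq_pow_of_mul_eq_add (k : ℕ) (a : N) : k • a = a ^ k := by
  induction k with
  | zero => rw [zero_smul, pow_zero, zero_eq_one_of_mul_eq_add hN]
  | succ k ih => rw [succ_nsmul, pow_succ, hN, ih]

end AddGroup

section GammaTwo

variable {G : Type*} [Group G] [AddCommGroup (gammaSeries G 2)]
  (hA : ∀ a b : gammaSeries G 2, a * b = a + b)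

/-- Conjugation by `x` on the abelian group `γ₂`. -/
def gammaConj (x : G) : AddMonoid.End (gammaSeries G 2) :=
  AddMonoidHom.mk' (MulAut.conjNormal (H := gammaSeries G 2) x) fun a b => by
    rw [← hA, map_mul, hA]

theorem coe_gammaConj (x : G) (a : gammaSeries G 2) : (gammaConj hA x a : G) = x * a * x⁻¹ :=
  MulAut.conjNormal_apply x a

include hA in
theorem coe_gamma_add (a b : gammaSeries G 2) : ((a + b : gammaSeries G 2) : G) = a * b := by
  rw [← hA]; rfl

theorem gammaConj_mul (x y : G) : gammaConj hA (x * y) = gammaConj hA x * gammaConj hA y := by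
  refine AddMonoidHom.ext fun a => Subtype.ext ?_
  change (gammaConj hA (x * y) a : G) = gammaConj hA x (gammaConj hA y a)
  rw [coe_gammaConj, coe_gammaConj, coe_gammaConj]; group

theorem gammaConj_one : gammaConj hA (1 : G) = 1 := by
  refine AddMonoidHom.ext fun a => Subtype.ext ?_
  change (gammaConj hA 1 a : G) = a
  rw [coe_gammaConj]; group

theorem gammaConj_pow (x : G) (k : ℕ) : gammaConj hA (x ^ k) = gammaConj hA x ^ k := by
  induction k with
  | zero => rw [pow_zero, pow_zero, gammaConj_one]
  | succ k ih => rw [pow_succ, pow_succ, gammaConj_mul, ih]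

theorem gammaConj_eq_one {x : G} (hx : x ∈ gammaSeries G 2) : gammaConj hA x = 1 := by
  refine AddMonoidHom.ext fun a => Subtype.ext ?_
  change (gammaConj hA x a : G) = a
  have h1 : (⟨x, hx⟩ * a : gammaSeries G 2) = a * ⟨x, hx⟩ := by rw [hA, hA, add_comm]
  have h2 : x * (a : G) = a * x := congrArg Subtype.val h1
  rw [coe_gammaConj, h2, mul_inv_cancel_right]

theorem gammaConj_comm (x y : G) : gammaConj hA x * gammaConj hA y = gammaConj hA y * gammaConj hA x := by
  rw [← gammaConj_mul, ← gammaConj_mul, show x * y = ⁅x, y⁆ * (y * x) by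
    rw [commutatorElement_def]; group, gammaConj_mul,
    gammaConj_eq_one hA (commutatorElement_mem_gammaSeries_succ (i := 1) trivial y), one_mul]

theorem coe_pow_mul_mul_pow_mul (x : G) (i : ℕ) (a b : gammaSeries G 2) :
    (x ^ i * a : G) * (x * b) = x ^ (i + 1) * ((gammaConj hA x⁻¹ a + b : gammaSeries G 2) : G) := by
  rw [coe_gamma_add hA, coe_gammaConj, pow_succ]; group

theorem mul_pow_eq_pow_mul_geom_sum (x : G) (b : gammaSeries G 2) (i : ℕ) :
    (x * b) ^ i = x ^ i * ((∑ k ∈ Finset.range i, gammaConj hA x⁻¹ ^ k) b : gammaSeries G 2) := by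
  induction i with
  | zero => simp [zero_eq_one_of_mul_eq_add hA]
  | succ i ih =>
    rw [pow_succ, ih, coe_pow_mul_mul_pow_mul hA, geom_sum_succ]
    rfl

/-- Conjugating g by s multiplies it on the right by c. Collecting the copies of c behind g^i gives
the geometric sum in conjugation by g⁻¹, and repeating the conjugation gives the one in s. -/
theorem conj_pow_eq_pow_mul (s g : G) (i j : ℕ) {c : gammaSeries G 2}
    (hc : (c : G) = g⁻¹ * s * g * s⁻¹) : s ^ j * g ^ i * (s ^ j)⁻¹ =
      g ^ i * (((∑ l ∈ Finset.range j, gammaConj hA s ^ l) *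
        ∑ k ∈ Finset.range i, gammaConj hA g⁻¹ ^ k) c : gammaSeries G 2) := by
  induction j with
  | zero => simp [zero_eq_one_of_mul_eq_add hA]
  | succ j ih =>
    have h1 : s * g ^ i * s⁻¹ = g ^ i *
        ((∑ k ∈ Finset.range i, gammaConj hA g⁻¹ ^ k) c : gammaSeries G 2) := by
      rw [← mul_pow_eq_pow_mul_geom_sum hA, hc, ← conj_pow]
      congr 1; group
    have h2 : s ^ (j + 1) * g ^ i * (s ^ (j + 1))⁻¹ = s * (s ^ j * g ^ i * (s ^ j)⁻¹) * s⁻¹ := by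
      rw [pow_succ']; group
    set u := (∑ k ∈ Finset.range i, gammaConj hA g⁻¹ ^ k) c
    set v := ((∑ l ∈ Finset.range j, gammaConj hA s ^ l) *
        ∑ k ∈ Finset.range i, gammaConj hA g⁻¹ ^ k) c
    have h3 : ((∑ l ∈ Finset.range (j + 1), gammaConj hA s ^ l) *
        ∑ k ∈ Finset.range i, gammaConj hA g⁻¹ ^ k) c = u + gammaConj hA s v := by
      rw [geom_sum_succ, add_mul, one_mul, mul_assoc, add_comm]
      rfl
    rw [h2, ih, h3, coe_gamma_add hA, coe_gammaConj, ← mul_assoc (g ^ i), ← h1]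
    group

/-- In the ordered product of the conjugates of g^i, all powers of g are moved to the left. A part
in γ₂ is acted on by conjugation by g^(-i) once for each later factor, whence the weights in
`powerSum`. -/
theorem pow_mul_pow_prime (s g : G) (i m : ℕ) {c : gammaSeries G 2}
    (hc : (c : G) = g⁻¹ * s * g * s⁻¹) : (g ^ i * s) ^ m = g ^ (i * m) *
      (powerSum m (gammaConj hA s - 1) (gammaConj hA g⁻¹ - 1) i c : gammaSeries G 2) * s ^ m := by
  rw [mul_pow_eq_orderedProd]
  congr 1
  simp only [conj_pow_eq_pow_mul hA s g i _ hc, powerSum, add_sub_cancel]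
  induction m with
  | zero => simp [orderedProd, zero_eq_one_of_mul_eq_add hA]
  | succ m ih =>
    rw [orderedProd, ih, pow_mul, coe_pow_mul_mul_pow_mul hA, ← pow_mul, Finset.sum_range_succ,
      Nat.add_sub_cancel, Nat.sub_self, pow_zero, one_mul, AddMonoid.End.add_apply', ← inv_pow,
      gammaConj_pow, pow_mul]
    have hsum : ∑ x ∈ Finset.range m, (gammaConj hA g⁻¹ ^ i) ^ (m - x) *
        ((∑ l ∈ Finset.range x, gammaConj hA s ^ l) * ∑ k ∈ Finset.range i, gammaConj hA g⁻¹ ^ k) =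
        gammaConj hA g⁻¹ ^ i * ∑ x ∈ Finset.range m, (gammaConj hA g⁻¹ ^ i) ^ (m - 1 - x) *
        ((∑ l ∈ Finset.range x, gammaConj hA s ^ l) *
          ∑ k ∈ Finset.range i, gammaConj hA g⁻¹ ^ k) := by
      rw [Finset.mul_sum]
      refine Finset.sum_congr rfl fun j hj => ?_
      rw [Finset.mem_range] at hj
      rw [show m - j = m - 1 - j + 1 by omega, pow_succ', mul_assoc]
    rw [hsum]
    rfl

/-- `γ_{j+2}` as an additive subgroup of `γ₂`. -/
def gammaFiltration (hA : ∀ a b : gammaSeries G 2, a * b = a + b) (j : ℕ) :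
    AddSubgroup (gammaSeries G 2) where
  carrier := {a | (a : G) ∈ gammaSeries G (j + 2)}
  zero_mem' := by
    rw [Set.mem_ofPred_eq, zero_eq_one_of_mul_eq_add hA]; exact one_mem _
  add_mem' {a b} ha hb := by
    rw [Set.mem_ofPred_eq] at *
    rw [coe_gamma_add hA]; exact mul_mem ha hb
  neg_mem' {a} ha := by
    rw [Set.mem_ofPred_eq] at *
    rw [neg_eq_inv_of_mul_eq_add hA]; exact inv_mem ha

theorem mem_gammaFiltration {j : ℕ} {a : gammaSeries G 2} :
    a ∈ gammaFiltration hA j ↔ (a : G) ∈ gammaSeries G (j + 2) := Iff.rfl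

theorem coe_gammaConj_sub_one (x : G) (a : gammaSeries G 2) :
    ((gammaConj hA x - 1) a : G) = ⁅x, (a : G)⁆ := by
  have h1 : (gammaConj hA x - 1) a = gammaConj hA x a + -a := sub_eq_add_neg _ _
  rw [h1, coe_gamma_add hA, coe_gammaConj, neg_eq_inv_of_mul_eq_add hA]
  rfl

theorem gamma_isUniserialFiltration {p n : ℕ} [hp : Fact p.Prime] (h : IsMaximalClass G p n)
    (hn : 4 ≤ n) {s : G} (hs : IsUniserialElement n s) :
    IsUniserialFiltration (n - 2) (gammaConj hA s - 1) (gammaFiltration hA) where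
  zero := top_le_iff.1 fun a _ => a.2
  bot := by
    rw [eq_bot_iff]
    intro a ha
    rw [mem_gammaFiltration, show n - 2 + 2 = n by omega] at ha
    rw [AddSubgroup.mem_bot, zero_eq_one_of_mul_eq_add hA]
    exact Subtype.ext (h.eq_one_of_mem le_rfl ha)
  succ_le i a ha := gammaSeries_antitone (Nat.le_succ (i + 2)) ha
  map_mem {i a} ha := by
    rw [mem_gammaFiltration, coe_gammaConj_sub_one]
    exact commutatorElement_mem_gammaSeries_succ' ha s
  strict {i a} hi ha hSa := by
    rw [mem_gammaFiltration, coe_gammaConj_sub_one] at hSa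
    refine hs.mem_of_commutatorElement_mem h (i := i + 2) (by omega) (by omega) ha ?_
    rw [← commutatorElement_inv]; exact inv_mem hSa
  gen {i a b} ha ha' hb := by
    obtain ⟨k, hk⟩ := h.exists_pow_inv_mul_mem_gammaSeries (by omega) (i := i + 2) (by omega) ha ha' hb
    refine ⟨k, ?_⟩
    rw [mem_gammaFiltration, sub_eq_neg_add, coe_gamma_add hA, neg_eq_inv_of_mul_eq_add hA,
      nsmul_eq_pow_of_mul_eq_add hA]
    exact hk

end GammaTwo

theorem AddMonoid.End.ext' {A : Type*} [AddCommGroup A] {f g : AddMonoid.End A}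
    (h : ∀ a, f a = g a) : f = g := AddMonoidHom.ext h

section Metabelian

open Polynomial

variable {G : Type*} [Group G] [AddCommGroup (gammaSeries G 2)]
  (hA : ∀ a b : gammaSeries G 2, a * b = a + b)

include hA

theorem mul_pow_eq_geom_sum_mul (s : G) (b : gammaSeries G 2) (m : ℕ) :
    ((b : G) * s) ^ m = ((∑ l ∈ Finset.range m, gammaConj hA s ^ l) b : gammaSeries G 2) * s ^ m := by
  rw [mul_pow_eq_orderedProd]
  congr 1
  induction m with
  | zero => simp [orderedProd, zero_eq_one_of_mul_eq_add hA]
  | succ m ih =>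
    rw [orderedProd, ih, Finset.sum_range_succ, AddMonoid.End.add_apply', coe_gamma_add hA,
      ← gammaConj_pow, coe_gammaConj]

variable {p n : ℕ} [hp : Fact p.Prime] (h : IsMaximalClass G p n)

include h

/-- The trace of b is (bs)^p s^(-p), which is trivial because γ₂s is a conjugacy class. -/
theorem gammaConj_geom_sum_eq_zero (hn : 4 ≤ n) {s : G} (hs : IsUniserialElement n s) :
    ∑ l ∈ Finset.range p, gammaConj hA s ^ l = 0 := by
  refine AddMonoidHom.ext fun b => ?_
  have h1 := mul_pow_eq_geom_sum_mul hA s b p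
  rw [hs.mul_pow_prime h hn b.2] at h1
  refine Subtype.ext ((mul_eq_right.1 h1.symm).trans ?_)
  change (1 : G) = ((0 : gammaSeries G 2) : G)
  rw [zero_eq_one_of_mul_eq_add hA]; rfl

theorem mem_of_nsmul_mem_gammaFiltration {k j : ℕ} (hk : k.Coprime p) {a : gammaSeries G 2}
    (ha : k • a ∈ gammaFiltration hA j) : a ∈ gammaFiltration hA j := by
  have := h.finite
  rw [mem_gammaFiltration, nsmul_eq_pow_of_mul_eq_add hA, Subgroup.coe_pow] at ha
  exact mem_of_pow_mem_of_coprime h.2.1 hk ha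

/-- As an S-module γ₂ is cyclic, generated by c = [g⁻¹, s]. The operator T of g⁻¹ commutes with S
and sends c into γ₄, so T is S² times a polynomial in S. As each (g^i s)^p lies in γ_{n-1}, the
quadratic formula for `powerSum` applies. It yields α = g^p + w and β = T S^(p-3) c, where w has
leading term S^(p-2)c and so lies in γ_p ∖ γ_{p+1}. Comparing g^p with -w modulo γ_{n-1} gives the
remaining claims. -/
theorem exists_pow_mul_pow_prime_eq (hG : IsMetabelianGroup G) (hp5 : 5 ≤ p) (hn : p + 1 ≤ n)
    {s g : G} (hs : s ∉ gOne G) (hg : g ∈ gOne G) (hg' : g ∉ gammaSeries G 2) :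
    ∃ α β : G, α ∈ gammaSeries G (n - 1) ∧ β ∈ gammaSeries G (n - 1) ∧
      (∀ i : ℕ, (g ^ i * s) ^ p = α ^ i * β ^ (i ^ 2) * s ^ p) ∧ g ^ p ∈ gammaSeries G p ∧
      (p + 2 ≤ n → g ^ p ∉ gammaSeries G (p + 1)) ∧ (n = p + 1 → g ^ p = 1 → α ≠ 1) := by
  have hn4 : 4 ≤ n := by omega
  have hs' := h.isUniserialElement_of_metabelian hn4 hG hs
  have hF := gamma_isUniserialFiltration hA h hn4 hs'
  have hsp := hs'.pow_prime_mem_last h (by omega)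
  obtain ⟨c, hc⟩ : ∃ c : gammaSeries G 2, (c : G) = g⁻¹ * s * g * s⁻¹ :=
    ⟨⟨⁅g⁻¹, s⁆, commutatorElement_mem_gammaSeries_succ (i := 1) trivial s⟩, by
      change ⁅g⁻¹, s⁆ = _
      rw [commutatorElement_def, inv_inv]⟩
  have hcF : c ∉ gammaFiltration hA 1 := by
    rw [mem_gammaFiltration, hc]
    intro h'
    rw [show g⁻¹ * s * g * s⁻¹ = ⁅g⁻¹, s⁆ by rw [commutatorElement_def, inv_inv]] at h'
    exact hg' (inv_mem_iff.1 (hs'.mem_two_of_commutatorElement_mem h hn4 (inv_mem hg) h'))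
  have hF0 : ∀ a, a ∈ gammaFiltration hA 0 := fun a => a.2
  obtain ⟨S, hS⟩ : ∃ S, S = gammaConj hA s - 1 := ⟨_, rfl⟩
  obtain ⟨T, hT⟩ : ∃ T, T = gammaConj hA g⁻¹ - 1 := ⟨_, rfl⟩
  have hST : Commute T S := by
    rw [hS, hT]
    exact (Commute.sub_left (gammaConj_comm hA _ _) (Commute.one_left _)).sub_right
      (Commute.one_right _)
  rw [← hS] at hF
  have hgen : ∀ a, ∃ f : ℤ[X], a = (aeval S f) c := fun a => by
    obtain ⟨f, hf⟩ := hF.exists_eq_aeval hcF (hF0 a)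
    exact ⟨f, hf⟩
  have hcommS : ∀ (f : ℤ[X]) a, T ((aeval S f) a) = (aeval S f) (T a) := by
    intro f a
    have h1 : Commute T (aeval S f) := by
      induction f using Polynomial.induction_on' with
      | add f g hf hg => rw [map_add]; exact hf.add_right hg
      | monomial k m =>
        rw [aeval_monomial, algebraMap_int_eq, eq_intCast]
        exact (Int.cast_commute m T).symm.mul_right (hST.pow_right k)
    exact DFunLike.congr_fun h1.eq a
  have hcommA : ∀ (f k : ℤ[X]) a, (aeval S k) ((aeval S f) a) = (aeval S f) ((aeval S k) a) := by
    intro f k a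
    have h1 : aeval S k * aeval S f = aeval S f * aeval S k := by
      rw [← map_mul, mul_comm, map_mul]
    exact DFunLike.congr_fun h1 a
  have hfaith : ∀ f : ℤ[X], (aeval S f) c = 0 → aeval S f = 0 := by
    intro f hf
    refine AddMonoid.End.ext' fun a => ?_
    obtain ⟨k, rfl⟩ := hgen a
    rw [hcommA k f, hf, map_zero]; rfl
  have hTc : T c ∈ gammaFiltration hA 2 := by
    rw [hT, mem_gammaFiltration, coe_gammaConj_sub_one]
    rw [← commutatorElement_inv]
    rw [gOne_eq_twoStepCentralizer] at hg
    exact inv_mem (mem_twoStepCentralizer.1 (inv_mem hg) c c.2)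
  obtain ⟨t, ht⟩ := hF.exists_eq_aeval hcF hTc
  have hTt : T = S ^ 2 * aeval S t := by
    refine AddMonoid.End.ext' fun a => ?_
    obtain ⟨k, rfl⟩ := hgen a
    rw [hcommS, ht]
    have h1 : aeval S k * (S ^ 2 * aeval S t) = S ^ 2 * aeval S t * aeval S k := by
      have : S ^ 2 = aeval S (X ^ 2 : ℤ[X]) := by rw [map_pow, aeval_X]
      rw [this, ← map_mul, ← map_mul, ← map_mul, mul_comm]
    exact DFunLike.congr_fun h1 c
  have hWpoly : ∀ i, powerSum p S T i = aeval S (powerSum p X (X ^ 2 * t) i) := by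
    intro i
    have := map_powerSum ((aeval S : ℤ[X] →ₐ[ℤ] _) : ℤ[X] →+* AddMonoid.End (gammaSeries G 2))
      p X (X ^ 2 * t) i
    simp only [RingHom.coe_coe, map_mul, map_pow, aeval_X, ← hTt] at this
    exact this.symm
  have hgp : g ^ p ∈ gammaSeries G 2 := h.pow_prime_mem_gammaSeries_two (by omega) g
  obtain ⟨q, hq⟩ := hgen ⟨g ^ p, hgp⟩
  have hpow : ∀ i : ℕ, (g ^ i * s) ^ p =
      ((i • (⟨g ^ p, hgp⟩ : gammaSeries G 2) + powerSum p S T i c : gammaSeries G 2) : G) * s ^ p := by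
    intro i
    rw [pow_mul_pow_prime hA s g i p hc, coe_gamma_add hA, nsmul_eq_pow_of_mul_eq_add hA,
      Subgroup.coe_pow, mul_comm i p, pow_mul, hS, hT]
  have hmem : ∀ i : ℕ, i • (⟨g ^ p, hgp⟩ : gammaSeries G 2) + powerSum p S T i c ∈
      gammaFiltration hA (n - 3) := by
    intro i
    have h1 : IsUniserialElement n (g ^ i * s) := h.isUniserialElement_of_metabelian hn4 hG
      fun h' => hs ((Subgroup.mul_mem_cancel_left _ (pow_mem hg i)).1 h')
    have h2 := h1.pow_prime_mem_last h (by omega)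
    rw [hpow i, Subgroup.mul_mem_cancel_right _ hsp] at h2
    rwa [mem_gammaFiltration, show n - 3 + 2 = n - 1 by omega]
  have hzero : ∀ i : ℕ, S * ((i : AddMonoid.End (gammaSeries G 2)) * aeval S q +
      powerSum p S T i) = 0 := by
    intro i
    have h1 := hF.map_mem (hmem i)
    rw [show n - 3 + 1 = n - 2 by omega, hF.bot, AddSubgroup.mem_bot] at h1
    have h2 := hfaith (X * ((i : ℤ[X]) * q + powerSum p X (X ^ 2 * t) i)) (by
      rw [map_mul, map_add, map_mul, map_natCast, aeval_X, ← hWpoly]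
      rw [hq] at h1
      rw [← h1]
      rfl)
    rwa [map_mul, map_add, map_mul, map_natCast, aeval_X, ← hWpoly] at h2
  have hν : ∑ l ∈ Finset.range p, (1 + S) ^ l = 0 := by
    rw [hS, add_sub_cancel]
    exact gammaConj_geom_sum_eq_zero hA h hn4 hs'
  have hx : (1 + T) ^ p = 1 := by
    rw [hT, add_sub_cancel, ← gammaConj_pow, inv_pow]
    exact gammaConj_eq_one hA (inv_mem hgp)
  obtain ⟨d, hd⟩ := exists_powerSum_eq hp.out hp5 ⟨_, hF.pow_eq_zero⟩ t q hTt hν hx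
    (by simpa using hzero 1) (by simpa using hzero 2)
  obtain ⟨w, hw⟩ : ∃ w, w = (S ^ (p - 2)) c + (S ^ (p - 1)) ((aeval S d) c) := ⟨_, rfl⟩
  obtain ⟨b, hb⟩ : ∃ b, b = T ((S ^ (p - 3)) c) := ⟨_, rfl⟩
  have hWc : ∀ i : ℕ, powerSum p S T i c = i • w + (i ^ 2) • b := by
    intro i
    rw [hd i, hw, hb, ← Nat.cast_pow]
    rw [AddMonoid.End.add_apply']
    change (i : AddMonoid.End (gammaSeries G 2)) _ +
      ((i ^ 2 : ℕ) : AddMonoid.End (gammaSeries G 2)) _ = _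
    rw [AddMonoid.End.natCast_apply, AddMonoid.End.natCast_apply]
    rfl
  have hmem' : ∀ i : ℕ, i • ((⟨g ^ p, hgp⟩ : gammaSeries G 2) + w) + (i ^ 2) • b ∈
      gammaFiltration hA (n - 3) := by
    intro i
    have := hmem i
    rwa [hWc, ← add_assoc, ← smul_add] at this
  -- The value at i = 2 minus twice the value at i = 1 is 2b.
  have hbF : b ∈ gammaFiltration hA (n - 3) := by
    have h1 := sub_mem (hmem' 2) ((gammaFiltration hA (n - 3)).nsmul_mem (hmem' 1) 2)
    refine mem_of_nsmul_mem_gammaFiltration hA h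
      ((Nat.coprime_primes Nat.prime_two hp.out).2 (by omega : 2 ≠ p)) (k := 2) ?_
    convert h1 using 1
    simp only [one_smul, one_pow]
    abel
  have haF : (⟨g ^ p, hgp⟩ : gammaSeries G 2) + w ∈ gammaFiltration hA (n - 3) := by
    have h1 := sub_mem (hmem' 1) hbF
    simpa using h1
  have hlast : ∀ a : gammaSeries G 2, a ∈ gammaFiltration hA (n - 3) ↔
      (a : G) ∈ gammaSeries G (n - 1) := fun a => by
    rw [mem_gammaFiltration, show n - 3 + 2 = n - 1 by omega]
  have hc0 := hF0 c
  have hwmem : w ∈ gammaFiltration hA (p - 2) := by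
    rw [hw]
    have h1 := hF.pow_mem hc0 (p - 2)
    have h2 := hF.pow_mem (hF0 ((aeval S d) c)) (p - 1)
    rw [zero_add] at h1 h2
    exact add_mem h1 (hF.antitone (by omega) h2)
  have hwmem' : w ∉ gammaFiltration hA (p - 1) := by
    intro h'
    have h2 := hF.pow_mem (hF0 ((aeval S d) c)) (p - 1)
    rw [zero_add] at h2
    have h3 := sub_mem h' h2
    rw [hw, add_sub_cancel_right] at h3
    refine hF.pow_notMem hc0 hcF (k := p - 2) (by omega) ?_
    rwa [show 0 + (p - 2) + 1 = p - 1 by omega]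
  refine ⟨((⟨g ^ p, hgp⟩ + w : gammaSeries G 2) : G), b, (hlast _).1 haF, (hlast _).1 hbF,
    fun i => ?_, ?_, fun hpn hgp' => ?_, fun hnp hg1 hα => ?_⟩
  · rw [hpow, hWc, ← add_assoc, ← smul_add, coe_gamma_add hA, nsmul_eq_pow_of_mul_eq_add hA,
      nsmul_eq_pow_of_mul_eq_add hA]
    rfl
  · have h1 := sub_mem (hF.antitone (by omega : p - 2 ≤ n - 3) haF) hwmem
    rw [add_sub_cancel_right, mem_gammaFiltration, show p - 2 + 2 = p by omega] at h1
    exact h1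
  · have h1 : (⟨g ^ p, hgp⟩ : gammaSeries G 2) ∈ gammaFiltration hA (p - 1) := by
      rw [mem_gammaFiltration, show p - 1 + 2 = p + 1 by omega]; exact hgp'
    have h2 := sub_mem (hF.antitone (by omega : p - 1 ≤ n - 3) haF) h1
    rw [add_sub_cancel_left] at h2
    exact hwmem' h2
  · have h1 : (⟨g ^ p, hgp⟩ : gammaSeries G 2) = 0 := by
      rw [zero_eq_one_of_mul_eq_add hA]; exact Subtype.ext hg1
    rw [h1, zero_add] at hα
    refine hwmem' ?_
    rw [mem_gammaFiltration, hα]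
    exact one_mem _

end Metabelian

theorem IsMaximalClass.exists_powerData_of_metabelian {G : Type*} [Group G] {p n : ℕ}
    [hp : Fact p.Prime] (h : IsMaximalClass G p n) (hp5 : 5 ≤ p) (hn : p + 1 ≤ n)
    (hG : IsMetabelianGroup G) : ∃ s g α β : G, PowerData p n s g α β := by
  have hn4 : 4 ≤ n := by omega
  have hle2 := h.gammaSeries_two_le_gOne hn4
  obtain ⟨_, hA⟩ := exists_addCommGroup_mul_eq_add (N := gammaSeries G 2)
    fun a b => Subtype.ext (hG.commute a.2 b.2)
  obtain ⟨s, -, hs⟩ := Set.exists_of_ssubset (h.isCoatom_gOne hn4).lt_top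
  obtain ⟨g, hg, hg'⟩ := Set.exists_of_ssubset
    (h.gammaSeries_two_lt_of_isCoatom (by omega) (h.isCoatom_gOne hn4))
  have huni : ∀ x, x ∉ gOne G → IsUniserialElement n x := fun x hx =>
    h.isUniserialElement_of_metabelian hn4 hG hx
  have huni' : ∀ a ∈ gOne G, IsUniserialElement n (a * s) := fun a ha =>
    huni _ fun h' => hs ((Subgroup.mul_mem_cancel_left _ ha).1 h')
  have hF := gamma_isUniserialFiltration hA h hn4 (huni s hs)
  have hν : ∑ l ∈ Finset.range p, (1 + (gammaConj hA s - 1)) ^ l = 0 := by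
    rw [add_sub_cancel]
    exact gammaConj_geom_sum_eq_zero hA h hn4 (huni s hs)
  have hmem : ∀ i a, 2 ≤ i → a ∈ gammaSeries G i → a ^ p ∈ gammaSeries G (i + p - 1) := by
    intro i a hi ha
    have ha1 : (⟨a, gammaSeries_antitone hi ha⟩ : gammaSeries G 2) ∈ gammaFiltration hA (i - 2) := by
      rw [mem_gammaFiltration, show i - 2 + 2 = i by omega]; exact ha
    have := hF.prime_nsmul_mem hp.out ha1 (by rw [hν]; exact zero_mem _)
    rw [mem_gammaFiltration, nsmul_eq_pow_of_mul_eq_add hA,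
      show i - 2 + p - 1 + 2 = i + p - 1 by omega] at this
    exact this
  have hlast : n = p + 1 → ∀ b ∈ gammaSeries G 2, b ^ p = 1 := fun hnp b hb =>
    h.eq_one_of_mem (by omega : n ≤ 2 + p - 1) (hmem 2 b le_rfl hb)
  obtain ⟨α, β, hα, hβ, hpow, -, -, hα1⟩ := exists_pow_mul_pow_prime_eq hA h hG hp5 hn hs hg hg'
  refine ⟨s, g, α, β, hs, hg, hg', fun a ha => (huni' a ha).pow_prime_mem_last h (by omega),
    fun a ha b hb => ?_, hα, hβ, hpow, hmem, fun i a hi ha ha' hin => ?_, fun a ha => ?_,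
    fun a ha ha' hpn => ?_, fun hnp a ha b hb => ?_, hα1⟩
  · rw [show a * b * s = a * b * a⁻¹ * (a * s) by group]
    exact (huni' a ha).mul_pow_prime h hn4 (conj_mem_gammaSeries hb a)
  · have ha1 : (⟨a, gammaSeries_antitone hi ha⟩ : gammaSeries G 2) ∈ gammaFiltration hA (i - 2) := by
      rw [mem_gammaFiltration, show i - 2 + 2 = i by omega]; exact ha
    have ha2 : (⟨a, gammaSeries_antitone hi ha⟩ : gammaSeries G 2) ∉
        gammaFiltration hA (i - 2 + 1) := by
      rw [mem_gammaFiltration, show i - 2 + 1 + 2 = i + 1 by omega]; exact ha'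
    have := hF.prime_nsmul_notMem hp.out ha1 ha2 (by omega) (by rw [hν]; exact zero_mem _)
    rw [mem_gammaFiltration, nsmul_eq_pow_of_mul_eq_add hA,
      show i - 2 + p + 2 = i + p by omega] at this
    exact this
  · by_cases ha' : a ∈ gammaSeries G 2
    · exact gammaSeries_antitone (by omega) (hmem 2 a le_rfl ha')
    · obtain ⟨-, -, -, -, -, hap, -⟩ := exists_pow_mul_pow_prime_eq hA h hG hp5 hn hs ha ha'
      exact hap
  · obtain ⟨-, -, -, -, -, -, hap, -⟩ := exists_pow_mul_pow_prime_eq hA h hG hp5 hn hs ha ha'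
    exact hap hpn
  -- For n = p + 1 the group γ₂ has exponent p and p - 1 commutations lead from γ₂ to γ_n = 1. Hence
  -- the geometric sum of conjugations by a⁻¹ vanishes on b, and (ab)^p = a^p.
  · obtain ⟨f, hf⟩ := IsUniserialFiltration.exists_geom_sum_apply hp.out (gammaConj hA a⁻¹ - 1)
    have h1 := hf ⟨b, hb⟩
    have h2 : p • (⟨b, hb⟩ : gammaSeries G 2) = 0 := by
      rw [nsmul_eq_pow_of_mul_eq_add hA, zero_eq_one_of_mul_eq_add hA]
      exact Subtype.ext (hlast hnp b hb)
    have h3 : ∀ k, ((gammaConj hA a⁻¹ - 1) ^ k) ⟨b, hb⟩ ∈ gammaFiltration hA k := by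
      intro k
      induction k with
      | zero => exact hb
      | succ k ih =>
        rw [pow_succ']
        rw [mem_gammaFiltration]
        change (((gammaConj hA a⁻¹ - 1) (((gammaConj hA a⁻¹ - 1) ^ k) ⟨b, hb⟩) : gammaSeries G 2) : G) ∈ _
        rw [coe_gammaConj_sub_one]
        exact commutatorElement_mem_gammaSeries_succ' ih _
    have h4 := h3 (p - 1)
    rw [show p - 1 = n - 2 by omega, hF.bot, AddSubgroup.mem_bot, show n - 2 = p - 1 by omega] at h4
    rw [h2, map_zero, map_zero, add_zero, zero_add, h4, add_sub_cancel] at h1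
    have h5 := mul_pow_eq_pow_mul_geom_sum hA a ⟨b, hb⟩ p
    rw [h1, zero_eq_one_of_mul_eq_add hA] at h5
    rw [h5, Subgroup.coe_one, mul_one]

theorem IsMaximalClass.exists_powerData {G : Type*} [Group G] {p n : ℕ} [hp : Fact p.Prime]
    (h : InFamily G p n) (hp5 : 5 ≤ p) : ∃ s g α β : G, PowerData p n s g α β :=
  (IsMaximalClass.metabelian_or_gOneClassLETwo_of_inFamily h (by have := h.2.1; omega)).elim
    (h.1.exists_powerData_of_metabelian hp5 h.2.1)
    (h.1.exists_powerData_of_gOneClassLETwo (by omega) h.2.1)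

/-! ### Membership in Σ(S) -/

section SigmaSet

variable {G : Type*} [Group G]

theorem mem_beauvilleSigma {S : G × G} {y : G} : y ∈ beauvilleSigma S ↔
    ∃ t ∈ ({S.1, S.2, S.1 * S.2} : Set G), ∃ (u : G) (k : ℤ), y = u⁻¹ * t ^ k * u := by
  have key : ∀ (t u : G) (k : ℤ), (u⁻¹ * t * u) ^ k = u⁻¹ * t ^ k * u := fun t u k => by
    have := conj_zpow (a := u⁻¹) (b := t) (i := k)
    rwa [inv_inv] at this
  unfold beauvilleSigma
  simp only [Set.mem_iUnion, SetLike.mem_coe, Subgroup.mem_zpowers_iff, exists_prop, key, eq_comm]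

theorem one_mem_beauvilleSigma (S : G × G) : (1 : G) ∈ beauvilleSigma S :=
  mem_beauvilleSigma.2 ⟨S.1, by simp, 1, 0, by simp⟩

theorem isBeauvilleStructure_of_forall {S₁ S₂ : G × G} (h1 : IsGeneratingPair S₁)
    (h2 : IsGeneratingPair S₂) (h : ∀ t ∈ ({S₁.1, S₁.2, S₁.1 * S₁.2} : Set G),
      ∀ t' ∈ ({S₂.1, S₂.2, S₂.1 * S₂.2} : Set G), ∀ (u w : G) (k l : ℤ),
      u⁻¹ * t ^ k * u = w⁻¹ * t' ^ l * w → u⁻¹ * t ^ k * u = 1) : IsBeauvilleStructure S₁ S₂ := by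
  refine ⟨h1, h2, Set.Subset.antisymm ?_ (Set.singleton_subset_iff.2
    ⟨one_mem_beauvilleSigma _, one_mem_beauvilleSigma _⟩)⟩
  rintro y ⟨hy1, hy2⟩
  obtain ⟨t, ht, u, k, rfl⟩ := mem_beauvilleSigma.1 hy1
  obtain ⟨t', ht', w, l, hl⟩ := mem_beauvilleSigma.1 hy2
  exact h t ht t' ht' u w k l hl

theorem IsBeauvilleStructure.eq_one {S₁ S₂ : G × G} (h : IsBeauvilleStructure S₁ S₂) {t t' : G}
    (ht : t ∈ ({S₁.1, S₁.2, S₁.1 * S₁.2} : Set G)) (ht' : t' ∈ ({S₂.1, S₂.2, S₂.1 * S₂.2} : Set G))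
    {u w : G} {k l : ℤ} (heq : u⁻¹ * t ^ k * u = w⁻¹ * t' ^ l * w) : u⁻¹ * t ^ k * u = 1 := by
  have : u⁻¹ * t ^ k * u ∈ beauvilleSigma S₁ ∩ beauvilleSigma S₂ :=
    ⟨mem_beauvilleSigma.2 ⟨t, ht, u, k, rfl⟩, mem_beauvilleSigma.2 ⟨t', ht', w, l, heq⟩⟩
  rwa [h.2.2, Set.mem_singleton_iff] at this

end SigmaSet

/-! ### Coordinates on G / γ₂ and generating pairs -/

section AdditiveFunction

variable {G A : Type*} [Group G] [AddCommGroup A] {f : G → A}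
  (hf : ∀ x y, f (x * y) = f x + f y)

include hf

theorem map_zpow_eq_zsmul (x : G) (k : ℤ) : f (x ^ k) = k • f x :=
  (AddMonoidHom.mk' (fun x : Additive G => f x.toMul) fun _ _ => hf _ _).map_zsmul k (.ofMul x)

theorem map_one_eq_zero : f 1 = 0 := by simpa using map_zpow_eq_zsmul hf 1 0

theorem map_inv_eq_neg (x : G) : f x⁻¹ = -f x := by simpa using map_zpow_eq_zsmul hf x (-1)

theorem map_npow_eq_nsmul (x : G) (k : ℕ) : f (x ^ k) = k • f x := by
  simpa using map_zpow_eq_zsmul hf x k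

theorem map_conj_eq (x u : G) : f (u⁻¹ * x * u) = f x := by
  rw [hf, hf, map_inv_eq_neg hf]; abel

end AdditiveFunction

/-- `φ` and `ψ` are the coordinates on `G / γ₂` with respect to the basis `(g, s)`, where `M` is
the maximal subgroup generated by `g` and `γ₂`. -/
structure IsCoordinatePair {G : Type*} [Group G] {p : ℕ} (M : Subgroup G) (s g : G)
    (φ ψ : G → ZMod p) : Prop where
  φ_mul : ∀ x y, φ (x * y) = φ x + φ y
  ψ_mul : ∀ x y, ψ (x * y) = ψ x + ψ y
  mem_two : ∀ x, x ∈ gammaSeries G 2 ↔ φ x = 0 ∧ ψ x = 0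
  mem : ∀ x, x ∈ M ↔ ψ x = 0
  φ_g : φ g = 1
  φ_s : φ s = 0
  ψ_s : ψ s = 1

theorem exists_additive_of_card_eq_mul {G : Type*} [Group G] [Finite G] {p : ℕ} [hp : Fact p.Prime]
    {N K : Subgroup G} [N.Normal] (hNK : N ≤ K) (hcard : Nat.card K = p * Nat.card N) {t : G}
    (ht : t ∈ K) (ht' : t ∉ N) : ∃ f : K → ZMod p, (∀ x y : K, f (x * y) = f x + f y) ∧
      (∀ x : K, (x : G) ∈ N ↔ f x = 0) ∧ f ⟨t, ht⟩ = 1 := by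
  have hc := quotient_card_eq_of_card_eq_mul hNK hcard
  let e : (K ⧸ N.subgroupOf K) ≃* Multiplicative (ZMod p) := mulEquivOfPrimeCardEq (p := p) hc
    (by rw [Nat.card_congr Multiplicative.toAdd, Nat.card_zmod])
  let f : K → ZMod p := fun x => (e (QuotientGroup.mk x)).toAdd
  have hf : ∀ x y, f (x * y) = f x + f y := fun x y => by
    simp only [f, QuotientGroup.mk_mul, map_mul, toAdd_mul]
  have hf0 : ∀ x : K, (x : G) ∈ N ↔ f x = 0 := fun x => by
    rw [← Subgroup.mem_subgroupOf, ← QuotientGroup.eq_one_iff (N := N.subgroupOf K) x,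
      ← map_eq_one_iff e e.injective]
    rfl
  have hft : f ⟨t, ht⟩ ≠ 0 := fun h => ht' ((hf0 ⟨t, ht⟩).2 h)
  refine ⟨fun x => (f ⟨t, ht⟩)⁻¹ * f x, fun x y => by
    change _ * f (x * y) = _; rw [hf, mul_add], fun x => ?_,
    inv_mul_cancel₀ hft⟩
  rw [hf0, mul_eq_zero, or_iff_right (inv_ne_zero hft)]

theorem IsMaximalClass.exists_isCoordinatePair {G : Type*} [Group G] {p n : ℕ} [hp : Fact p.Prime]
    (h : IsMaximalClass G p n) (hn : 3 ≤ n) {M : Subgroup G} (hM : IsCoatom M) {s g : G}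
    (hs : s ∉ M) (hg : g ∈ M) (hg' : g ∉ gammaSeries G 2) :
    ∃ φ ψ : G → ZMod p, IsCoordinatePair M s g φ ψ := by
  have := h.finite
  have hle := (h.gammaSeries_two_lt_of_isCoatom hn hM).le
  have hs2 : s ∉ gammaSeries G 2 := fun h' => hs (hle h')
  have hN := h.isCoatom_zpowers_sup hn hs2
  have hsN : s ∈ Subgroup.zpowers s ⊔ gammaSeries G 2 :=
    (le_sup_left : Subgroup.zpowers s ≤ _) (Subgroup.mem_zpowers s)
  have hMN : ∀ x, x ∈ M → x ∈ Subgroup.zpowers s ⊔ gammaSeries G 2 → x ∈ gammaSeries G 2 := by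
    intro x hx hx'
    by_contra hx2
    exact hs (h.isCoatom_eq_of_mem hn hM hN hx hx' hx2 ▸ hsN)
  have hMn := normal_of_gammaSeries_two_le hle
  have hNn : (Subgroup.zpowers s ⊔ gammaSeries G 2).Normal :=
    normal_of_gammaSeries_two_le le_sup_right
  obtain ⟨f1, hf1, hf1', hf1g⟩ := exists_additive_of_card_eq_mul le_top (h.card_top_eq hn hN)
    (Subgroup.mem_top g) (fun h' => hg' (hMN g hg h'))
  obtain ⟨f2, hf2, hf2', hf2s⟩ := exists_additive_of_card_eq_mul le_top (h.card_top_eq hn hM)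
    (Subgroup.mem_top s) hs
  refine ⟨fun x => f1 ⟨x, Subgroup.mem_top x⟩, fun x => f2 ⟨x, Subgroup.mem_top x⟩,
    ⟨fun x y => hf1 ⟨x, _⟩ ⟨y, _⟩, fun x y => hf2 ⟨x, _⟩ ⟨y, _⟩, fun x => ?_,
      fun x => hf2' ⟨x, Subgroup.mem_top x⟩, hf1g, (hf1' ⟨s, Subgroup.mem_top s⟩).1 hsN, hf2s⟩⟩
  rw [← hf1', ← hf2']
  exact ⟨fun hx => ⟨(le_sup_right : gammaSeries G 2 ≤ _) hx, hle hx⟩, fun hx => hMN x hx.2 hx.1⟩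

namespace IsCoordinatePair

variable {G : Type*} [Group G] {p n : ℕ} [hp : Fact p.Prime] {M : Subgroup G} {s g : G}
  {φ ψ : G → ZMod p}

/-- The subgroup cut out by a linear equation in the coordinates. -/
def linearSubgroup (hc : IsCoordinatePair M s g φ ψ) (l m : ZMod p) : Subgroup G where
  carrier := {x | l * φ x + m * ψ x = 0}
  one_mem' := by
    change l * φ 1 + m * ψ 1 = 0
    rw [map_one_eq_zero hc.φ_mul, map_one_eq_zero hc.ψ_mul]; ring
  mul_mem' {x y} hx hy := by
    change l * φ (x * y) + m * ψ (x * y) = 0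
    change l * φ x + m * ψ x = 0 at hx
    change l * φ y + m * ψ y = 0 at hy
    rw [hc.φ_mul, hc.ψ_mul]; linear_combination hx + hy
  inv_mem' {x} hx := by
    change l * φ x⁻¹ + m * ψ x⁻¹ = 0
    change l * φ x + m * ψ x = 0 at hx
    rw [map_inv_eq_neg hc.φ_mul, map_inv_eq_neg hc.ψ_mul]; linear_combination -hx

theorem mem_linearSubgroup (hc : IsCoordinatePair M s g φ ψ) {l m : ZMod p} {x : G} :
    x ∈ hc.linearSubgroup l m ↔ l * φ x + m * ψ x = 0 := Iff.rfl

theorem ψ_g (hc : IsCoordinatePair M s g φ ψ) (hg : g ∈ M) : ψ g = 0 := (hc.mem g).1 hg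

/-- If the determinant vanished, some nonzero linear form would vanish on both generators and cut
out a proper subgroup containing them. -/
theorem det_ne_zero (hc : IsCoordinatePair M s g φ ψ) (hg : g ∈ M) {S : G × G}
    (hS : IsGeneratingPair S) : φ S.1 * ψ S.2 - φ S.2 * ψ S.1 ≠ 0 := by
  intro hdet
  have key : ∀ l m : ZMod p, l * φ S.1 + m * ψ S.1 = 0 → l * φ S.2 + m * ψ S.2 = 0 →
      l = 0 ∧ m = 0 := by
    intro l m h1 h2
    have htop : hc.linearSubgroup l m = ⊤ := by
      rw [eq_top_iff, ← hS.2, Subgroup.closure_le]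
      rintro x (rfl | rfl)
      · exact h1
      · exact h2
    have h3 : g ∈ hc.linearSubgroup l m := htop ▸ Subgroup.mem_top g
    have h4 : s ∈ hc.linearSubgroup l m := htop ▸ Subgroup.mem_top s
    rw [mem_linearSubgroup, hc.φ_g, hc.ψ_g hg] at h3
    rw [mem_linearSubgroup, hc.φ_s, hc.ψ_s] at h4
    exact ⟨by simpa using h3, by simpa using h4⟩
  obtain ⟨h1, h2⟩ := key (ψ S.1) (-φ S.1) (by ring) (by linear_combination -hdet)
  obtain ⟨h3, h4⟩ := key (ψ S.2) (-φ S.2) (by linear_combination hdet) (by ring)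
  rw [neg_eq_zero] at h2 h4
  exact one_ne_zero (key 1 1 (by rw [h1, h2]; ring) (by rw [h3, h4]; ring)).1

theorem isGeneratingPair (hc : IsCoordinatePair M s g φ ψ) (h : IsMaximalClass G p n) (hn : 3 ≤ n)
    {S : G × G} (hdet : φ S.1 * ψ S.2 - φ S.2 * ψ S.1 ≠ 0) : IsGeneratingPair S := by
  have := h.finite
  refine ⟨fun heq => hdet (by rw [heq]; ring), ?_⟩
  rcases eq_top_or_exists_le_coatom (Subgroup.closure ({S.1, S.2} : Set G)) with htop | ⟨N, hN, hle⟩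
  · exact htop
  exfalso
  rw [Subgroup.closure_le, Set.insert_subset_iff, Set.singleton_subset_iff] at hle
  have hx : S.1 ∉ gammaSeries G 2 := fun hx => by
    obtain ⟨h1, h2⟩ := (hc.mem_two _).1 hx
    exact hdet (by rw [h1, h2]; ring)
  have hNle := (h.gammaSeries_two_lt_of_isCoatom hn hN).le
  have hK := h.isCoatom_zpowers_sup hn hx
  have hxK : S.1 ∈ Subgroup.zpowers S.1 ⊔ gammaSeries G 2 :=
    (le_sup_left : Subgroup.zpowers S.1 ≤ _) (Subgroup.mem_zpowers _)
  have hyK : S.2 ∈ Subgroup.zpowers S.1 ⊔ gammaSeries G 2 :=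
    h.isCoatom_eq_of_mem hn hN hK hle.1 hxK hx ▸ hle.2
  have hKle : Subgroup.zpowers S.1 ⊔ gammaSeries G 2 ≤ hc.linearSubgroup (ψ S.1) (-φ S.1) := by
    refine sup_le ?_ fun a ha => ?_
    · rw [Subgroup.zpowers_le, mem_linearSubgroup]; ring
    · obtain ⟨h1, h2⟩ := (hc.mem_two _).1 ha
      rw [mem_linearSubgroup, h1, h2]; ring
  have := hKle hyK
  rw [mem_linearSubgroup] at this
  exact hdet (by linear_combination -this)

/-- If `t` and `t'` are independent modulo `γ₂`, then `⟨t⟩` and `⟨t'⟩` meet modulo `γ₂` only in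
`p`-th powers. -/
theorem dvd_of_conj_eq (hc : IsCoordinatePair M s g φ ψ) {t t' u w : G} {k l : ℤ}
    (hdet : φ t * ψ t' - φ t' * ψ t ≠ 0) (heq : φ (u⁻¹ * t ^ k * u) = φ (w⁻¹ * t' ^ l * w))
    (heq' : ψ (u⁻¹ * t ^ k * u) = ψ (w⁻¹ * t' ^ l * w)) : (p : ℤ) ∣ k ∧ (p : ℤ) ∣ l := by
  rw [map_conj_eq hc.φ_mul, map_conj_eq hc.φ_mul, map_zpow_eq_zsmul hc.φ_mul,
    map_zpow_eq_zsmul hc.φ_mul, zsmul_eq_mul, zsmul_eq_mul] at heq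
  rw [map_conj_eq hc.ψ_mul, map_conj_eq hc.ψ_mul, map_zpow_eq_zsmul hc.ψ_mul,
    map_zpow_eq_zsmul hc.ψ_mul, zsmul_eq_mul, zsmul_eq_mul] at heq'
  constructor
  · rw [← ZMod.intCast_zmod_eq_zero_iff_dvd]
    exact (mul_eq_zero.1 (by linear_combination ψ t' * heq - φ t' * heq' :
      (k : ZMod p) * (φ t * ψ t' - φ t' * ψ t) = 0)).resolve_right hdet
  · rw [← ZMod.intCast_zmod_eq_zero_iff_dvd]
    exact (mul_eq_zero.1 (by linear_combination ψ t * heq - φ t * heq' :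
      (l : ZMod p) * (φ t * ψ t' - φ t' * ψ t) = 0)).resolve_right hdet

/-- If `t` and `t'` are dependent modulo `γ₂`, then `t'` is congruent to a power of `t`. -/
theorem exists_pow_of_det_eq_zero (hc : IsCoordinatePair M s g φ ψ) {t t' : G}
    (ht : t ∉ gammaSeries G 2) (hdet : φ t * ψ t' - φ t' * ψ t = 0) :
    ∃ k : ℕ, t' * (t ^ k)⁻¹ ∈ gammaSeries G 2 := by
  have key : ∀ c : ZMod p, φ t' = c * φ t → ψ t' = c * ψ t →
      ∃ k : ℕ, t' * (t ^ k)⁻¹ ∈ gammaSeries G 2 := fun c h1 h2 => by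
    refine ⟨c.val, (hc.mem_two _).2 ?_⟩
    rw [hc.φ_mul, hc.ψ_mul, map_inv_eq_neg hc.φ_mul, map_inv_eq_neg hc.ψ_mul,
      map_npow_eq_nsmul hc.φ_mul, map_npow_eq_nsmul hc.ψ_mul, nsmul_eq_mul, nsmul_eq_mul,
      ZMod.natCast_zmod_val, h1, h2]
    constructor <;> ring
  by_cases hφ : φ t = 0
  · have hψ : ψ t ≠ 0 := fun h' => ht ((hc.mem_two t).2 ⟨hφ, h'⟩)
    rw [hφ, zero_mul, zero_sub, neg_eq_zero] at hdet
    exact key (ψ t' / ψ t) (by rw [(mul_eq_zero.1 hdet).resolve_right hψ, hφ, mul_zero])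
      (by rw [div_mul_cancel₀ _ hψ])
  · exact key (φ t' / φ t) (by rw [div_mul_cancel₀ _ hφ])
      (by field_simp; linear_combination hdet)

/-- Of the three elements attached to a generating pair, two lie outside `M`, with different
slopes; the third one lies in `M` or has a third slope. -/
theorem exists_two_slopes (hc : IsCoordinatePair M s g φ ψ) {S : G × G}
    (hdet : φ S.1 * ψ S.2 - φ S.2 * ψ S.1 ≠ 0) :
    ∃ t₁ ∈ ({S.1, S.2, S.1 * S.2} : Set G), ∃ t₂ ∈ ({S.1, S.2, S.1 * S.2} : Set G),
      ∃ t₃ ∈ ({S.1, S.2, S.1 * S.2} : Set G), ψ t₁ ≠ 0 ∧ ψ t₂ ≠ 0 ∧ φ t₁ / ψ t₁ ≠ φ t₂ / ψ t₂ ∧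
        (ψ t₃ = 0 ∧ φ t₃ ≠ 0 ∨
          ψ t₃ ≠ 0 ∧ φ t₃ / ψ t₃ ≠ φ t₁ / ψ t₁ ∧ φ t₃ / ψ t₃ ≠ φ t₂ / ψ t₂) := by
  have h1 : S.1 ∈ ({S.1, S.2, S.1 * S.2} : Set G) := by simp
  have h2 : S.2 ∈ ({S.1, S.2, S.1 * S.2} : Set G) := by simp
  have h3 : S.1 * S.2 ∈ ({S.1, S.2, S.1 * S.2} : Set G) := by simp
  have hne : ∀ x y, ψ x ≠ 0 → ψ y ≠ 0 → φ x * ψ y - φ y * ψ x ≠ 0 →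
      φ x / ψ x ≠ φ y / ψ y := by
    intro x y hx hy hxy heq
    rw [div_eq_div_iff hx hy] at heq
    exact hxy (by rw [heq, sub_self])
  have h13 : φ S.1 * ψ (S.1 * S.2) - φ (S.1 * S.2) * ψ S.1 ≠ 0 := by
    rw [hc.φ_mul, hc.ψ_mul]
    convert hdet using 1; ring
  have h23 : φ S.2 * ψ (S.1 * S.2) - φ (S.1 * S.2) * ψ S.2 ≠ 0 := by
    rw [hc.φ_mul, hc.ψ_mul]
    refine fun h' => hdet ?_
    linear_combination -h'
  have hz : ∀ x y, φ x * ψ y - φ y * ψ x ≠ 0 → ψ x = 0 → φ x ≠ 0 ∧ ψ y ≠ 0 := by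
    intro x y hxy hx
    rw [hx, mul_zero, sub_zero] at hxy
    exact ⟨left_ne_zero_of_mul hxy, right_ne_zero_of_mul hxy⟩
  have hneg : ∀ {x y}, φ x * ψ y - φ y * ψ x ≠ 0 → φ y * ψ x - φ x * ψ y ≠ 0 := by
    intro x y hxy h'
    exact hxy (by linear_combination -h')
  by_cases hx : ψ S.1 = 0
  · obtain ⟨hφ, hy⟩ := hz _ _ hdet hx
    obtain ⟨-, hxy⟩ := hz _ _ h13 hx
    exact ⟨_, h2, _, h3, _, h1, hy, hxy, hne _ _ hy hxy h23, Or.inl ⟨hx, hφ⟩⟩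
  by_cases hy : ψ S.2 = 0
  · obtain ⟨hφ, -⟩ := hz _ _ (hneg hdet) hy
    obtain ⟨-, hxy⟩ := hz _ _ h23 hy
    exact ⟨_, h1, _, h3, _, h2, hx, hxy, hne _ _ hx hxy h13, Or.inl ⟨hy, hφ⟩⟩
  refine ⟨_, h1, _, h2, _, h3, hx, hy, hne _ _ hx hy hdet, ?_⟩
  by_cases hxy : ψ (S.1 * S.2) = 0
  · exact Or.inl ⟨hxy, (hz _ _ (hneg h13) hxy).1⟩
  · exact Or.inr ⟨hxy, (hne _ _ hx hxy h13).symm, (hne _ _ hy hxy h23).symm⟩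

/-- If `p ≤ 3` and all cosets of `γ₂` outside a maximal subgroup are conjugacy classes, then there
is no Beauville structure. -/
theorem not_isBeauvilleGroup (hc : IsCoordinatePair M s g φ ψ) (hg : g ∈ M) (hp3 : p ≤ 3)
    (hM : ∀ x, x ∉ M → ∀ a ∈ gammaSeries G 2, ∃ u, u * x * u⁻¹ = a * x) :
    ¬ IsBeauvilleGroup G := by
  rintro ⟨S₁, S₂, hS⟩
  obtain ⟨t₁, ht₁, t₂, ht₂, -, -, h1, h2, h12, -⟩ :=
    hc.exists_two_slopes (hc.det_ne_zero hg hS.1)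
  obtain ⟨t₃, ht₃, t₄, ht₄, -, -, h3, h4, h34, -⟩ :=
    hc.exists_two_slopes (hc.det_ne_zero hg hS.2.1)
  -- Equal finite slopes would make t' congruent modulo γ₂ to a power of t. As the coset is a
  -- conjugacy class, t' would be conjugate to that power and lie in both Σ-sets.
  have key : ∀ t ∈ ({S₁.1, S₁.2, S₁.1 * S₁.2} : Set G), ∀ t' ∈ ({S₂.1, S₂.2, S₂.1 * S₂.2} : Set G),
      ψ t ≠ 0 → ψ t' ≠ 0 → φ t / ψ t ≠ φ t' / ψ t' := by
    intro t ht t' ht' hψ hψ' heq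
    rw [div_eq_div_iff hψ hψ'] at heq
    obtain ⟨k, hk⟩ := hc.exists_pow_of_det_eq_zero (t := t) (t' := t')
      (fun h' => hψ ((hc.mem_two t).1 h').2) (by rw [heq, sub_self])
    have hkM : t ^ k ∉ M := by
      intro h'
      have h5 := mul_mem ((hc.mem _).2 ((hc.mem_two _).1 hk).2) h'
      rw [inv_mul_cancel_right, hc.mem] at h5
      exact hψ' h5
    obtain ⟨u, hu⟩ := hM _ hkM _ hk
    rw [inv_mul_cancel_right] at hu
    have h6 := hS.eq_one ht ht' (u := u⁻¹) (w := 1) (k := k) (l := 1) (by simpa using hu)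
    rw [inv_inv, zpow_natCast, hu] at h6
    exact hψ' (by rw [h6, map_one_eq_zero hc.ψ_mul])
  -- Each triple supplies two finite slopes, so four distinct elements of ZMod p would be needed.
  have hcard : ({φ t₁ / ψ t₁, φ t₂ / ψ t₂, φ t₃ / ψ t₃, φ t₄ / ψ t₄} : Finset (ZMod p)).card = 4 := by
    rw [Finset.card_insert_of_notMem, Finset.card_insert_of_notMem, Finset.card_pair h34]
    · simp only [Finset.mem_insert, Finset.mem_singleton, not_or]
      exact ⟨key _ ht₂ _ ht₃ h2 h3, key _ ht₂ _ ht₄ h2 h4⟩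
    · simp only [Finset.mem_insert, Finset.mem_singleton, not_or]
      exact ⟨h12, key _ ht₁ _ ht₃ h1 h3, key _ ht₁ _ ht₄ h1 h4⟩
  have := Finset.card_le_univ ({φ t₁ / ψ t₁, φ t₂ / ψ t₂, φ t₃ / ψ t₃, φ t₄ / ψ t₄} : Finset (ZMod p))
  rw [ZMod.card] at this
  omega

end IsCoordinatePair

/-! ### No Beauville structures for p ≤ 3 -/

section SmallPrimes

variable {G : Type*} [Group G] {p n : ℕ} [hp : Fact p.Prime]

theorem IsMaximalClass.exists_isCoatom (h : IsMaximalClass G p n) (hn : 3 ≤ n) :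
    ∃ M : Subgroup G, IsCoatom M := by
  obtain ⟨x, -, hx⟩ := Set.exists_of_ssubset (h.gammaSeries_succ_lt le_rfl (by omega : 1 < n))
  exact ⟨_, h.isCoatom_zpowers_sup hn hx⟩

/-- In a nonabelian group of order `p ^ 3`, the elements outside `γ₂` are not central. -/
theorem IsMaximalClass.exists_commutatorElement_ne_one (h : IsMaximalClass G p 3) {x : G}
    (hx : x ∉ gammaSeries G 2) : ∃ u : G, ⁅u, x⁆ ≠ 1 := by
  by_contra! hcon
  have hM := h.isCoatom_zpowers_sup le_rfl hx
  obtain ⟨w, -, hw⟩ := Set.exists_of_ssubset hM.lt_top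
  have hle : Subgroup.zpowers x ⊔ gammaSeries G 2 ≤ Subgroup.center G := by
    refine sup_le ?_ fun a ha => Subgroup.mem_center_iff.2 fun u => ?_
    · rw [Subgroup.zpowers_le, Subgroup.mem_center_iff]
      exact fun u => commutatorElement_eq_one_iff_mul_comm.1 (hcon u)
    · exact (h.mul_comm_of_mem_last ha u).symm
  have hc : Subgroup.centralizer {w} = ⊤ := by
    refine hM.2 _ (lt_of_le_of_ne (fun a ha => ?_) fun heq => hw ?_)
    · exact Subgroup.mem_centralizer_singleton_iff.2 (Subgroup.mem_center_iff.1 (hle ha) w).symm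
    · rw [heq]
      exact Subgroup.mem_centralizer_singleton_iff.2 rfl
  have hwc : w ∈ Subgroup.center G := Subgroup.mem_center_iff.2 fun u =>
    Subgroup.mem_centralizer_singleton_iff.1 (hc ▸ Subgroup.mem_top u)
  have htop : Subgroup.center G = ⊤ :=
    hM.2 _ (lt_of_le_of_ne hle fun heq => hw (heq ▸ hwc))
  refine h.gammaSeries_ne_bot (by norm_num : 2 < 3) ?_
  rw [gammaSeries_succ (i := 1) le_rfl, Subgroup.commutator_eq_bot_iff_le_centralizer]
  intro a _
  rw [Subgroup.mem_centralizer_iff]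
  intro b _
  have ha : a ∈ Subgroup.center G := htop ▸ Subgroup.mem_top a
  exact Subgroup.mem_center_iff.1 ha b

theorem not_isBeauvilleGroup_of_le_three (h : InFamily G p n) (hp3 : p ≤ 3) :
    ¬ IsBeauvilleGroup G := by
  have hp2 := hp.out.two_le
  have hn3 : 3 ≤ n := by have := h.2.1; omega
  have key : ∃ M : Subgroup G, IsCoatom M ∧
      ∀ x, x ∉ M → ∀ a ∈ gammaSeries G 2, ∃ u, u * x * u⁻¹ = a * x := by
    by_cases hn4 : 4 ≤ n
    · refine ⟨gOne G, h.1.isCoatom_gOne hn4, fun x hx a ha => ?_⟩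
      have hxu : IsUniserialElement n x :=
        (IsMaximalClass.metabelian_or_gOneClassLETwo_of_inFamily h hn4).elim
          (fun hG => h.1.isUniserialElement_of_metabelian hn4 hG hx)
          fun hC => h.1.isUniserialElement_of_le_three hn4 hp3 hC hx
      exact hxu.exists_conj_eq h.1 hn4 ha
    -- Here G is nonabelian of order 8, and γ₂ = {1, [u, x]} as soon as u does not commute with x.
    · obtain rfl : n = 3 := by omega
      obtain rfl : p = 2 := by have := h.2.1; omega
      obtain ⟨M, hM⟩ := h.1.exists_isCoatom le_rfl
      refine ⟨M, hM, fun x hx a ha => ?_⟩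
      by_cases ha1 : a = 1
      · exact ⟨1, by simp [ha1]⟩
      obtain ⟨u, hu⟩ := h.1.exists_commutatorElement_ne_one
        fun h' => hx ((h.1.gammaSeries_two_lt_of_isCoatom le_rfl hM).le h')
      have hfin := h.1.finite
      have hcard : Nat.card (gammaSeries G 2) = 2 := by
        rw [h.1.card_gammaSeries le_rfl le_rfl (by norm_num)]; norm_num
      obtain ⟨b, hb⟩ := (Nat.card_eq_two_iff' (1 : gammaSeries G 2)).1 hcard
      have h1 := hb.2 ⟨a, ha⟩ fun h' => ha1 (congrArg Subtype.val h')
      have h2 := hb.2 ⟨⁅u, x⁆, commutatorElement_mem_gammaSeries_succ (i := 1) trivial x⟩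
        fun h' => hu (congrArg Subtype.val h')
      have h3 : a = ⁅u, x⁆ := congrArg Subtype.val (h1.trans h2.symm)
      refine ⟨u, ?_⟩
      rw [h3, commutatorElement_def]; group
  obtain ⟨M, hM, hMc⟩ := key
  obtain ⟨s, -, hs⟩ := Set.exists_of_ssubset hM.lt_top
  obtain ⟨g, hg, hg'⟩ := Set.exists_of_ssubset (h.1.gammaSeries_two_lt_of_isCoatom hn3 hM)
  obtain ⟨φ, ψ, hc⟩ := h.1.exists_isCoordinatePair hn3 hM hs hg hg'
  exact hc.not_isBeauvilleGroup hg hp3 hMc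

end SmallPrimes

/-- `x` has a nontrivial power in `γ_{n-1}`. -/
def HasCentralPower (n : ℕ) {G : Type*} [Group G] (x : G) : Prop :=
  ∃ k : ℕ, x ^ k ∈ gammaSeries G (n - 1) ∧ x ^ k ≠ 1

/-! ### Nontrivial powers in γ_{n-1} -/

section CentralPower

variable {G : Type*} [Group G] {p n : ℕ} [hp : Fact p.Prime] (h : IsMaximalClass G p n)

include h

theorem eq_one_of_pow_eq_one_of_coprime {x : G} {k : ℕ} (hk : k.Coprime p) (hx : x ^ k = 1) :
    x = 1 := by
  have := h.finite
  exact Subgroup.mem_bot.1 (mem_of_pow_mem_of_coprime h.2.1 hk (Subgroup.mem_bot.2 hx))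

theorem not_hasCentralPower_of_pow_eq_one (hn : 3 ≤ n) {x : G} (hx : x ∉ gammaSeries G 2)
    (hxp : x ^ p = 1) : ¬ HasCentralPower n x := by
  have := h.finite
  rintro ⟨k, hk, hk1⟩
  have hpk : ¬ p ∣ k := fun ⟨m, hm⟩ => hk1 (by rw [hm, pow_mul, hxp, one_pow])
  exact hx (gammaSeries_antitone (by omega) (mem_of_pow_mem_of_coprime h.2.1
    ((Nat.Prime.coprime_iff_not_dvd hp.out).2 hpk).symm hk))

theorem card_gammaSeries_last (hn : 3 ≤ n) : Nat.card (gammaSeries G (n - 1)) = p := by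
  rw [h.card_gammaSeries hn (by omega) (by omega), show n - (n - 1) = 1 by omega, pow_one]

/-- As γ_{n-1} has order p, a nontrivial power in it generates it, so it would be contained in both
Σ-sets. -/
theorem not_hasCentralPower_of_isBeauvilleStructure (hn : 3 ≤ n) {S₁ S₂ : G × G}
    (hS : IsBeauvilleStructure S₁ S₂) {t t' : G} (ht : t ∈ ({S₁.1, S₁.2, S₁.1 * S₁.2} : Set G))
    (ht' : t' ∈ ({S₂.1, S₂.2, S₂.1 * S₂.2} : Set G)) (hN : HasCentralPower n t) :
    ¬ HasCentralPower n t' := by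
  have := h.finite
  rintro ⟨l, hl, hl1⟩
  obtain ⟨k, hk, hk1⟩ := hN
  obtain ⟨m, hm⟩ := exists_pow_inv_mul_mem (N := (⊥ : Subgroup G)) bot_le
    (by rw [card_gammaSeries_last h hn, Subgroup.card_bot, mul_one]) hk hk1 hl
  rw [Subgroup.mem_bot, inv_mul_eq_one, ← pow_mul] at hm
  have := hS.eq_one ht ht' (u := 1) (w := 1) (k := (k * m : ℕ)) (l := l) (by
    rw [zpow_natCast, zpow_natCast, hm])
  rw [zpow_natCast, hm, inv_one, one_mul, mul_one] at this
  exact hl1 this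

end CentralPower

/-! ### Central powers of elements of G₁ -/

namespace PowerData

variable {G : Type*} [Group G] {p n : ℕ} [hp : Fact p.Prime] {s g α β : G}

section

variable (D : PowerData p n s g α β) (h : IsMaximalClass G p n)

include D

/-- Each p-th power moves exactly p - 1 steps down the series, starting from level 1 for t in G₁ ∖
γ₂. -/
theorem pow_prime_pow_mem (hpn : p + 2 ≤ n) {t : G} (ht : t ∈ gOne G) (ht' : t ∉ gammaSeries G 2)
    (j : ℕ) (hj : 1 + j * (p - 1) ≤ n - 1) : t ^ p ^ j ∈ gammaSeries G (1 + j * (p - 1)) ∧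
      t ^ p ^ j ∉ gammaSeries G (2 + j * (p - 1)) := by
  have hp1 := hp.out.two_le
  induction j with
  | zero => simpa using ⟨trivial, ht'⟩
  | succ j ih =>
    rcases Nat.eq_zero_or_pos j with rfl | hj0
    · rw [zero_add, pow_one, one_mul, show 1 + (p - 1) = p by omega,
        show 2 + (p - 1) = p + 1 by omega]
      exact ⟨D.gOne_pow_mem t ht, D.gOne_pow_notMem t ht ht' hpn⟩
    · have hjp : 1 * (p - 1) ≤ j * (p - 1) := Nat.mul_le_mul_right _ hj0
      rw [Nat.succ_mul] at hj ⊢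
      obtain ⟨h1, h2⟩ := ih (by omega)
      rw [pow_succ, pow_mul]
      have h3 := D.gamma_pow_mem _ _ (by omega) h1
      have h4 := D.gamma_pow_notMem _ _ (by omega) h1
        (by rwa [show 1 + j * (p - 1) + 1 = 2 + j * (p - 1) by omega]) (by omega)
      rw [show 1 + j * (p - 1) + p - 1 = 1 + (j * (p - 1) + (p - 1)) by omega] at h3
      rw [show 1 + j * (p - 1) + p = 2 + (j * (p - 1) + (p - 1)) by omega] at h4
      exact ⟨h3, h4⟩

theorem hasCentralPower_of_modEq (hpn : p + 2 ≤ n) (hmod : n ≡ 2 [MOD p - 1]) {t : G}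
    (ht : t ∈ gOne G) (ht' : t ∉ gammaSeries G 2) : HasCentralPower n t := by
  obtain ⟨J, hJ⟩ := (Nat.modEq_iff_dvd' (by omega : 2 ≤ n)).1 hmod.symm
  rw [mul_comm] at hJ
  obtain ⟨h2, h3⟩ := D.pow_prime_pow_mem hpn ht ht' J (by omega)
  rw [← hJ, show 1 + (n - 2) = n - 1 by omega] at h2
  exact ⟨_, h2, fun h' => h3 (h' ▸ one_mem _)⟩

include h

/-- The levels reached are 1 + j(p - 1); if n - 1 is not among them, the sequence of p-power powers
jumps over γ_{n-1} directly to 1. -/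
theorem not_hasCentralPower_of_not_modEq (hpn : p + 2 ≤ n) (hmod : ¬ n ≡ 2 [MOD p - 1]) {t : G}
    (ht : t ∈ gOne G) (ht' : t ∉ gammaSeries G 2) : ¬ HasCentralPower n t := by
  have := h.finite
  have hp2 := hp.out.two_le
  rintro ⟨k, hk, hk1⟩
  have hk0 : k ≠ 0 := by rintro rfl; exact hk1 (pow_zero t)
  obtain ⟨a, k', hk', rfl⟩ := Nat.exists_eq_pow_mul_and_not_dvd hk0 p hp.out.ne_one
  rw [pow_mul] at hk hk1
  have h1 := mem_of_pow_mem_of_coprime h.2.1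
    ((Nat.Prime.coprime_iff_not_dvd hp.out).2 hk').symm hk
  -- J is the last exponent for which t^(p^J) is still guaranteed to be nontrivial: its level is
  -- strictly above γ_{n-1}, and one more p-th power gives 1.
  obtain ⟨J, hJ⟩ : ∃ J, J = (n - 2) / (p - 1) := ⟨_, rfl⟩
  have hdiv := Nat.div_add_mod (n - 2) (p - 1)
  have hlt := Nat.mod_lt (n - 2) (by omega : 0 < p - 1)
  rw [← hJ, mul_comm] at hdiv
  have hne : (n - 2) % (p - 1) ≠ 0 := fun h0 => hmod
    ((Nat.modEq_iff_dvd' (by omega : 2 ≤ n)).2 (Nat.dvd_of_mod_eq_zero h0)).symm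
  have hJ1 : 1 ≤ J := by
    rw [hJ]; exact Nat.div_pos (by omega) (by omega)
  have hJp : 1 * (p - 1) ≤ J * (p - 1) := Nat.mul_le_mul_right _ hJ1
  obtain ⟨h2, h3⟩ := D.pow_prime_pow_mem hpn ht ht' J (by omega)
  rcases le_or_gt a J with haJ | haJ
  · refine h3 (gammaSeries_antitone (by omega : 2 + J * (p - 1) ≤ n - 1) ?_)
    rw [← Nat.add_sub_cancel' haJ, pow_add, pow_mul]
    exact pow_mem h1 _
  · have h4 := D.gamma_pow_mem _ _ (by omega) h2
    have h5 := h.eq_one_of_mem (by omega) h4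
    rw [← pow_mul, ← pow_succ] at h5
    refine hk1 ?_
    rw [← Nat.add_sub_cancel' (Nat.succ_le_of_lt haJ), pow_add, pow_mul t, Nat.succ_eq_add_one, h5,
      one_pow, one_pow]

/-- The condition on `n` and `G₁` in the second case excludes nontrivial central powers. -/
theorem not_hasCentralPower (hpn : p + 1 ≤ n) (hp5 : 5 ≤ p)
    (hR : ¬ n ≡ 2 [MOD p - 1] ∨ (n = p + 1 ∧ ∀ g ∈ maximalBranch (gOne G), orderOf g = p)) {t : G}
    (ht : t ∈ gOne G) (ht' : t ∉ gammaSeries G 2) : ¬ HasCentralPower n t := by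
  rcases hR with hR | ⟨-, hR⟩
  · refine D.not_hasCentralPower_of_not_modEq h ?_ hR ht ht'
    have : n ≠ p + 1 := by
      rintro rfl
      refine hR ((Nat.modEq_iff_dvd' (by omega)).2 ?_).symm
      rw [show p + 1 - 2 = p - 1 by omega]
    omega
  · refine not_hasCentralPower_of_pow_eq_one h (by omega) ht' ?_
    rw [← hR t ⟨ht, by rwa [h.frattini_eq (by omega)]⟩, pow_orderOf_eq_one]

theorem hasCentralPower (hpn : p + 1 ≤ n) (hp5 : 5 ≤ p)
    (hR : ¬ (¬ n ≡ 2 [MOD p - 1] ∨ (n = p + 1 ∧ ∀ g ∈ maximalBranch (gOne G), orderOf g = p)))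
    {t : G} (ht : t ∈ gOne G) (ht' : t ∉ gammaSeries G 2) : HasCentralPower n t := by
  have := h.finite
  rw [not_or, not_not] at hR
  obtain ⟨hmod, hR⟩ := hR
  rcases lt_or_eq_of_le hpn with hlt | rfl
  · exact D.hasCentralPower_of_modEq hlt hmod ht ht'
  -- For n = p + 1 the p-th powers on G₁ are constant on cosets of γ₂, and G₁ / γ₂ is cyclic. A
  -- single t with t^p = 1 would thus force all of B(G₁) to have order p.
  · refine ⟨p, by simpa using D.gOne_pow_mem t ht, fun htp => hR ⟨rfl, fun x hx => ?_⟩⟩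
    have hx2 : x ∉ gammaSeries G 2 := by rw [← h.frattini_eq (by omega)]; exact hx.2
    obtain ⟨k, hk⟩ := exists_pow_inv_mul_mem (h.gammaSeries_two_le_gOne (by omega))
      (h.card_isCoatom_eq (by omega) (h.isCoatom_gOne (by omega))) ht ht' hx.1
    have h1 := D.gOne_pow_eq rfl _ (pow_mem ht k) _ hk
    rw [mul_inv_cancel_left, ← pow_mul, mul_comm, pow_mul, htp, one_pow] at h1
    exact orderOf_eq_prime_iff.2 ⟨h1, fun h' => hx2 (h' ▸ one_mem _)⟩

end

end PowerData

/-- The slope of `t`, an element of the projective line over `ZMod p`. -/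
def HasSlope {G : Type*} {p : ℕ} (φ ψ : G → ZMod p) (t : G) : Option (ZMod p) → Prop
  | none => ψ t = 0 ∧ φ t ≠ 0
  | some i => ψ t ≠ 0 ∧ φ t = i * ψ t

/-! ### Triples with prescribed slopes -/

namespace IsCoordinatePair

variable {G : Type*} [Group G] {p n : ℕ} [hp : Fact p.Prime] {M : Subgroup G} {s g : G}
  {φ ψ : G → ZMod p}

omit [Group G] in
theorem det_ne_zero_of_hasSlope {t t' : G} {o o' : Option (ZMod p)} (h : HasSlope φ ψ t o)
    (h' : HasSlope φ ψ t' o') (hne : o ≠ o') : φ t * ψ t' - φ t' * ψ t ≠ 0 := by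
  match o, o', h, h' with
  | none, none, _, _ => exact absurd rfl hne
  | none, some i, ⟨h1, h2⟩, ⟨h3, _⟩ =>
    rw [h1, mul_zero, sub_zero]; exact mul_ne_zero h2 h3
  | some i, none, ⟨h1, _⟩, ⟨h3, h4⟩ =>
    rw [h3, mul_zero, zero_sub, neg_ne_zero]; exact mul_ne_zero h4 h1
  | some i, some j, ⟨h1, h2⟩, ⟨h3, h4⟩ =>
    have hij : i - j ≠ 0 := fun h0 => hne (by rw [sub_eq_zero.1 h0])
    rw [h2, h4, show i * ψ t * ψ t' - j * ψ t' * ψ t = (i - j) * (ψ t * ψ t') by ring]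
    exact mul_ne_zero hij (mul_ne_zero h1 h3)

theorem exists_generatingPair (hc : IsCoordinatePair M s g φ ψ) (hg : g ∈ M)
    (h : IsMaximalClass G p n) (hn : 3 ≤ n) {a b : ZMod p} {o : Option (ZMod p)} (hab : a ≠ b)
    (ha : o ≠ some a) (hb : o ≠ some b) :
    ∃ S : G × G, IsGeneratingPair S ∧ HasSlope φ ψ S.1 (some a) ∧ HasSlope φ ψ S.2 (some b) ∧
      HasSlope φ ψ (S.1 * S.2) o := by
  have hφ : ∀ i j : ZMod p, φ ((g ^ i.val * s) ^ j.val) = j * i := fun i j => by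
    rw [map_npow_eq_nsmul hc.φ_mul, hc.φ_mul, map_npow_eq_nsmul hc.φ_mul, hc.φ_g, hc.φ_s,
      nsmul_eq_mul, nsmul_eq_mul, ZMod.natCast_zmod_val, ZMod.natCast_zmod_val]; ring
  have hψ : ∀ i j : ZMod p, ψ ((g ^ i.val * s) ^ j.val) = j := fun i j => by
    rw [map_npow_eq_nsmul hc.ψ_mul, hc.ψ_mul, map_npow_eq_nsmul hc.ψ_mul, hc.ψ_g hg, hc.ψ_s,
      nsmul_eq_mul, nsmul_eq_mul, ZMod.natCast_zmod_val, ZMod.natCast_zmod_val]; ring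
  -- Scale vectors of slopes a and b by j and k so that their sum has slope o. The weights (1, -1)
  -- give slope ∞, and (c - b, a - c) give (a - b)(c, 1), of slope c.
  have key : ∀ j k : ZMod p, j ≠ 0 → k ≠ 0 →
      (∀ x : G, φ x = j * a + k * b → ψ x = j + k → HasSlope φ ψ x o) →
      ∃ S : G × G, IsGeneratingPair S ∧ HasSlope φ ψ S.1 (some a) ∧ HasSlope φ ψ S.2 (some b) ∧
      HasSlope φ ψ (S.1 * S.2) o := by
    intro j k hj hk hjk
    have h1 : HasSlope φ ψ ((g ^ a.val * s) ^ j.val) (some a) :=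
      ⟨by rwa [hψ], by rw [hφ, hψ, mul_comm]⟩
    have h2 : HasSlope φ ψ ((g ^ b.val * s) ^ k.val) (some b) :=
      ⟨by rwa [hψ], by rw [hφ, hψ, mul_comm]⟩
    exact ⟨((g ^ a.val * s) ^ j.val, (g ^ b.val * s) ^ k.val), hc.isGeneratingPair h hn
      (det_ne_zero_of_hasSlope h1 h2 (by simpa using hab)), h1, h2,
      hjk _ (by rw [hc.φ_mul, hφ, hφ]) (by rw [hc.ψ_mul, hψ, hψ])⟩
  have hab' := sub_ne_zero.2 hab
  match o, ha, hb with
  | none, _, _ =>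
    refine key 1 (-1) one_ne_zero (neg_ne_zero.2 one_ne_zero) fun x h1 h2 => ⟨?_, ?_⟩
    · rw [h2]; ring
    · rw [h1]; convert hab' using 1; ring
  | some c, ha, hb =>
    have hac : a - c ≠ 0 := fun h0 => ha (by rw [sub_eq_zero.1 h0])
    have hcb : c - b ≠ 0 := fun h0 => hb (by rw [sub_eq_zero.1 h0])
    refine key (c - b) (a - c) hcb hac fun x h1 h2 => ⟨?_, ?_⟩
    · rw [h2]; convert hab' using 1; ring
    · rw [h1, h2]; ring

end IsCoordinatePair

/-! ### The quadratic equation for slopes and the invariant μ -/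

namespace PowerData

variable {G : Type*} [Group G] {p n : ℕ} [hp : Fact p.Prime] {s g α β : G} {φ ψ : G → ZMod p}
  (D : PowerData p n s g α β) (h : IsMaximalClass G p n)
  (hc : IsCoordinatePair (gOne G) s g φ ψ)

include D h hc

/-- Raising x to a power that inverts ψ(x) modulo p brings it to the form g^i b s with b in γ₂,
whose p-th power is that of g^i s. -/
theorem pow_prime_eq_iff {x : G} {i : ZMod p} (hx : HasSlope φ ψ x (some i)) :
    x ^ p ∈ gammaSeries G (n - 1) ∧ (x ^ p = 1 ↔ (g ^ i.val * s) ^ p = 1) := by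
  have := h.finite
  obtain ⟨hψ, hφ⟩ := hx
  have hk : ((ψ x)⁻¹.val).Coprime p := by
    rw [Nat.coprime_comm, Nat.Prime.coprime_iff_not_dvd hp.out, ← ZMod.natCast_eq_zero_iff,
      ZMod.natCast_zmod_val]
    exact inv_ne_zero hψ
  have hb : (g ^ i.val)⁻¹ * x ^ (ψ x)⁻¹.val * s⁻¹ ∈ gammaSeries G 2 := by
    rw [hc.mem_two, hc.φ_mul, hc.φ_mul, hc.ψ_mul, hc.ψ_mul, map_inv_eq_neg hc.φ_mul,
      map_inv_eq_neg hc.φ_mul, map_inv_eq_neg hc.ψ_mul, map_inv_eq_neg hc.ψ_mul,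
      map_npow_eq_nsmul hc.φ_mul, map_npow_eq_nsmul hc.φ_mul, map_npow_eq_nsmul hc.ψ_mul,
      map_npow_eq_nsmul hc.ψ_mul, hc.φ_s, hc.ψ_s, hc.φ_g, hc.ψ_g D.g_mem, hφ]
    simp only [nsmul_eq_mul, ZMod.natCast_zmod_val]
    constructor
    · field_simp; ring
    · field_simp; ring
  have h1 := D.pow_prime_eq _ (pow_mem D.g_mem i.val) _ hb
  rw [show g ^ i.val * ((g ^ i.val)⁻¹ * x ^ (ψ x)⁻¹.val * s⁻¹) * s = x ^ (ψ x)⁻¹.val by group,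
    ← pow_mul, mul_comm, pow_mul] at h1
  refine ⟨mem_of_pow_mem_of_coprime h.2.1 hk (h1 ▸ D.pow_prime_mem _ (pow_mem D.g_mem _)),
    fun hx => by rw [← h1, hx, one_pow], fun hx => ?_⟩
  exact eq_one_of_pow_eq_one_of_coprime h hk (by rw [h1, hx])

omit hc in
theorem exists_quadratic (hn : 3 ≤ n) : ∃ A B C : ZMod p, ∀ i : ZMod p,
    (g ^ i.val * s) ^ p = 1 ↔ i * A + i ^ 2 * B + C = 0 := by
  have := h.finite
  obtain ⟨t, ht, ht'⟩ := Set.exists_of_ssubset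
    (h.gammaSeries_succ_lt (by omega : 1 ≤ n - 1) (by omega))
  have ht1 : t ∉ (⊥ : Subgroup G) := fun h' => ht' (by
    rw [Subgroup.mem_bot.1 h']; exact one_mem _)
  obtain ⟨f, hf, hf0, -⟩ := exists_additive_of_card_eq_mul (p := p) (N := (⊥ : Subgroup G))
    (K := gammaSeries G (n - 1)) bot_le
    (by rw [card_gammaSeries_last h hn, Subgroup.card_bot, mul_one]) ht ht1
  have hsp : s ^ p ∈ gammaSeries G (n - 1) := by simpa using D.pow_prime_mem 1 (one_mem _)
  refine ⟨f ⟨α, D.α_mem⟩, f ⟨β, D.β_mem⟩, f ⟨s ^ p, hsp⟩, fun i => ?_⟩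
  have h1 := hf0 (⟨α, D.α_mem⟩ ^ i.val * ⟨β, D.β_mem⟩ ^ i.val ^ 2 * ⟨s ^ p, hsp⟩)
  rw [hf, hf, map_npow_eq_nsmul hf, map_npow_eq_nsmul hf, nsmul_eq_mul, nsmul_eq_mul,
    Nat.cast_pow, ZMod.natCast_zmod_val, Subgroup.mem_bot] at h1
  rw [D.pow_mul_eq]
  exact h1

omit hc in
theorem forall_of_three (hn : 3 ≤ n) {i j k : ZMod p} (hij : i ≠ j) (hik : i ≠ k) (hjk : j ≠ k)
    (hi : (g ^ i.val * s) ^ p = 1) (hj : (g ^ j.val * s) ^ p = 1) (hk : (g ^ k.val * s) ^ p = 1)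
    (l : ZMod p) : (g ^ l.val * s) ^ p = 1 := by
  obtain ⟨A, B, C, hABC⟩ := D.exists_quadratic h hn
  rw [hABC] at *
  have h1 : B * (i + j) + A = 0 := (mul_eq_zero.1 (by linear_combination hi - hj :
    (i - j) * (B * (i + j) + A) = 0)).resolve_left (sub_ne_zero.2 hij)
  have h2 : B * (i + k) + A = 0 := (mul_eq_zero.1 (by linear_combination hi - hk :
    (i - k) * (B * (i + k) + A) = 0)).resolve_left (sub_ne_zero.2 hik)
  have hB : B = 0 := (mul_eq_zero.1 (by linear_combination h1 - h2 :
    (j - k) * B = 0)).resolve_left (sub_ne_zero.2 hjk)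
  have hA : A = 0 := by rw [hB] at h1; linear_combination h1
  have hC : C = 0 := by rw [hA, hB] at hi; linear_combination hi
  rw [hA, hB, hC]; ring

/-- The maximal subgroups other than G₁ are the lines of finite slope, and by `pow_prime_eq_iff` a
whole branch has order p once its representative g^i s does. -/
theorem muInvariant_eq (hn : 4 ≤ n) :
    muInvariant G p = {i : ZMod p | (g ^ i.val * s) ^ p = 1}.ncard := by
  have hmem : ∀ i x, x ∈ hc.linearSubgroup 1 (-i) ↔ φ x = i * ψ x := fun i x => by
    rw [IsCoordinatePair.mem_linearSubgroup]
    constructor <;> intro h' <;> linear_combination h'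
  have hgs : ∀ i : ZMod p, φ (g ^ i.val * s) = i ∧ ψ (g ^ i.val * s) = 1 := fun i => by
    rw [hc.φ_mul, hc.ψ_mul, map_npow_eq_nsmul hc.φ_mul, map_npow_eq_nsmul hc.ψ_mul, hc.φ_g,
      hc.ψ_g D.g_mem, hc.φ_s, hc.ψ_s, nsmul_eq_mul, ZMod.natCast_zmod_val]
    simp
  have hgsm : ∀ i : ZMod p, g ^ i.val * s ∈ hc.linearSubgroup 1 (-i) := fun i => by
    rw [hmem, (hgs i).1, (hgs i).2, mul_one]
  have hgs2 : ∀ i : ZMod p, g ^ i.val * s ∉ gammaSeries G 2 := fun i h' => by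
    rw [hc.mem_two, (hgs i).2] at h'
    exact one_ne_zero h'.2
  have hfr := h.frattini_eq (by omega : 3 ≤ n)
  have hle : ∀ i, gammaSeries G 2 ≤ hc.linearSubgroup 1 (-i) := fun i x hx => by
    obtain ⟨h1, h2⟩ := (hc.mem_two x).1 hx
    rw [hmem, h1, h2, mul_zero]
  have hcoatom : ∀ i, IsCoatom (hc.linearSubgroup 1 (-i)) := by
    intro i
    refine h.isCoatom_of_gammaSeries_two_lt (by omega)
      (lt_of_le_of_ne (hle i) fun heq => hgs2 i (heq ▸ hgsm i))
      (lt_top_iff_ne_top.2 fun heq => ?_)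
    have h1 := (hmem i g).1 (heq ▸ Subgroup.mem_top g)
    rw [hc.φ_g, hc.ψ_g D.g_mem, mul_zero] at h1
    exact one_ne_zero h1
  have hinj : Function.Injective fun i => hc.linearSubgroup 1 (-i) := by
    intro i j hij
    have h1 : g ^ i.val * s ∈ hc.linearSubgroup 1 (-j) := by
      have := hgsm i
      rwa [show hc.linearSubgroup 1 (-i) = _ from hij] at this
    rwa [hmem, (hgs i).1, (hgs i).2, mul_one] at h1
  have hslope : ∀ i x, x ∈ maximalBranch (hc.linearSubgroup 1 (-i)) →
      HasSlope φ ψ x (some i) := by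
    rintro i x ⟨hx, hx2⟩
    have h1 := (hmem i x).1 hx
    refine ⟨fun h0 => hx2 ?_, h1⟩
    rw [hfr, SetLike.mem_coe, hc.mem_two, h1, h0, mul_zero]
    exact ⟨rfl, rfl⟩
  rw [muInvariant, ← Set.ncard_image_of_injective _ hinj]
  congr 1
  ext M
  constructor
  · rintro ⟨hM, hMne, hMp⟩
    obtain ⟨x, hx, hx2⟩ := Set.exists_of_ssubset (h.gammaSeries_two_lt_of_isCoatom (by omega) hM)
    have hψ : ψ x ≠ 0 := fun h0 =>
      hMne (h.isCoatom_eq_of_mem (by omega) hM (h.isCoatom_gOne hn) hx ((hc.mem x).2 h0) hx2)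
    have hMeq : hc.linearSubgroup 1 (-(φ x / ψ x)) = M :=
      h.isCoatom_eq_of_mem (by omega) (hcoatom _) hM
        ((hmem _ _).2 (div_mul_cancel₀ _ hψ).symm) hx hx2
    refine ⟨φ x / ψ x, ?_, hMeq⟩
    have h1 := hMp (g ^ (φ x / ψ x).val * s) ⟨hMeq ▸ hgsm _, by rw [hfr]; exact hgs2 _⟩
    exact (orderOf_eq_prime_iff.1 h1).1
  · rintro ⟨i, hi, rfl⟩
    refine ⟨hcoatom i, fun heq => ?_, fun x hx => orderOf_eq_prime_iff.2 ⟨?_, fun h1 => hx.2 ?_⟩⟩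
    · have h1 : g ^ i.val * s ∈ gOne G := by
        rw [← show hc.linearSubgroup 1 (-i) = _ from heq]; exact hgsm i
      rw [hc.mem, (hgs i).2] at h1
      exact one_ne_zero h1
    · exact (D.pow_prime_eq_iff h hc (hslope i x hx)).2.2 hi
    · rw [h1]; exact one_mem _

theorem caseA_iff (hn : 4 ≤ n) : CaseA G p ↔ ∀ i : ZMod p, (g ^ i.val * s) ^ p = 1 := by
  have hcard : Nat.card (ZMod p) = p := Nat.card_zmod p
  rw [CaseA, D.muInvariant_eq h hc hn]
  constructor
  · intro h1 i
    have h2 : {i : ZMod p | (g ^ i.val * s) ^ p = 1} = Set.univ :=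
      (Set.eq_univ_iff_ncard _).2 (by rw [h1, hcard])
    exact Set.eq_univ_iff_forall.1 h2 i
  · intro h1
    rw [Set.eq_univ_of_forall (s := {i : ZMod p | (g ^ i.val * s) ^ p = 1}) h1, Set.ncard_univ,
      hcard]

theorem not_hasCentralPower_iff_of_slope (hn : 3 ≤ n) {x : G} {i : ZMod p}
    (hx : HasSlope φ ψ x (some i)) :
    ¬ HasCentralPower n x ↔ (g ^ i.val * s) ^ p = 1 := by
  obtain ⟨h1, h2⟩ := D.pow_prime_eq_iff h hc hx
  rw [← h2]
  refine ⟨fun hN => by_contra fun hxp => hN ⟨p, h1, hxp⟩, fun hxp =>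
    not_hasCentralPower_of_pow_eq_one h hn (fun h' => hx.1 ((hc.mem_two x).1 h').2) hxp⟩

/-- By independence modulo γ₂ both exponents are multiples of p. If neither p-th power is trivial,
then (t')^p lies in γ_{n-1}, so the common element yields a power of t in γ_{n-1}, which must be 1.
-/
theorem conj_zpow_eq_one {t t' u w : G} {k l : ℤ}
    (hdet : φ t * ψ t' - φ t' * ψ t ≠ 0)
    (hcond : t ^ p = 1 ∨ t' ^ p = 1 ∨ (¬ HasCentralPower n t ∧ ψ t' ≠ 0))
    (heq : u⁻¹ * t ^ k * u = w⁻¹ * t' ^ l * w) : u⁻¹ * t ^ k * u = 1 := by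
  have := h.finite
  obtain ⟨⟨k', hk⟩, l', hl⟩ := hc.dvd_of_conj_eq hdet (congrArg φ heq) (congrArg ψ heq)
  rcases hcond with h1 | h1 | ⟨h1, h2⟩
  · rw [hk, zpow_mul, zpow_natCast, h1, one_zpow]; group
  · rw [heq, hl, zpow_mul, zpow_natCast, h1, one_zpow]; group
  · obtain ⟨h3, -⟩ := D.pow_prime_eq_iff h hc (x := t') (i := φ t' / ψ t')
      ⟨h2, (div_mul_cancel₀ _ h2).symm⟩
    have h4 : w⁻¹ * t' ^ l * w ∈ gammaSeries G (n - 1) := by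
      have h5 : t' ^ l ∈ gammaSeries G (n - 1) := by
        rw [hl, zpow_mul, zpow_natCast]; exact zpow_mem h3 l'
      simpa using conj_mem_gammaSeries h5 w⁻¹
    obtain ⟨m, hm⟩ : ∃ m : ℕ, t ^ m = t ^ k :=
      Submonoid.mem_powers_iff _ _ |>.1 (mem_powers_iff_mem_zpowers.2 ⟨k, rfl⟩)
    have h5 := conj_mem_gammaSeries (heq ▸ h4) u
    rw [show u * (u⁻¹ * t ^ k * u) * u⁻¹ = t ^ k by group, ← hm] at h5
    have h6 : t ^ k = 1 := hm ▸ by_contra fun h' => h1 ⟨m, h5, h'⟩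
    rw [h6]; group

end PowerData

/-! ### Beauville structures of G / Φ(G) -/

section FrattiniQuotient

variable {G : Type*} [Group G] {p n : ℕ} [hp : Fact p.Prime] {M : Subgroup G} {s g : G}
  {φ ψ : G → ZMod p}

theorem isGeneratingPair_of_map [Finite G] {S : G × G} (hS : IsGeneratingPair
    (S.map (QuotientGroup.mk' (frattini G)) (QuotientGroup.mk' (frattini G)))) :
    IsGeneratingPair S := by
  refine ⟨fun heq => hS.1 (congrArg (QuotientGroup.mk' (frattini G)) heq), ?_⟩
  have h1 : (Subgroup.closure ({S.1, S.2} : Set G)).map (QuotientGroup.mk' (frattini G)) = ⊤ := by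
    rw [MonoidHom.map_closure, Set.image_pair]
    exact hS.2
  refine frattini_nongenerating ?_
  have h2 := congrArg (Subgroup.comap (QuotientGroup.mk' (frattini G))) h1
  rwa [Subgroup.comap_map_eq, QuotientGroup.ker_mk', Subgroup.comap_top] at h2

theorem mk_mem_triple {N : Subgroup G} [N.Normal] {S : G × G} {t : G}
    (ht : t ∈ ({S.1, S.2, S.1 * S.2} : Set G)) :
    QuotientGroup.mk' N t ∈ ({(S.map (QuotientGroup.mk' N) (QuotientGroup.mk' N)).1,
      (S.map (QuotientGroup.mk' N) (QuotientGroup.mk' N)).2,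
      (S.map (QuotientGroup.mk' N) (QuotientGroup.mk' N)).1 *
        (S.map (QuotientGroup.mk' N) (QuotientGroup.mk' N)).2} : Set (G ⧸ N)) := by
  rcases ht with rfl | rfl | rfl
  · exact Or.inl rfl
  · exact Or.inr (Or.inl rfl)
  · exact Or.inr (Or.inr rfl)

theorem exists_mk_eq_of_mem_triple {N : Subgroup G} [N.Normal] {S : G × G} {t : G ⧸ N}
    (ht : t ∈ ({(S.map (QuotientGroup.mk' N) (QuotientGroup.mk' N)).1,
      (S.map (QuotientGroup.mk' N) (QuotientGroup.mk' N)).2,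
      (S.map (QuotientGroup.mk' N) (QuotientGroup.mk' N)).1 *
        (S.map (QuotientGroup.mk' N) (QuotientGroup.mk' N)).2} : Set (G ⧸ N))) :
    ∃ x ∈ ({S.1, S.2, S.1 * S.2} : Set G), QuotientGroup.mk' N x = t := by
  rcases ht with rfl | rfl | rfl
  · exact ⟨S.1, Or.inl rfl, rfl⟩
  · exact ⟨S.2, Or.inr (Or.inl rfl), rfl⟩
  · exact ⟨S.1 * S.2, Or.inr (Or.inr rfl), rfl⟩

theorem mem_triple_notMem_gammaSeries_two (hc : IsCoordinatePair M s g φ ψ) (hg : g ∈ M)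
    {S : G × G} (hS : IsGeneratingPair S) {t : G} (ht : t ∈ ({S.1, S.2, S.1 * S.2} : Set G)) :
    t ∉ gammaSeries G 2 := by
  intro ht2
  obtain ⟨h1, h2⟩ := (hc.mem_two t).1 ht2
  refine hc.det_ne_zero hg hS ?_
  rcases ht with rfl | rfl | rfl
  · rw [h1, h2]; ring
  · rw [h1, h2]; ring
  · rw [hc.φ_mul] at h1
    rw [hc.ψ_mul] at h2
    linear_combination φ S.1 * h2 - ψ S.1 * h1

theorem det_ne_zero_of_isBeauvilleStructure_map (hc : IsCoordinatePair M s g φ ψ) (hg : g ∈ M)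
    (h : IsMaximalClass G p n) (hn : 3 ≤ n) {S₁ S₂ : G × G} (hS : IsBeauvilleStructure
      (S₁.map (QuotientGroup.mk' (frattini G)) (QuotientGroup.mk' (frattini G)))
      (S₂.map (QuotientGroup.mk' (frattini G)) (QuotientGroup.mk' (frattini G)))) {t t' : G}
    (ht : t ∈ ({S₁.1, S₁.2, S₁.1 * S₁.2} : Set G))
    (ht' : t' ∈ ({S₂.1, S₂.2, S₂.1 * S₂.2} : Set G)) : φ t * ψ t' - φ t' * ψ t ≠ 0 := by
  have := h.finite
  intro hdet
  obtain ⟨k, hk⟩ := hc.exists_pow_of_det_eq_zero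
    (mem_triple_notMem_gammaSeries_two hc hg (isGeneratingPair_of_map hS.1) ht) hdet
  rw [← h.frattini_eq hn, ← QuotientGroup.ker_mk' (frattini G), MonoidHom.mem_ker, map_mul,
    map_inv, mul_inv_eq_one, map_pow] at hk
  have h1 := hS.eq_one (mk_mem_triple ht) (mk_mem_triple ht') (u := 1) (w := 1) (k := k) (l := 1)
    (by rw [zpow_natCast, hk, zpow_one])
  rw [zpow_natCast, ← hk, inv_one, one_mul, mul_one, ← MonoidHom.mem_ker, QuotientGroup.ker_mk',
    h.frattini_eq hn] at h1
  exact mem_triple_notMem_gammaSeries_two hc hg (isGeneratingPair_of_map hS.2.1) ht' h1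

/-- In the elementary abelian quotient two independent elements generate subgroups meeting
trivially, so pairwise independence of the two triples is all that is required. -/
theorem isBeauvilleStructure_map (hc : IsCoordinatePair M s g φ ψ) (hg : g ∈ M)
    (h : IsMaximalClass G p n) (hn : 3 ≤ n) {S₁ S₂ : G × G} (hS₁ : IsGeneratingPair S₁)
    (hS₂ : IsGeneratingPair S₂) (hdet : ∀ t ∈ ({S₁.1, S₁.2, S₁.1 * S₁.2} : Set G),
      ∀ t' ∈ ({S₂.1, S₂.2, S₂.1 * S₂.2} : Set G), φ t * ψ t' - φ t' * ψ t ≠ 0) :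
    IsBeauvilleStructure
      (S₁.map (QuotientGroup.mk' (frattini G)) (QuotientGroup.mk' (frattini G)))
      (S₂.map (QuotientGroup.mk' (frattini G)) (QuotientGroup.mk' (frattini G))) := by
  have hmk : ∀ x y : G, QuotientGroup.mk' (frattini G) x = QuotientGroup.mk' (frattini G) y →
      φ x = φ y ∧ ψ x = ψ y := by
    intro x y hxy
    rw [← mul_inv_eq_one, ← map_inv, ← map_mul, ← MonoidHom.mem_ker, QuotientGroup.ker_mk',
      h.frattini_eq hn, hc.mem_two, hc.φ_mul, hc.ψ_mul, map_inv_eq_neg hc.φ_mul,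
      map_inv_eq_neg hc.ψ_mul] at hxy
    exact ⟨by linear_combination hxy.1, by linear_combination hxy.2⟩
  have hgen : ∀ S : G × G, IsGeneratingPair S → IsGeneratingPair
      (S.map (QuotientGroup.mk' (frattini G)) (QuotientGroup.mk' (frattini G))) := by
    intro S hS
    constructor
    · intro heq
      obtain ⟨h1, h2⟩ := hmk S.1 S.2 heq
      exact hc.det_ne_zero hg hS (by rw [h1, h2]; ring)
    · have := congrArg (Subgroup.map (QuotientGroup.mk' (frattini G))) hS.2
      rw [MonoidHom.map_closure, Set.image_pair, Subgroup.map_top_of_surjective _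
        (QuotientGroup.mk'_surjective _)] at this
      exact this
  refine isBeauvilleStructure_of_forall (hgen _ hS₁) (hgen _ hS₂) ?_
  intro t ht t' ht' u w k l heq
  obtain ⟨t, ht1, rfl⟩ := exists_mk_eq_of_mem_triple ht
  obtain ⟨t', ht1', rfl⟩ := exists_mk_eq_of_mem_triple ht'
  obtain ⟨u, rfl⟩ := QuotientGroup.mk'_surjective _ u
  obtain ⟨w, rfl⟩ := QuotientGroup.mk'_surjective _ w
  simp only [← map_inv, ← map_zpow, ← map_mul] at heq ⊢
  obtain ⟨h1, h2⟩ := hmk _ _ heq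
  obtain ⟨⟨k', hk⟩, -⟩ := hc.dvd_of_conj_eq (hdet t ht1 t' ht1') h1 h2
  rw [← MonoidHom.mem_ker, QuotientGroup.ker_mk', h.frattini_eq hn, hc.mem_two,
    map_conj_eq hc.φ_mul, map_conj_eq hc.ψ_mul, map_zpow_eq_zsmul hc.φ_mul,
    map_zpow_eq_zsmul hc.ψ_mul, hk]
  simp

end FrattiniQuotient

theorem exists_three_notMem_pair {p : ℕ} [hp : Fact p.Prime] (hp5 : 5 ≤ p) (i j : ZMod p) :
    ∃ a b c : ZMod p, a ≠ b ∧ a ≠ c ∧ b ≠ c ∧ (a ≠ i ∧ a ≠ j) ∧ (b ≠ i ∧ b ≠ j) ∧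
      (c ≠ i ∧ c ≠ j) := by
  have h1 : 2 < (Finset.univ \ {i, j} : Finset (ZMod p)).card := by
    have h2 := Finset.le_card_sdiff ({i, j} : Finset (ZMod p)) Finset.univ
    have h3 := Finset.card_le_two (a := i) (b := j)
    rw [Finset.card_univ, ZMod.card] at h2
    omega
  obtain ⟨a, ha, b, hb, c, hc, hab, hac, hbc⟩ := Finset.two_lt_card.1 h1
  simp only [Finset.mem_sdiff, Finset.mem_univ, true_and, Finset.mem_insert,
    Finset.mem_singleton, not_or] at ha hb hc
  exact ⟨a, b, c, hab, hac, hbc, ha, hb, hc⟩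

theorem forall_mem_triple {G : Type*} [Group G] {S : G × G} {P : G → Prop} (h1 : P S.1)
    (h2 : P S.2) (h3 : P (S.1 * S.2)) : ∀ t ∈ ({S.1, S.2, S.1 * S.2} : Set G), P t := by
  rintro t (rfl | rfl | rfl) <;> assumption

/-! ### The classification for p ≥ 5 -/

namespace PowerData

variable {G : Type*} [Group G] {p n : ℕ} [hp : Fact p.Prime] {s g α β : G} {φ ψ : G → ZMod p}
  (D : PowerData p n s g α β) (h : IsMaximalClass G p n)
  (hc : IsCoordinatePair (gOne G) s g φ ψ) (hp5 : 5 ≤ p) (hn : p + 1 ≤ n)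

include D h hc hp5 hn

/-- Two elements of the triple give two distinct roots of the quadratic equation. A third root
anywhere yields case (a). Without one, the third element must lie in G₁ ∖ γ₂, and its lack of
central powers is the second condition of case (b). -/
theorem caseA_or_caseB_of_forall {S : G × G} (hS : IsGeneratingPair S)
    (hN : ∀ t ∈ ({S.1, S.2, S.1 * S.2} : Set G), ¬ HasCentralPower n t) :
    CaseA G p ∨ CaseB G p n := by
  obtain ⟨t₁, ht₁, t₂, ht₂, t₃, ht₃, h1, h2, h12, h3⟩ :=
    hc.exists_two_slopes (hc.det_ne_zero D.g_mem hS)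
  have hroot : ∀ t ∈ ({S.1, S.2, S.1 * S.2} : Set G), ψ t ≠ 0 →
      (g ^ (φ t / ψ t).val * s) ^ p = 1 := fun t ht hψ =>
    (D.not_hasCentralPower_iff_of_slope h hc (by omega)
      ⟨hψ, (div_mul_cancel₀ _ hψ).symm⟩).1 (hN t ht)
  by_cases hthird : ∃ k : ZMod p, k ≠ φ t₁ / ψ t₁ ∧ k ≠ φ t₂ / ψ t₂ ∧ (g ^ k.val * s) ^ p = 1
  · obtain ⟨k, hk1, hk2, hk⟩ := hthird
    exact Or.inl ((D.caseA_iff h hc (by omega)).2 (D.forall_of_three h (by omega) h12 hk1.symm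
      hk2.symm (hroot _ ht₁ h1) (hroot _ ht₂ h2) hk))
  · rcases h3 with ⟨h3, h3'⟩ | ⟨h3, h31, h32⟩
    · refine Or.inr ⟨?_, by_contra fun hR => hN t₃ ht₃ (D.hasCentralPower h hn hp5 hR
        ((hc.mem t₃).2 h3) fun h' => h3' ((hc.mem_two t₃).1 h').1)⟩
      rw [D.muInvariant_eq h hc (by omega), Set.ncard_eq_two]
      refine ⟨_, _, h12, Set.Subset.antisymm (fun k hk => ?_) ?_⟩
      · by_contra hk'
        rw [Set.mem_insert_iff, Set.mem_singleton_iff, not_or] at hk'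
        exact hthird ⟨k, hk'.1, hk'.2, hk⟩
      · rintro k (rfl | rfl)
        · exact hroot _ ht₁ h1
        · exact hroot _ ht₂ h2
    · exact absurd ⟨_, h31, h32, hroot _ ht₃ h3⟩ hthird

theorem caseA_or_caseB (hB : IsBeauvilleGroup G) : CaseA G p ∨ CaseB G p n := by
  obtain ⟨S₁, S₂, hS⟩ := hB
  by_cases hN : ∀ t ∈ ({S₁.1, S₁.2, S₁.1 * S₁.2} : Set G), ¬ HasCentralPower n t
  · exact D.caseA_or_caseB_of_forall h hc hp5 hn hS.1 hN
  · push Not at hN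
    obtain ⟨t, ht, htN⟩ := hN
    exact D.caseA_or_caseB_of_forall h hc hp5 hn hS.2.1 fun t' ht' =>
      not_hasCentralPower_of_isBeauvilleStructure h (by omega) hS ht ht' htN

/-- The triples have slopes (i, j, ∞) and (a, b, c) with six distinct slopes; this uses p ≥ 5. -/
theorem isBeauvilleGroup_of_slopes {i j : ZMod p} (hij : i ≠ j)
    (hcond : ∀ t t' : G, ∀ k : ZMod p, (HasSlope φ ψ t (some i) ∨ HasSlope φ ψ t (some j) ∨
      HasSlope φ ψ t none) → HasSlope φ ψ t' (some k) →
      t ^ p = 1 ∨ t' ^ p = 1 ∨ (¬ HasCentralPower n t ∧ ψ t' ≠ 0)) : IsBeauvilleGroup G := by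
  obtain ⟨a, b, c, hab, hac, hbc, ⟨hai, haj⟩, ⟨hbi, hbj⟩, hci, hcj⟩ :=
    exists_three_notMem_pair hp5 i j
  obtain ⟨S₁, hS₁, h1, h2, h3⟩ := hc.exists_generatingPair D.g_mem h (by omega) hij
    (o := none) (by simp) (by simp)
  obtain ⟨S₂, hS₂, h4, h5, h6⟩ := hc.exists_generatingPair D.g_mem h (by omega) hab
    (o := some c) (by simpa using hac.symm) (by simpa using hbc.symm)
  refine ⟨S₁, S₂, isBeauvilleStructure_of_forall hS₁ hS₂ (forall_mem_triple ?_ ?_ ?_)⟩ <;>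
    refine forall_mem_triple ?_ ?_ ?_ <;> intro u w k l
  · exact D.conj_zpow_eq_one h hc
      (IsCoordinatePair.det_ne_zero_of_hasSlope h1 h4 (by simpa using hai.symm))
      (hcond _ _ _ (Or.inl h1) h4)
  · exact D.conj_zpow_eq_one h hc
      (IsCoordinatePair.det_ne_zero_of_hasSlope h1 h5 (by simpa using hbi.symm))
      (hcond _ _ _ (Or.inl h1) h5)
  · exact D.conj_zpow_eq_one h hc
      (IsCoordinatePair.det_ne_zero_of_hasSlope h1 h6 (by simpa using hci.symm))
      (hcond _ _ _ (Or.inl h1) h6)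
  · exact D.conj_zpow_eq_one h hc
      (IsCoordinatePair.det_ne_zero_of_hasSlope h2 h4 (by simpa using haj.symm))
      (hcond _ _ _ (Or.inr (Or.inl h2)) h4)
  · exact D.conj_zpow_eq_one h hc
      (IsCoordinatePair.det_ne_zero_of_hasSlope h2 h5 (by simpa using hbj.symm))
      (hcond _ _ _ (Or.inr (Or.inl h2)) h5)
  · exact D.conj_zpow_eq_one h hc
      (IsCoordinatePair.det_ne_zero_of_hasSlope h2 h6 (by simpa using hcj.symm))
      (hcond _ _ _ (Or.inr (Or.inl h2)) h6)
  · exact D.conj_zpow_eq_one h hc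
      (IsCoordinatePair.det_ne_zero_of_hasSlope h3 h4 (by simp))
      (hcond _ _ _ (Or.inr (Or.inr h3)) h4)
  · exact D.conj_zpow_eq_one h hc
      (IsCoordinatePair.det_ne_zero_of_hasSlope h3 h5 (by simp))
      (hcond _ _ _ (Or.inr (Or.inr h3)) h5)
  · exact D.conj_zpow_eq_one h hc
      (IsCoordinatePair.det_ne_zero_of_hasSlope h3 h6 (by simp))
      (hcond _ _ _ (Or.inr (Or.inr h3)) h6)

theorem isTameBeauville (hA : CaseA G p) : IsTameBeauville G := by
  have := h.finite
  rw [D.caseA_iff h hc (by omega)] at hA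
  have hroot : ∀ t i, HasSlope φ ψ t (some i) → t ^ p = 1 := fun t i ht =>
    (D.pow_prime_eq_iff h hc ht).2.2 (hA i)
  constructor
  · exact D.isBeauvilleGroup_of_slopes h hc hp5 hn zero_ne_one fun t t' k _ ht' =>
      Or.inr (Or.inl (hroot t' k ht'))
  · intro S₁ S₂ hS
    refine isBeauvilleStructure_of_forall (isGeneratingPair_of_map hS.1)
      (isGeneratingPair_of_map hS.2.1) fun t ht t' ht' u w k l => ?_
    have hdet := det_ne_zero_of_isBeauvilleStructure_map hc D.g_mem h (by omega) hS ht ht'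
    refine D.conj_zpow_eq_one h hc hdet ?_
    -- Independent elements cannot both lie in G₁, so at least one of t, t' has finite slope and
    -- hence order p.
    by_cases hψ : ψ t = 0
    · rw [hψ, mul_zero, sub_zero] at hdet
      have hψ' := right_ne_zero_of_mul hdet
      exact Or.inr (Or.inl (hroot t' _ ⟨hψ', (div_mul_cancel₀ _ hψ').symm⟩))
    · exact Or.inl (hroot t _ ⟨hψ, (div_mul_cancel₀ _ hψ).symm⟩)

theorem isWildBeauville (hB : CaseB G p n) : IsWildBeauville G := by
  obtain ⟨hμ, hR⟩ := hB
  rw [D.muInvariant_eq h hc (by omega), Set.ncard_eq_two] at hμ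
  obtain ⟨i, j, hij, hset⟩ := hμ
  have hroot : ∀ k : ZMod p, (g ^ k.val * s) ^ p = 1 ↔ k = i ∨ k = j := fun k => by
    have := Set.ext_iff.1 hset k
    simpa using this
  constructor
  · refine D.isBeauvilleGroup_of_slopes h hc hp5 hn hij fun t t' k ht ht' =>
      Or.inr (Or.inr ⟨?_, ht'.1⟩)
    rcases ht with ht | ht | ht
    · exact (D.not_hasCentralPower_iff_of_slope h hc (by omega) ht).2 ((hroot i).2 (Or.inl rfl))
    · exact (D.not_hasCentralPower_iff_of_slope h hc (by omega) ht).2 ((hroot j).2 (Or.inr rfl))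
    · exact D.not_hasCentralPower h hn hp5 hR ((hc.mem t).2 ht.1)
        fun h' => ht.2 ((hc.mem_two t).1 h').1
  · intro hlift
    -- Slopes (i, j, a) and (b, c, ∞) form a Beauville structure modulo Φ(G), but a and b are not
    -- roots, so both triples have nontrivial powers in γ_{n-1}.
    obtain ⟨a, b, c, hab, hac, hbc, ⟨hai, haj⟩, ⟨hbi, hbj⟩, hci, hcj⟩ :=
      exists_three_notMem_pair hp5 i j
    obtain ⟨S₁, hS₁, h1, h2, h3⟩ := hc.exists_generatingPair D.g_mem h (by omega) hij
      (o := some a) (by simpa using hai) (by simpa using haj)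
    obtain ⟨S₂, hS₂, h4, h5, h6⟩ := hc.exists_generatingPair D.g_mem h (by omega) hbc
      (o := none) (by simp) (by simp)
    have hdet : ∀ t ∈ ({S₁.1, S₁.2, S₁.1 * S₁.2} : Set G),
        ∀ t' ∈ ({S₂.1, S₂.2, S₂.1 * S₂.2} : Set G), φ t * ψ t' - φ t' * ψ t ≠ 0 := by
      refine forall_mem_triple ?_ ?_ ?_ <;> refine forall_mem_triple ?_ ?_ ?_
      · exact IsCoordinatePair.det_ne_zero_of_hasSlope h1 h4 (by simpa using hbi.symm)
      · exact IsCoordinatePair.det_ne_zero_of_hasSlope h1 h5 (by simpa using hci.symm)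
      · exact IsCoordinatePair.det_ne_zero_of_hasSlope h1 h6 (by simp)
      · exact IsCoordinatePair.det_ne_zero_of_hasSlope h2 h4 (by simpa using hbj.symm)
      · exact IsCoordinatePair.det_ne_zero_of_hasSlope h2 h5 (by simpa using hcj.symm)
      · exact IsCoordinatePair.det_ne_zero_of_hasSlope h2 h6 (by simp)
      · exact IsCoordinatePair.det_ne_zero_of_hasSlope h3 h4 (by simpa using hab)
      · exact IsCoordinatePair.det_ne_zero_of_hasSlope h3 h5 (by simpa using hac)
      · exact IsCoordinatePair.det_ne_zero_of_hasSlope h3 h6 (by simp)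
    have hS := hlift S₁ S₂ (isBeauvilleStructure_map hc D.g_mem h (by omega) hS₁ hS₂ hdet)
    have hN : ∀ t k, HasSlope φ ψ t (some k) → k ≠ i → k ≠ j → HasCentralPower n t := by
      intro t k ht hki hkj
      by_contra hN
      rw [D.not_hasCentralPower_iff_of_slope h hc (by omega) ht, hroot] at hN
      exact hN.elim hki hkj
    exact not_hasCentralPower_of_isBeauvilleStructure h (by omega) hS (Or.inr (Or.inr rfl))
      (Or.inl rfl) (hN _ _ h3 hai haj) (hN _ _ h4 hbi hbj)

/-- The equations for i = 0, 1, 2 give s^p = 1, αβ = 1 and α²β⁴ = 1, hence β² = 1; and p is odd. -/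
theorem α_eq_one_of_caseA (hA : CaseA G p) : α = 1 := by
  rw [D.caseA_iff h hc (by omega)] at hA
  have hi : ∀ i : ℕ, i < p → α ^ i * β ^ (i ^ 2) * s ^ p = 1 := by
    intro i hip
    have := hA i
    rwa [ZMod.val_natCast_of_lt hip, D.pow_mul_eq] at this
  have h0 := hi 0 (by omega)
  have h1 := hi 1 (by omega)
  have h2 := hi 2 (by omega)
  rw [zero_pow two_ne_zero, pow_zero, pow_zero, one_mul, one_mul] at h0
  rw [h0, mul_one, pow_one, one_pow, pow_one, mul_eq_one_iff_eq_inv] at h1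
  rw [h0, mul_one, h1, show β⁻¹ ^ 2 * β ^ 2 ^ 2 = β ^ 2 by group] at h2
  have := eq_one_of_pow_eq_one_of_coprime h
    ((Nat.coprime_primes Nat.prime_two hp.out).2 (by omega)) h2
  rw [h1, this, inv_one]

theorem caseA_iff_setOf_eq :
    CaseA G p ↔ {x : G | x ∉ frattini G ∧ orderOf x = p} = (gOne G : Set G)ᶜ := by
  have := h.finite
  have hfr := h.frattini_eq (by omega : 3 ≤ n)
  have hle := h.gammaSeries_two_le_gOne (by omega : 4 ≤ n)
  constructor
  · intro hA
    ext x
    rw [Set.mem_ofPred_eq, Set.mem_compl_iff, SetLike.mem_coe, hfr]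
    constructor
    · rintro ⟨hx2, hxp⟩ hx
      have hxp' := (orderOf_eq_prime_iff.1 hxp).1
      -- An element of order p in G₁ ∖ γ₂ is excluded by the exact descent if n ≥ p + 2. If n = p +
      -- 1 it would give g^p = 1 and thus α ≠ 1, whereas case (a) forces α = 1.
      rcases lt_or_eq_of_le hn with hlt | hnp
      · exact D.gOne_pow_notMem x hx hx2 hlt (hxp' ▸ one_mem _)
      · obtain ⟨k, hk⟩ := exists_pow_inv_mul_mem hle
          (h.card_isCoatom_eq (by omega) (h.isCoatom_gOne (by omega))) hx hx2 D.g_mem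
        have h1 := D.gOne_pow_eq hnp.symm _ (pow_mem hx k) _ hk
        rw [mul_inv_cancel_left, ← pow_mul, mul_comm, pow_mul, hxp', one_pow] at h1
        exact D.α_ne hnp.symm h1 (D.α_eq_one_of_caseA h hc hp5 hn hA)
    · intro hx
      rw [D.caseA_iff h hc (by omega)] at hA
      have hψ : ψ x ≠ 0 := fun h0 => hx ((hc.mem x).2 h0)
      have hxp := (D.pow_prime_eq_iff h hc (x := x) (i := φ x / ψ x)
        ⟨hψ, (div_mul_cancel₀ _ hψ).symm⟩).2.2 (hA _)
      exact ⟨fun h' => hx (hle h'), orderOf_eq_prime_iff.2 ⟨hxp, fun h' => hx (h' ▸ one_mem _)⟩⟩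
  · intro hset
    rw [D.caseA_iff h hc (by omega)]
    intro i
    have hmem : g ^ i.val * s ∈ (gOne G : Set G)ᶜ := fun h' =>
      D.s_notMem ((Subgroup.mul_mem_cancel_left _ (pow_mem D.g_mem _)).1 h')
    rw [← hset] at hmem
    exact (orderOf_eq_prime_iff.1 hmem.2).1

end PowerData

theorem exists_powerData_and_isCoordinatePair {G : Type*} [Group G] {p n : ℕ} [hp : Fact p.Prime]
    (h : InFamily G p n) (hp5 : 5 ≤ p) : ∃ (s g α β : G) (φ ψ : G → ZMod p),
      PowerData p n s g α β ∧ IsCoordinatePair (gOne G) s g φ ψ := by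
  have hn := h.2.1
  obtain ⟨s, g, α, β, D⟩ := IsMaximalClass.exists_powerData h hp5
  obtain ⟨φ, ψ, hc⟩ := h.1.exists_isCoordinatePair (by omega) (h.1.isCoatom_gOne (by omega))
    D.s_notMem D.g_mem D.g_notMem
  exact ⟨s, g, α, β, φ, ψ, D, hc⟩

theorem beauville_classification {G : Type*} [Group G] {p n : ℕ} [hp : Fact p.Prime]
    (h : InFamily G p n) :
    (IsBeauvilleGroup G ↔ 5 ≤ p ∧ (CaseA G p ∨ CaseB G p n)) ∧
      (5 ≤ p → (CaseA G p ↔ {g : G | g ∉ frattini G ∧ orderOf g = p} = (gOne G : Set G)ᶜ)) ∧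
      (5 ≤ p → CaseA G p → IsTameBeauville G) ∧
      (5 ≤ p → CaseB G p n → IsWildBeauville G) := by
  rcases lt_or_ge p 5 with hp4 | hp5
  · have hp3 : p ≤ 3 := by
      have : p ≠ 4 := by
        rintro rfl
        exact absurd hp.out (by norm_num)
      omega
    refine ⟨⟨fun hB => absurd hB (not_isBeauvilleGroup_of_le_three h hp3), fun h5 => ?_⟩, ?_, ?_, ?_⟩
      <;> omega
  · obtain ⟨s, g, α, β, φ, ψ, D, hc⟩ := exists_powerData_and_isCoordinatePair h hp5
    have hn := h.2.1
    refine ⟨⟨fun hB => ⟨hp5, D.caseA_or_caseB h.1 hc hp5 hn hB⟩, fun hAB => ?_⟩,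
      fun _ => D.caseA_iff_setOf_eq h.1 hc hp5 hn, fun _ => D.isTameBeauville h.1 hc hp5 hn,
      fun _ => D.isWildBeauville h.1 hc hp5 hn⟩
    exact hAB.2.elim (fun hA => (D.isTameBeauville h.1 hc hp5 hn hA).1)
      fun hB => (D.isWildBeauville h.1 hc hp5 hn hB).1

/-! ### Recognising the two cases -/

namespace InFamily

variable {G : Type*} [Group G] {p n : ℕ} [hp : Fact p.Prime]

theorem caseA_of_pow_prime (h : InFamily G p n) (hp5 : 5 ≤ p) {s : G} (hs : s ∉ gOne G)
    (hG : ∀ a ∈ gOne G, (a * s) ^ p = 1) : CaseA G p := by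
  obtain ⟨s', g, α, β, φ, ψ, D, hc⟩ := exists_powerData_and_isCoordinatePair h hp5
  have hn := h.2.1
  have hψ : ψ s ≠ 0 := fun h' => hs ((hc.mem s).2 h')
  refine (D.caseA_iff h.1 hc (by omega)).2 fun i => ?_
  have hk := pow_mem D.g_mem (i * ψ s - φ s).val
  refine (D.pow_prime_eq_iff h.1 hc (x := g ^ (i * ψ s - φ s).val * s) ?_).2.1 (hG _ hk)
  have hψ' := (hc.mem _).1 hk
  rw [HasSlope, hc.ψ_mul, hψ', zero_add, hc.φ_mul, map_npow_eq_nsmul hc.φ_mul, hc.φ_g,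
    nsmul_eq_mul, ZMod.natCast_zmod_val]
  exact ⟨hψ, by ring⟩

theorem caseB_of_pow_prime (h : InFamily G p n) (hp5 : 5 ≤ p) (hmod : ¬ n ≡ 2 [MOD p - 1]) {s a : G}
    (hs : s ∉ gOne G) (ha : a ∈ gOne G) (h0 : s ^ p = 1) (h1 : (a * s) ^ p = 1)
    (h2 : (a ^ 2 * s) ^ p ≠ 1) : CaseB G p n := by
  obtain ⟨s', g, α, β, φ, ψ, D, hc⟩ := exists_powerData_and_isCoordinatePair h hp5
  have hn := h.2.1
  have hψa := (hc.mem a).1 ha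
  have hψ : ψ s ≠ 0 := fun h' => hs ((hc.mem s).2 h')
  have hslope : ∀ k : ℕ, HasSlope φ ψ (a ^ k * s) (some ((k * φ a + φ s) / ψ s)) := fun k => by
    have : ψ (a ^ k * s) = ψ s := by
      rw [hc.ψ_mul, map_npow_eq_nsmul hc.ψ_mul, hψa, smul_zero, zero_add]
    refine ⟨by rwa [this], ?_⟩
    rw [this, hc.φ_mul, map_npow_eq_nsmul hc.φ_mul, nsmul_eq_mul, div_mul_cancel₀ _ hψ]
  have key := fun k => (D.pow_prime_eq_iff h.1 hc (hslope k)).2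
  replace h0 := (key 0).1 (by rwa [pow_zero, one_mul])
  replace h1 := (key 1).1 (by rwa [pow_one])
  rw [Ne, key] at h2
  -- If φ(a) were 0, all the elements a^k s would have the same slope, contradicting the different
  -- behaviour at k = 0 and k = 2.
  have hne : ((0 : ℕ) * φ a + φ s) / ψ s ≠ ((1 : ℕ) * φ a + φ s) / ψ s := by
    intro h'
    rw [div_left_inj' hψ] at h'
    have : φ a = 0 := by simpa using h'
    simp only [this, mul_zero] at h0 h2
    exact h2 h0
  refine ⟨?_, Or.inl hmod⟩
  rw [D.muInvariant_eq h.1 hc (by omega), ← Set.ncard_pair hne]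
  congr 1
  ext i
  refine ⟨fun hi => ?_, ?_⟩
  · by_contra hi'
    simp only [Set.mem_insert_iff, Set.mem_singleton_iff, not_or] at hi'
    exact h2 (D.forall_of_three h.1 (by omega) hne (Ne.symm hi'.1) (Ne.symm hi'.2) h0 h1 hi _)
  · rintro (rfl | rfl)
    exacts [h0, h1]

end InFamily

/-- An action `T` of `ZMod p` on an abelian group together with a `T`-invariant pairing `q` whose
values are multiples of an element `z` which is fixed by `T` and lies in both kernels of `q`. -/
structure TwistedAction (p : ℕ) (A : Type*) [AddCommGroup A] where
  T : ZMod p → AddMonoid.End A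
  q : A →+ A →+ A
  z : A
  T_zero : ∀ a, T 0 a = a
  T_add : ∀ i j a, T (i + j) a = T i (T j a)
  T_z : ∀ i, T i z = z
  q_T : ∀ i a b, q (T i a) (T i b) = q a b
  q_mem : ∀ a b, q a b ∈ AddSubgroup.zmultiples z
  q_z_left : ∀ a, q z a = 0
  q_z_right : ∀ a, q a z = 0

/-- The extension of `ZMod p` by `A`, where `A` carries the multiplication `a * b = a + b + q a b`
and `ZMod p` acts through `T`. -/
@[ext]
structure TwistedProduct {p : ℕ} {A : Type*} [AddCommGroup A] (D : TwistedAction p A) where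
  left : A
  right : ZMod p

/-! ### Extensions of ZMod p by a group of class at most two -/

namespace TwistedAction

variable {p : ℕ} {A : Type*} [AddCommGroup A] (D : TwistedAction p A)

theorem map_q (f : AddMonoid.End A) (hf : f D.z = D.z) (a b : A) : f (D.q a b) = D.q a b := by
  obtain ⟨k, hk⟩ := AddSubgroup.mem_zmultiples_iff.1 (D.q_mem a b)
  rw [← hk, map_zsmul, hf]

theorem q_left_eq_zero {t : A} (ht : t ∈ AddSubgroup.zmultiples D.z) (a : A) : D.q t a = 0 := by
  obtain ⟨k, rfl⟩ := AddSubgroup.mem_zmultiples_iff.1 ht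
  rw [map_zsmul, AddMonoidHom.zsmul_apply, D.q_z_left, smul_zero]

theorem q_right_eq_zero {t : A} (ht : t ∈ AddSubgroup.zmultiples D.z) (a : A) : D.q a t = 0 := by
  obtain ⟨k, rfl⟩ := AddSubgroup.mem_zmultiples_iff.1 ht
  rw [map_zsmul, D.q_z_right, smul_zero]

theorem T_q (i : ZMod p) (a b : A) : D.T i (D.q a b) = D.q a b := D.map_q _ (D.T_z i) a b

theorem q_q_left (a b d : A) : D.q (D.q a b) d = 0 := D.q_left_eq_zero (D.q_mem a b) d

theorem q_q_right (a b d : A) : D.q d (D.q a b) = 0 := D.q_right_eq_zero (D.q_mem a b) d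

end TwistedAction

namespace TwistedProduct

variable {p : ℕ} {A : Type*} [AddCommGroup A] {D : TwistedAction p A}

instance : Mul (TwistedProduct D) :=
  ⟨fun x y => ⟨x.left + D.T x.right y.left + D.q x.left (D.T x.right y.left), x.right + y.right⟩⟩

instance : One (TwistedProduct D) := ⟨⟨0, 0⟩⟩

instance : Inv (TwistedProduct D) :=
  ⟨fun x => ⟨-D.T (-x.right) x.left + D.q (D.T (-x.right) x.left) (D.T (-x.right) x.left), -x.right⟩⟩

@[simp]
theorem mul_left (x y : TwistedProduct D) : (x * y).left =
    x.left + D.T x.right y.left + D.q x.left (D.T x.right y.left) := rfl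

@[simp]
theorem mul_right (x y : TwistedProduct D) : (x * y).right = x.right + y.right := rfl

@[simp]
theorem one_left : (1 : TwistedProduct D).left = 0 := rfl

@[simp]
theorem one_right : (1 : TwistedProduct D).right = 0 := rfl

@[simp]
theorem inv_left (x : TwistedProduct D) : x⁻¹.left =
    -D.T (-x.right) x.left + D.q (D.T (-x.right) x.left) (D.T (-x.right) x.left) := rfl

@[simp]
theorem inv_right (x : TwistedProduct D) : x⁻¹.right = -x.right := rfl

instance : Group (TwistedProduct D) :=
  Group.ofLeftAxioms
    (fun x y w => by
      ext
      · simp only [mul_left, mul_right, map_add, AddMonoidHom.add_apply, D.T_q, D.q_q_left,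
          D.q_q_right, D.T_add, D.q_T]
        abel
      · exact add_assoc _ _ _)
    (fun x => by ext <;> simp [D.T_zero])
    (fun x => by
      ext
      · simp only [mul_left, inv_left, inv_right, map_add, map_neg, AddMonoidHom.add_apply,
          AddMonoidHom.neg_apply, D.q_q_left, one_left]
        abel
      · simp)

variable (D) in
/-- The projection to `ZMod p`. -/
def rightHom : TwistedProduct D →* Multiplicative (ZMod p) where
  toFun x := Multiplicative.ofAdd x.right
  map_one' := rfl
  map_mul' _ _ := rfl

theorem mem_ker_rightHom {x : TwistedProduct D} : x ∈ (rightHom D).ker ↔ x.right = 0 := Iff.rfl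

theorem card_eq [NeZero p] : Nat.card (TwistedProduct D) = p * Nat.card A := by
  rw [Nat.card_congr (⟨fun x => (x.right, x.left), fun x => ⟨x.2, x.1⟩, fun _ => rfl,
    fun _ => rfl⟩ : TwistedProduct D ≃ ZMod p × A), Nat.card_prod, Nat.card_zmod]

variable (D) in
/-- The elements of the kernel of the projection. -/
def inl (a : A) : TwistedProduct D := ⟨a, 0⟩

variable (D) in
/-- The standard complement of the kernel of the projection is generated by this element. -/
def gen : TwistedProduct D := ⟨0, 1⟩

theorem inl_left {x : TwistedProduct D} (hx : x.right = 0) : inl D x.left = x :=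
  TwistedProduct.ext rfl hx.symm

theorem inl_mul_inl (a b : A) : inl D a * inl D b = inl D (a + b + D.q a b) := by
  ext <;> simp [inl, D.T_zero]

theorem commutatorElement_inl (a b : A) : ⁅inl D a, inl D b⁆ = inl D (D.q a b - D.q b a) := by
  rw [commutatorElement_def, mul_inv_eq_iff_eq_mul, mul_inv_eq_iff_eq_mul, inl_mul_inl, inl_mul_inl,
    inl_mul_inl]
  simp only [map_add, map_sub, AddMonoidHom.add_apply, AddMonoidHom.sub_apply, D.q_q_left]
  congr 1
  abel

theorem commutatorElement_gen_inl (a : A) :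
    ⁅gen D, inl D a⁆ = inl D ((D.T 1 a - a) - D.q (D.T 1 a - a) a) := by
  have h : gen D * inl D a = inl D (D.T 1 a) * gen D := by
    ext <;> simp [gen, inl]
  rw [commutatorElement_def, h, mul_inv_cancel_right, mul_inv_eq_iff_eq_mul, inl_mul_inl]
  simp only [map_sub, AddMonoidHom.sub_apply, D.q_q_left]
  congr 1
  abel

theorem inl_mul_gen (a : A) : inl D a * gen D = ⟨a, 1⟩ := by
  ext <;> simp [gen, inl]

theorem inl_mul_gen_pow (a : A) (k : ℕ) : (inl D a * gen D) ^ k =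
    ⟨∑ j ∈ Finset.range k, D.T j a +
      ∑ j ∈ Finset.range k, D.q (∑ i ∈ Finset.range j, D.T i a) (D.T j a), k⟩ := by
  induction k with
  | zero => ext <;> simp
  | succ k ih =>
    have h0 : D.q (∑ j ∈ Finset.range k, D.q (∑ i ∈ Finset.range j, D.T i a) (D.T j a)) (D.T k a) = 0 :=
      D.q_left_eq_zero (sum_mem fun j _ => D.q_mem _ _) _
    rw [pow_succ, ih, inl_mul_gen]
    ext
    · simp only [mul_left, map_add, AddMonoidHom.add_apply, h0, Finset.sum_range_succ]
      abel
    · simp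

theorem right_eq_zero_of_mem_gammaSeries_two {x : TwistedProduct D} (hx : x ∈ gammaSeries _ 2) :
    x.right = 0 := by
  rw [← mem_ker_rightHom]
  refine Abelianization.commutator_subset_ker (rightHom D) ?_
  exact hx

section Uniserial

variable [hp : Fact p.Prime] {m : ℕ} {c : A}

/-- Repeated commutation with `gen` applies T 1 - 1; the correction by q is a multiple of z and
disappears at the next step, because T fixes z. -/
theorem exists_inl_mem_gammaSeries (c : A) (k : ℕ) : ∃ t ∈ AddSubgroup.zmultiples D.z,
    inl D (((D.T 1 - 1) ^ k : AddMonoid.End A) c + t) ∈ gammaSeries (TwistedProduct D) (k + 1) := by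
  induction k with
  | zero => exact ⟨0, zero_mem _, trivial⟩
  | succ k ih =>
    obtain ⟨t, ht, hk⟩ := ih
    have h1 := commutatorElement_mem_gammaSeries_succ' hk (gen D)
    have h2 : D.T 1 t - t = 0 := by
      obtain ⟨l, rfl⟩ := AddSubgroup.mem_zmultiples_iff.1 ht
      rw [map_zsmul, D.T_z, sub_self]
    have h3 : D.T 1 (((D.T 1 - 1) ^ k : AddMonoid.End A) c + t) -
        (((D.T 1 - 1) ^ k : AddMonoid.End A) c + t) =
        ((D.T 1 - 1) ^ (k + 1) : AddMonoid.End A) c := by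
      rw [pow_succ', map_add, add_sub_add_comm, h2, add_zero]
      rfl
    rw [commutatorElement_gen_inl, h3, sub_eq_add_neg] at h1
    exact ⟨_, neg_mem (D.q_mem _ _), h1⟩

variable (hc : ((D.T 1 - 1) ^ (m - 1) : AddMonoid.End A) c = D.z)
include hc

theorem inl_z_mem_gammaSeries (hm : 2 ≤ m) : inl D D.z ∈ gammaSeries (TwistedProduct D) m := by
  obtain ⟨k, rfl⟩ := Nat.exists_eq_add_of_le' hm
  obtain ⟨t, ht, hk⟩ := exists_inl_mem_gammaSeries (D := D) c k
  have h1 := commutatorElement_mem_gammaSeries_succ' hk (gen D)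
  have h2 : D.T 1 t - t = 0 := by
    obtain ⟨l, rfl⟩ := AddSubgroup.mem_zmultiples_iff.1 ht
    rw [map_zsmul, D.T_z, sub_self]
  have h3 : D.T 1 (((D.T 1 - 1) ^ k : AddMonoid.End A) c + t) -
      (((D.T 1 - 1) ^ k : AddMonoid.End A) c + t) = D.z := by
    rw [map_add, add_sub_add_comm, h2, add_zero, ← hc]
    change _ = ((D.T 1 - 1) ^ (k + 1) : AddMonoid.End A) c
    rw [pow_succ']
    rfl
  rwa [commutatorElement_gen_inl, h3, D.q_z_left, sub_zero] at h1

theorem inl_mem_gammaSeries_of_mem (hm : 2 ≤ m) {t : A} (ht : t ∈ AddSubgroup.zmultiples D.z) :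
    inl D t ∈ gammaSeries (TwistedProduct D) m := by
  obtain ⟨k, rfl⟩ := AddSubgroup.mem_zmultiples_iff.1 ht
  have key : ∀ j : ℤ, inl D ((j + 1) • D.z) = inl D (j • D.z) * inl D D.z := fun j => by
    rw [inl_mul_inl, D.q_z_right, add_zero, add_zsmul, one_zsmul]
  have hz := inl_z_mem_gammaSeries hc hm
  clear ht
  induction k with
  | zero => rw [zero_smul]; exact one_mem _
  | succ k ih => rw [key]; exact mul_mem ih hz
  | pred k ih =>
    rwa [← Subgroup.mul_mem_cancel_right _ hz, ← key, sub_add_cancel]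

theorem isMaximalClass (hm : 2 ≤ m) (hcard : Nat.card A = p ^ m) (hz : D.z ≠ 0) :
    IsMaximalClass (TwistedProduct D) p (m + 1) := by
  refine isMaximalClass_of_gammaSeries_ne_bot (by omega) (by rw [card_eq, hcard, pow_succ']) ?_
  intro h
  have h1 := inl_z_mem_gammaSeries hc hm
  rw [Nat.add_sub_cancel] at h
  rw [h, Subgroup.mem_bot] at h1
  exact hz (congrArg left h1)

omit hc in
theorem isCoatom_ker_rightHom : IsCoatom (rightHom D).ker := by
  have : IsSimpleGroup (Multiplicative (ZMod p)) :=
    isSimpleGroup_of_prime_card (p := p) (Nat.card_zmod p)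
  have h := (Subgroup.isCoatom_comap_of_surjective (φ := rightHom D) (M := ⊥)
    (fun i => ⟨⟨0, i⟩, rfl⟩) isCoatom_bot)
  rwa [MonoidHom.comap_bot] at h

omit hc in
-- In the kernel of the projection to ZMod p the multiples of z are central, and the quotient by
-- them is abelian because q takes values there.
theorem hasMaximalSubgroupOfClassLETwo : HasMaximalSubgroupOfClassLETwo (TwistedProduct D) := by
  have hM : ∀ x : (rightHom D).ker, inl D x.1.left = x := fun x => inl_left x.2
  let f : (rightHom D).ker →* Multiplicative (A ⧸ AddSubgroup.zmultiples D.z) :=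
    MonoidHom.mk' (fun x => Multiplicative.ofAdd (QuotientAddGroup.mk x.1.left)) fun x y => by
      have h : (x * y : (rightHom D).ker).1.left = x.1.left + y.1.left + D.q x.1.left y.1.left := by
        rw [Subgroup.coe_mul, ← hM x, ← hM y, inl_mul_inl]
        rfl
      rw [← ofAdd_add, ← QuotientAddGroup.mk_add, h, QuotientAddGroup.mk_add_of_mem _ (D.q_mem _ _)]
  have hf : f.ker ≤ Subgroup.center _ := by
    intro x hx
    rw [MonoidHom.mem_ker] at hx
    have hx' : x.1.left ∈ AddSubgroup.zmultiples D.z := (QuotientAddGroup.eq_zero_iff _).1 hx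
    rw [Subgroup.mem_center_iff]
    intro y
    apply Subtype.ext
    rw [Subgroup.coe_mul, Subgroup.coe_mul, ← hM x, ← hM y, inl_mul_inl, inl_mul_inl,
      D.q_left_eq_zero hx', D.q_right_eq_zero hx', add_comm y.1.left]
  exact ⟨_, isCoatom_ker_rightHom, Subgroup.isNilpotent_of_ker_le_center f hf,
    (Group.nilpotencyClass_le_of_ker_le_center f hf).trans
      (Nat.succ_le_succ CommGroup.nilpotencyClass_le_one)⟩

theorem inFamily (hm : 2 ≤ m) (hpm : p ≤ m) (hcard : Nat.card A = p ^ m) (hz : D.z ≠ 0) :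
    InFamily (TwistedProduct D) p (m + 1) :=
  ⟨isMaximalClass hc hm hcard hz, by omega, Or.inr hasMaximalSubgroupOfClassLETwo⟩

/-- Commutators within the kernel are multiples of z and so lie in γ_m, which is contained in γ₄. -/
theorem gOne_eq_ker_rightHom (hm : 4 ≤ m) (hcard : Nat.card A = p ^ m) (hz : D.z ≠ 0) :
    gOne (TwistedProduct D) = (rightHom D).ker := by
  have h := isMaximalClass hc (by omega) hcard hz
  refine ((isCoatom_ker_rightHom.le_iff_eq (h.isCoatom_gOne (by omega)).1).1 fun x hx => ?_)
  rw [gOne_eq_twoStepCentralizer, mem_twoStepCentralizer]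
  intro a ha
  rw [← inl_left hx, ← inl_left (right_eq_zero_of_mem_gammaSeries_two ha), commutatorElement_inl]
  exact gammaSeries_antitone hm (inl_mem_gammaSeries_of_mem hc (by omega)
    (sub_mem (D.q_mem _ _) (D.q_mem _ _)))

end Uniserial

end TwistedProduct

open Polynomial

/-- The `ZMod N`-valued functions on `ZMod p` which vanish at `0`; they form a system of
representatives for the functions modulo constants. -/
def NormalizedFun (p N : ℕ) : Type :=
  LinearMap.ker (LinearMap.proj (R := ZMod N) (φ := fun _ : ZMod p => ZMod N) 0)

/-! ### Functions modulo constants and the translation action -/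

namespace NormalizedFun

variable {p N : ℕ}

instance : AddCommGroup (NormalizedFun p N) :=
  inferInstanceAs (AddCommGroup (LinearMap.ker (LinearMap.proj (R := ZMod N) _)))

instance : Module (ZMod N) (NormalizedFun p N) :=
  inferInstanceAs (Module (ZMod N) (LinearMap.ker (LinearMap.proj (R := ZMod N) _)))

/-- The underlying function. -/
def coeFn (a : NormalizedFun p N) : ZMod p → ZMod N := a.1

instance : CoeFun (NormalizedFun p N) fun _ => ZMod p → ZMod N := ⟨coeFn⟩

@[ext]
theorem ext {a b : NormalizedFun p N} (h : ∀ x, a x = b x) : a = b := Subtype.ext (funext h)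

@[simp]
theorem add_apply (a b : NormalizedFun p N) (x : ZMod p) : (a + b) x = a x + b x := rfl

@[simp]
theorem smul_apply (r : ZMod N) (a : NormalizedFun p N) (x : ZMod p) : (r • a) x = r * a x := rfl

@[simp]
theorem zero_apply (x : ZMod p) : (0 : NormalizedFun p N) x = 0 := rfl

variable (p N) in
/-- Evaluation at a point. -/
def eval (x : ZMod p) : NormalizedFun p N →ₗ[ZMod N] ZMod N where
  toFun a := a x
  map_add' _ _ := rfl
  map_smul' _ _ := rfl

theorem eval_apply (x : ZMod p) (a : NormalizedFun p N) : eval p N x a = a x := rfl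

theorem apply_zero (a : NormalizedFun p N) : a 0 = 0 := a.2

/-- The translation by `i`, modulo constants. -/
def shift (i : ZMod p) : NormalizedFun p N →ₗ[ZMod N] NormalizedFun p N where
  toFun a := ⟨fun x => a (x - i) - a (-i), by simp⟩
  map_add' a b := by
    ext x
    exact add_sub_add_comm _ _ _ _
  map_smul' r a := by
    ext x
    exact (mul_sub _ _ _).symm

theorem shift_apply (i : ZMod p) (a : NormalizedFun p N) (x : ZMod p) :
    shift i a x = a (x - i) - a (-i) := rfl

theorem shift_zero (a : NormalizedFun p N) : shift 0 a = a := by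
  ext x
  simp [shift_apply, a.apply_zero]

theorem shift_add (i j : ZMod p) (a : NormalizedFun p N) :
    shift (i + j) a = shift i (shift j a) := by
  ext x
  simp only [shift_apply, sub_add_eq_sub_sub, neg_add_rev]
  rw [show -j + -i = -i - j by ring]
  ring

theorem card_eq [NeZero p] [NeZero N] : Nat.card (NormalizedFun p N) = N ^ (p - 1) := by
  have hs : Function.Surjective (LinearMap.proj (R := ZMod N) (φ := fun _ : ZMod p => ZMod N) 0) :=
    fun r => ⟨fun _ => r, rfl⟩
  have h1 := Submodule.card_eq_card_quotient_mul_card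
    (LinearMap.ker (LinearMap.proj (R := ZMod N) (φ := fun _ : ZMod p => ZMod N) 0))
  rw [Nat.card_congr (LinearMap.quotKerEquivOfSurjective _ hs).toEquiv, Nat.card_zmod,
    Nat.card_fun, Nat.card_zmod, Nat.card_zmod] at h1
  obtain ⟨k, hk⟩ := Nat.exists_eq_succ_of_ne_zero (NeZero.ne p)
  rw [hk, pow_succ] at h1
  rw [hk, Nat.succ_sub_one]
  exact (Nat.eq_of_mul_eq_mul_right (NeZero.pos N) h1).symm

section Prime

variable [hp : Fact p.Prime]

theorem sum_range_natCast {M : Type*} [AddCommMonoid M] (f : ZMod p → M) :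
    ∑ j ∈ Finset.range p, f j = ∑ x, f x := by
  refine Finset.sum_bij' (fun j _ => (j : ZMod p)) (fun x _ => x.val) ?_ ?_ ?_ ?_ ?_
  · simp
  · exact fun x _ => Finset.mem_range.2 (ZMod.val_lt x)
  · exact fun j hj => ZMod.val_cast_of_lt (Finset.mem_range.1 hj)
  · exact fun x _ => ZMod.natCast_zmod_val x
  · exact fun _ _ => rfl

/-- The sum of all translates of a function is constant, hence zero modulo constants. -/
theorem sum_shift (a : NormalizedFun p N) : ∑ j ∈ Finset.range p, shift (j : ZMod p) a = 0 := by
  rw [sum_range_natCast fun j => shift j a]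
  ext x
  simp only [← eval_apply, map_sum]
  simp only [eval_apply, shift_apply, Finset.sum_sub_distrib]
  exact sub_eq_zero.2 (((Equiv.subLeft x).sum_comp a).trans (Equiv.sum_comp (Equiv.neg (ZMod p)) a).symm)

variable (p N) in
/-- The difference operator `shift 1 - 1`. -/
def diff : NormalizedFun p N →ₗ[ZMod N] NormalizedFun p N := shift 1 - LinearMap.id

theorem diff_def (a : NormalizedFun p N) : diff p N a = shift 1 a - a := rfl

theorem diff_apply (a : NormalizedFun p N) (x : ZMod p) :
    diff p N a x = a (x - 1) - a (-1) - a x := rfl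

/-- The trace of the shift vanishes, so `exists_geom_sum_eq` turns the (p - 1)-st power of the
difference operator into -p times an operator of the form 1 + diff · w. -/
theorem diff_pow_prime_sub_one (a : NormalizedFun p N) :
    ∃ b, (diff p N ^ (p - 1)) a = (-(p : ZMod N)) • (a + diff p N b) := by
  obtain ⟨w, hw⟩ := exists_geom_sum_eq hp.out (X : ℤ[X])
  refine ⟨aeval (diff p N) w a, ?_⟩
  have h1 : ∀ j : ℕ, ((1 + diff p N) ^ j) a = shift (j : ZMod p) a := by
    intro j
    induction j with
    | zero => rw [pow_zero, Nat.cast_zero, shift_zero]; rfl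
    | succ j ih =>
      rw [pow_succ', Module.End.mul_apply, ih, Nat.cast_succ, add_comm (j : ZMod p), shift_add]
      exact add_sub_cancel _ _
  have h2 := congrArg (fun f => aeval (diff p N) f a) hw
  simp only [map_sum, map_pow, map_add, map_mul, map_one, aeval_X, map_natCast,
    LinearMap.sum_apply, LinearMap.add_apply, Module.End.mul_apply, h1, sum_shift,
    Module.End.natCast_apply, Module.End.one_apply] at h2
  refine Eq.trans ?_ (neg_smul _ _).symm
  rw [Nat.cast_smul_eq_nsmul, smul_add]
  exact eq_neg_of_add_eq_zero_right h2.symm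

theorem diff_pow_mul (a : NormalizedFun p N) (k : ℕ) :
    ∃ b, (diff p N ^ ((p - 1) * k)) a = (-(p : ZMod N)) ^ k • (a + diff p N b) := by
  induction k generalizing a with
  | zero => exact ⟨0, by simp⟩
  | succ k ih =>
    obtain ⟨b, hb⟩ := diff_pow_prime_sub_one a
    obtain ⟨d, hd⟩ := ih (a + diff p N b)
    refine ⟨b + d, ?_⟩
    rw [mul_add, mul_one, pow_add, Module.End.mul_apply, hb, map_smul, hd, smul_smul, ← pow_succ',
      map_add, add_assoc]

variable (p N) in
/-- The indicator function of `1`. -/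
def single : NormalizedFun p N := ⟨Pi.single 1 1, by simp⟩

theorem single_apply (x : ZMod p) : single p N x = if x = 1 then 1 else 0 :=
  Pi.single_apply _ _ _

/-- Each difference moves the last support point, among the representatives 0, …, p - 1, one place
to the right with coefficient 1. For k = p - 2 this shows that the result is nonzero even modulo p.
-/
theorem diff_pow_single_apply {k : ℕ} (hk : k + 2 ≤ p) :
    (diff p N ^ k) (single p N) ((k + 1 : ℕ) : ZMod p) = 1 ∧
      ∀ y < p, k + 1 < y → (diff p N ^ k) (single p N) (y : ZMod p) = 0 := by
  induction k with
  | zero =>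
    simp only [pow_zero, Module.End.one_apply, single_apply]
    refine ⟨by simp, fun y hy h1 => if_neg fun h2 => ?_⟩
    rw [← Nat.cast_one, ZMod.natCast_eq_natCast_iff', Nat.mod_eq_of_lt hy,
      Nat.mod_eq_of_lt hp.out.one_lt] at h2
    omega
  | succ k ih =>
    obtain ⟨ih1, ih2⟩ := ih (by omega)
    -- The point -1 is p - 1, still beyond the support, so the normalising constant in `diff_apply`
    -- vanishes.
    have h0 : (diff p N ^ k) (single p N) (-1) = 0 := by
      rw [← ih2 (p - 1) (by omega) (by omega), Nat.cast_pred hp.out.pos, ZMod.natCast_self, zero_sub]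
    rw [pow_succ', Module.End.mul_apply]
    simp only [diff_apply, h0, sub_zero]
    refine ⟨?_, fun y hy h1 => ?_⟩
    · rw [ih2 (k + 1 + 1) (by omega) (by omega), sub_zero, Nat.cast_succ (k + 1),
        add_sub_cancel_right, ih1]
    · rw [ih2 y hy (by omega), sub_zero, ← ih2 (y - 1) (by omega) (by omega),
        Nat.cast_pred (by omega)]

end Prime

/-- The pairing `∑ x, a x * (b (x - 1) - b x)`. -/
def pairing [Fact p.Prime] (a b : NormalizedFun p N) : ZMod N := ∑ x, a x * (b (x - 1) - b x)

section Pairing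

variable [hp : Fact p.Prime]

theorem pairing_add_left (a a' b : NormalizedFun p N) :
    pairing (a + a') b = pairing a b + pairing a' b := by
  simp only [pairing, add_apply, add_mul, Finset.sum_add_distrib]

theorem pairing_add_right (a b b' : NormalizedFun p N) :
    pairing a (b + b') = pairing a b + pairing a b' := by
  simp only [pairing, add_apply, ← Finset.sum_add_distrib]
  exact Finset.sum_congr rfl fun x _ => by ring

theorem pairing_smul_left (r : ZMod N) (a b : NormalizedFun p N) :
    pairing (r • a) b = r * pairing a b := by
  simp only [pairing, smul_apply, Finset.mul_sum, mul_assoc]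

theorem pairing_smul_right (r : ZMod N) (a b : NormalizedFun p N) :
    pairing a (r • b) = r * pairing a b := by
  simp only [pairing, smul_apply, Finset.mul_sum]
  exact Finset.sum_congr rfl fun x _ => by ring

/-- The normalising constants drop out: they cancel inside b(x - 1) - b(x), and in the first
argument they multiply a telescoping sum. -/
theorem pairing_shift (i : ZMod p) (a b : NormalizedFun p N) :
    pairing (shift i a) (shift i b) = pairing a b := by
  have h : ∀ (f : ZMod p → ZMod N) (j : ZMod p), ∑ x, f (x - j) = ∑ x, f x :=
    fun f j => (Equiv.subRight j).sum_comp f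
  have h1 : ∑ x, (b (x - 1) - b x) = 0 := by
    rw [Finset.sum_sub_distrib, h b, sub_self]
  calc pairing (shift i a) (shift i b)
      = ∑ x, (a (x - i) * (b (x - i - 1) - b (x - i)) - a (-i) * (b (x - i - 1) - b (x - i))) := by
        refine Finset.sum_congr rfl fun x _ => ?_
        rw [shift_apply, shift_apply, shift_apply, sub_right_comm x 1 i]
        ring
    _ = pairing a b := by
        rw [Finset.sum_sub_distrib, h fun y => a y * (b (y - 1) - b y),
          h fun y => a (-i) * (b (y - 1) - b y), ← Finset.mul_sum, h1, mul_zero, sub_zero, pairing]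

theorem pairing_single (a : NormalizedFun p N) : pairing a (single p N) = a 2 - a 1 := by
  simp only [pairing, single_apply, mul_sub, Finset.sum_sub_distrib, mul_ite, mul_one, mul_zero]
  rw [Finset.sum_ite_eq' _ 1]
  simp only [sub_eq_iff_eq_add, one_add_one_eq_two, Finset.sum_ite_eq', Finset.mem_univ, if_true]

theorem sum_pairing_shift_single (hp3 : 3 ≤ p) {j : ℕ} (hj : j < p) :
    ∑ i ∈ Finset.range j, pairing (shift (i : ZMod p) (single p N)) (shift (j : ZMod p) (single p N)) =
      if j = p - 1 then 1 else 0 := by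
  -- By invariance the pairing depends only on k = i - j and equals 1 at k = 1, -1 at k = 0 and 0
  -- otherwise. For 0 ≤ i < j < p this leaves only i = 0, j = p - 1.
  have h1 : ∀ i ∈ Finset.range j, pairing (shift (i : ZMod p) (single p N))
      (shift (j : ZMod p) (single p N)) = if j = p - 1 then if i = 0 then 1 else 0 else 0 := by
    intro i hi
    rw [Finset.mem_range] at hi
    have h2 : ((i : ZMod p) - j = 0) ↔ False := by
      rw [sub_eq_zero, ZMod.natCast_eq_natCast_iff', Nat.mod_eq_of_lt (hi.trans hj),
        Nat.mod_eq_of_lt hj, iff_false]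
      exact hi.ne
    have h3 : ((i : ZMod p) - j = 1) ↔ j = p - 1 ∧ i = 0 := by
      rw [sub_eq_iff_eq_add', ← Nat.cast_succ, ZMod.natCast_eq_natCast_iff',
        Nat.mod_eq_of_lt (hi.trans hj)]
      rcases eq_or_ne j (p - 1) with rfl | hne
      · rw [Nat.succ_eq_add_one, Nat.sub_add_cancel hp.out.pos, Nat.mod_self]
        simp
      · rw [Nat.mod_eq_of_lt (by omega)]
        omega
    obtain ⟨k, hk⟩ : ∃ k : ZMod p, k = i - j := ⟨_, rfl⟩
    rw [← hk] at h2 h3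
    have h4 : (2 - k = 1) ↔ k = 1 :=
      ⟨fun h => by linear_combination -h, fun h => by linear_combination -h⟩
    have h5 : (1 - k = 1) ↔ k = 0 :=
      ⟨fun h => by linear_combination -h, fun h => by linear_combination -h⟩
    rw [show (i : ZMod p) = j + k by rw [hk]; ring, shift_add, pairing_shift, pairing_single,
      shift_apply, shift_apply, sub_sub_sub_cancel_right, single_apply, single_apply]
    simp only [h4, h5, h2, h3, if_false, sub_zero, ite_and]
  rw [Finset.sum_congr rfl h1]
  split_ifs with h
  · rw [Finset.sum_ite_eq', if_pos (Finset.mem_range.2 (by omega))]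
  · exact Finset.sum_const_zero

end Pairing

end NormalizedFun

/-! ### The twisted action and the socle element -/

namespace NormalizedFun

variable {p N : ℕ} [hp : Fact p.Prime]

/-- A shift-invariant function which is divisible by `p` and killed by `p`. -/
structure IsSmallInvariant (z : NormalizedFun p N) : Prop where
  shift_eq : ∀ i, shift i z = z
  exists_eq : ∃ w, z = (p : ZMod N) • w
  smul_eq : (p : ZMod N) • z = 0

namespace IsSmallInvariant

variable {z : NormalizedFun p N} (hz : IsSmallInvariant z)
include hz

omit hp in
theorem mul_smul_eq (r : ZMod N) : ((p : ZMod N) * r) • z = 0 := by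
  rw [mul_comm, mul_smul, hz.smul_eq, smul_zero]

omit hp in
-- The values of z are multiples of p, and p annihilates z. This makes all second-order terms in the
-- twist disappear.
theorem apply_smul (x : ZMod p) : z x • z = 0 := by
  obtain ⟨w, hw⟩ := hz.exists_eq
  conv_lhs => rw [hw, smul_apply, ← hw]
  exact hz.mul_smul_eq _

theorem pairing_left_smul (a : NormalizedFun p N) : pairing z a • z = 0 := by
  obtain ⟨w, hw⟩ := hz.exists_eq
  conv_lhs => rw [hw, pairing_smul_left, ← hw]
  exact hz.mul_smul_eq _

theorem pairing_right_smul (a : NormalizedFun p N) : pairing a z • z = 0 := by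
  obtain ⟨w, hw⟩ := hz.exists_eq
  conv_lhs => rw [hw, pairing_smul_right, ← hw]
  exact hz.mul_smul_eq _

theorem pairing_add_smul (a b : NormalizedFun p N) (u v : ZMod N) :
    pairing (a + u • z) (b + v • z) • z = pairing a b • z := by
  rw [pairing_add_left, pairing_add_right, pairing_smul_right, pairing_smul_left, add_smul,
    add_smul, mul_smul, mul_smul, hz.pairing_left_smul, hz.pairing_right_smul, smul_zero,
    smul_zero, add_zero, add_zero]

/-- The translation action, twisted by `ε` times a cocycle, and `ε` times the pairing. -/
def twistedAction (ε : ZMod N) : TwistedAction p (NormalizedFun p N) where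
  T i := AddMonoidHom.mk' (fun a => shift i a + (ε * (a 1 - a (1 - i))) • z) fun a b => by
    rw [map_add, add_apply, add_apply, add_add_add_comm, ← add_smul, ← mul_add]
    congr 3
    ring
  q := AddMonoidHom.mk' (fun a => AddMonoidHom.mk' (fun b => (ε * pairing a b) • z) fun b b' => by
      rw [pairing_add_right, mul_add, add_smul]) fun a a' => by
    ext1 b
    change (ε * pairing (a + a') b) • z = (ε * pairing a b) • z + (ε * pairing a' b) • z
    rw [pairing_add_left, mul_add, add_smul]
  z := z
  T_zero a := by
    change shift 0 a + (ε * (a 1 - a (1 - 0))) • z = a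
    rw [shift_zero, sub_zero, sub_self, mul_zero, zero_smul, add_zero]
  T_add i j a := by
    change shift (i + j) a + (ε * (a 1 - a (1 - (i + j)))) • z =
      shift i (shift j a + (ε * (a 1 - a (1 - j))) • z) +
        (ε * ((shift j a 1 + ε * (a 1 - a (1 - j)) * z 1) -
          (shift j a (1 - i) + ε * (a 1 - a (1 - j)) * z (1 - i)))) • z
    -- Up to terms in z(x) • z, which vanish, the differences a(1) - a(1 - j) and a(1 - j) - a(1 -
    -- (i + j)) telescope: this is the cocycle identity.
    generalize hu : ε * (a 1 - a (1 - j)) = u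
    have h : ε * ((shift j a 1 + u * z 1) - (shift j a (1 - i) + u * z (1 - i))) =
        ε * (a (1 - j) - a (1 - (i + j))) + ((ε * u) * z 1 - (ε * u) * z (1 - i)) := by
      rw [shift_apply, shift_apply, sub_add_eq_sub_sub 1 i j]
      ring
    rw [h, add_smul, sub_smul, mul_smul (ε * u), mul_smul (ε * u), hz.apply_smul, hz.apply_smul,
      smul_zero, sub_zero, add_zero, map_add, map_smul, hz.shift_eq, shift_add, add_assoc,
      ← add_smul, ← hu]
    congr 2
    rw [← mul_add, sub_add_sub_cancel]
  T_z i := by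
    change shift i z + (ε * (z 1 - z (1 - i))) • z = z
    rw [hz.shift_eq, mul_smul, sub_smul, hz.apply_smul, hz.apply_smul, sub_zero, smul_zero, add_zero]
  q_T i a b := by
    change (ε * pairing (shift i a + (ε * (a 1 - a (1 - i))) • z)
      (shift i b + (ε * (b 1 - b (1 - i))) • z)) • z = (ε * pairing a b) • z
    rw [mul_smul, hz.pairing_add_smul, pairing_shift, mul_smul]
  q_mem a b := by
    refine AddSubgroup.mem_zmultiples_iff.2 ⟨((ε * pairing a b : ZMod N).cast : ℤ), ?_⟩
    rw [← Int.cast_smul_eq_zsmul (ZMod N), ZMod.intCast_zmod_cast]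
    rfl
  q_z_left a := by
    change (ε * pairing z a) • z = 0
    rw [mul_smul, hz.pairing_left_smul, smul_zero]
  q_z_right a := by
    change (ε * pairing a z) • z = 0
    rw [mul_smul, hz.pairing_right_smul, smul_zero]

theorem twistedAction_T_apply (ε : ZMod N) (i : ZMod p) (a : NormalizedFun p N) :
    (hz.twistedAction ε).T i a = shift i a + (ε * (a 1 - a (1 - i))) • z := rfl

theorem twistedAction_q_apply (ε : ZMod N) (a b : NormalizedFun p N) :
    (hz.twistedAction ε).q a b = (ε * pairing a b) • z := rfl

theorem twistedAction_z (ε : ZMod N) : (hz.twistedAction ε).z = z := rfl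

theorem diff_eq_zero : diff p N z = 0 := by
  rw [diff_def, hz.shift_eq, sub_self]

/-- The untwisted trace is zero. In the sum of the cocycle the term with a(1) occurs p times and is
killed by z, leaving minus the total sum of a. -/
theorem sum_twistedAction_T (ε : ZMod N) (a : NormalizedFun p N) :
    ∑ j ∈ Finset.range p, (hz.twistedAction ε).T j a = -((ε * ∑ x, a x) • z) := by
  simp only [twistedAction_T_apply, Finset.sum_add_distrib, sum_shift, zero_add]
  rw [← Finset.sum_smul, ← Finset.mul_sum, sum_range_natCast fun j : ZMod p => a 1 - a (1 - j),
    Finset.sum_sub_distrib, Finset.sum_const, Finset.card_univ, ZMod.card, nsmul_eq_mul,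
    show ∑ x, a (1 - x) = ∑ x, a x from (Equiv.subLeft (1 : ZMod p)).sum_comp a, mul_sub, sub_smul, mul_left_comm,
    hz.mul_smul_eq, zero_sub]

theorem sum_twistedAction_q (ε : ZMod N) (a : NormalizedFun p N) :
    ∑ j ∈ Finset.range p, (hz.twistedAction ε).q
        (∑ i ∈ Finset.range j, (hz.twistedAction ε).T i a) ((hz.twistedAction ε).T j a) =
      (ε * ∑ j ∈ Finset.range p, ∑ i ∈ Finset.range j,
        pairing (shift (i : ZMod p) a) (shift (j : ZMod p) a)) • z := by
  have key : ∀ i j : ZMod p, (hz.twistedAction ε).q ((hz.twistedAction ε).T i a)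
      ((hz.twistedAction ε).T j a) = (ε * pairing (shift i a) (shift j a)) • z := fun i j => by
    rw [twistedAction_q_apply, twistedAction_T_apply, twistedAction_T_apply, mul_smul,
      hz.pairing_add_smul, mul_smul]
  simp only [map_sum, AddMonoidHom.finsetSum_apply, key, Finset.mul_sum, Finset.sum_smul]

theorem twistedAction_sub_one_pow (ε : ZMod N) (a : NormalizedFun p N) (k : ℕ) :
    (((hz.twistedAction ε).T 1 - 1) ^ (k + 1) : AddMonoid.End (NormalizedFun p N)) a =
      (diff p N ^ (k + 1)) a + (ε * ((diff p N ^ k) a 1)) • z := by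
  have h1 : ∀ b, ((hz.twistedAction ε).T 1 - 1 : AddMonoid.End (NormalizedFun p N)) b =
      diff p N b + (ε * b 1) • z := fun b => by
    change shift 1 b + (ε * (b 1 - b (1 - 1))) • z - b = _
    rw [diff_def, sub_self, b.apply_zero, sub_zero]
    abel
  induction k with
  | zero => rw [pow_one, pow_one, h1, pow_zero]; rfl
  | succ k ih =>
    rw [pow_succ', pow_succ' (diff p N)]
    change ((hz.twistedAction ε).T 1 - 1 : AddMonoid.End (NormalizedFun p N))
      ((((hz.twistedAction ε).T 1 - 1) ^ (k + 1) : AddMonoid.End (NormalizedFun p N)) a) = _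
    rw [ih, h1, map_add, map_smul, hz.diff_eq_zero, smul_zero, add_zero, add_apply, mul_add,
      smul_apply, mul_left_comm, add_smul, mul_smul _ (ε * _), mul_smul ε (z 1)]
    rw [hz.apply_smul, smul_zero, smul_zero, add_zero, Module.End.mul_apply]

end IsSmallInvariant

variable {e : ℕ}

variable (p e) in
/-- The socle element `(-p) ^ (e - 1) • (shift 1 - 1) ^ (p - 2) (single)`. -/
def socle : NormalizedFun p (p ^ e) :=
  (-(p : ZMod (p ^ e))) ^ (e - 1) • (diff p (p ^ e) ^ (p - 2)) (single p (p ^ e))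

omit hp in
theorem neg_pow_eq_zero {k : ℕ} (hk : e ≤ k) : (-(p : ZMod (p ^ e))) ^ k = 0 := by
  have h : (p : ZMod (p ^ e)) ^ e = 0 := by rw [← Nat.cast_pow, ZMod.natCast_self]
  rw [neg_pow, ← Nat.sub_add_cancel hk, pow_add (p : ZMod (p ^ e)), h, mul_zero, mul_zero]

theorem isSmallInvariant_socle (he : 2 ≤ e) : IsSmallInvariant (socle p e) := by
  have hp2 := hp.out.two_le
  have hdiff : diff p (p ^ e) (socle p e) = 0 := by
    obtain ⟨b, hb⟩ := diff_pow_prime_sub_one (single p (p ^ e))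
    rw [socle, map_smul, ← Module.End.mul_apply, ← pow_succ', show p - 2 + 1 = p - 1 by omega, hb,
      smul_smul, ← pow_succ, neg_pow_eq_zero (by omega), zero_smul]
  have hshift : shift 1 (socle p e) = socle p e := sub_eq_zero.1 hdiff
  refine ⟨fun i => ?_, ⟨(-(-(p : ZMod (p ^ e))) ^ (e - 2)) •
    (diff p (p ^ e) ^ (p - 2)) (single p (p ^ e)), ?_⟩, ?_⟩
  · rw [← ZMod.natCast_zmod_val i]
    induction i.val with
    | zero => rw [Nat.cast_zero, shift_zero]
    | succ k ih => rw [Nat.cast_succ, shift_add, hshift, ih]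
  · rw [socle, smul_smul, show e - 1 = e - 2 + 1 by omega, pow_succ]
    congr 1
    ring
  · rw [socle, smul_smul, show (p : ZMod (p ^ e)) * (-(p : ZMod (p ^ e))) ^ (e - 1) =
      -(-(p : ZMod (p ^ e))) ^ (e - 1 + 1) by ring, neg_pow_eq_zero (by omega), neg_zero, zero_smul]

/-- Every p - 1 differences produce a factor -p up to a further difference. After e - 1 rounds and p
- 2 more differences, the error carries the factor p^e = 0. -/
theorem diff_pow_single_eq_socle (he : 1 ≤ e) :
    (diff p (p ^ e) ^ (e * (p - 1) - 1)) (single p (p ^ e)) = socle p e := by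
  have hp2 := hp.out.two_le
  obtain ⟨b, hb⟩ := diff_pow_mul (single p (p ^ e)) (e - 1)
  obtain ⟨d, hd⟩ := diff_pow_prime_sub_one b
  have h : e * (p - 1) - 1 = (p - 2) + (p - 1) * (e - 1) := by
    obtain ⟨k, rfl⟩ := Nat.exists_eq_add_of_le' he
    obtain ⟨l, rfl⟩ := Nat.exists_eq_add_of_le' hp2
    rw [show k + 1 - 1 = k by omega, show l + 2 - 1 = l + 1 by omega, show l + 2 - 2 = l by omega]
    have : (k + 1) * (l + 1) = l + (l + 1) * k + 1 := by ring
    omega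
  rw [h, pow_add, Module.End.mul_apply, hb, map_smul, map_add, ← Module.End.mul_apply _ _ b,
    ← pow_succ, show p - 2 + 1 = p - 1 by omega, hd, smul_add, smul_smul, ← pow_succ,
    neg_pow_eq_zero (k := e - 1 + 1) (by omega), zero_smul, add_zero, socle]

theorem socle_ne_zero (he : 1 ≤ e) : socle p e ≠ 0 := by
  have hp2 := hp.out.two_le
  intro h
  have h1 := congrArg (fun a : NormalizedFun p (p ^ e) => a ((p - 2 + 1 : ℕ) : ZMod p)) h
  simp only [socle, smul_apply, zero_apply, (diff_pow_single_apply (by omega : p - 2 + 2 ≤ p)).1,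
    mul_one] at h1
  rw [neg_pow, ((isUnit_one.neg).pow _).mul_right_eq_zero, ← Nat.cast_pow,
    ZMod.natCast_eq_zero_iff, Nat.pow_dvd_pow_iff_le_right hp.out.one_lt] at h1
  omega

theorem two_smul_socle_ne_zero (he : 2 ≤ e) (hp3 : 3 ≤ p) : (2 : ℕ) • socle p e ≠ 0 := by
  intro h
  have h1 : p • socle p e = 0 := by
    rw [← Nat.cast_smul_eq_nsmul (ZMod (p ^ e))]
    exact (isSmallInvariant_socle he).smul_eq
  refine socle_ne_zero (p := p) (by omega : 1 ≤ e) ?_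
  obtain ⟨k, hk⟩ := hp.out.odd_of_ne_two (by omega)
  have h2 : (2 * k + 1) • socle p e = 0 := by rwa [← hk]
  rwa [add_smul, mul_comm, mul_smul, h, smul_zero, zero_add, one_smul] at h2

end NormalizedFun

/-! ### The two infinite families -/

namespace NormalizedFun

variable {p e : ℕ} [hp : Fact p.Prime]

variable (p) in
/-- The group with kernel `NormalizedFun p (p ^ e)` attached to `ε`. -/
abbrev socleExtension (he : 2 ≤ e) (ε : ZMod (p ^ e)) : Type :=
  TwistedProduct ((isSmallInvariant_socle (p := p) he).twistedAction ε)

/-- The twist adds a multiple of z whose coefficient is a value of at least p - 1 differences of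
`single`. That coefficient is divisible by p, so the correction is zero. -/
theorem twistedAction_pow_single (he : 2 ≤ e) (hp3 : 3 ≤ p) (ε : ZMod (p ^ e)) :
    ((((isSmallInvariant_socle (p := p) he).twistedAction ε).T 1 - 1) ^ (e * (p - 1) - 1) :
      AddMonoid.End (NormalizedFun p (p ^ e))) (single p (p ^ e)) =
      ((isSmallInvariant_socle (p := p) he).twistedAction ε).z := by
  have hz := isSmallInvariant_socle (p := p) he
  have hm : 2 * (p - 1) ≤ e * (p - 1) := Nat.mul_le_mul_right _ he
  obtain ⟨k, hk⟩ := Nat.exists_eq_add_of_le (by omega : p - 1 + 2 ≤ e * (p - 1))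
  obtain ⟨b, hb⟩ := diff_pow_prime_sub_one ((diff p (p ^ e) ^ k) (single p (p ^ e)))
  have h1 := diff_pow_single_eq_socle (p := p) (by omega : 1 ≤ e)
  rw [hk, show p - 1 + 2 + k - 1 = p - 1 + k + 1 by omega] at *
  rw [hz.twistedAction_sub_one_pow, h1, pow_add, Module.End.mul_apply, hb, smul_apply, neg_mul,
    mul_neg, neg_smul, mul_left_comm, hz.mul_smul_eq, neg_zero, add_zero, hz.twistedAction_z]

theorem card_eq_pow : Nat.card (NormalizedFun p (p ^ e)) = p ^ (e * (p - 1)) := by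
  have : NeZero (p ^ e) := ⟨pow_ne_zero _ hp.out.ne_zero⟩
  rw [card_eq, pow_mul]

omit hp in
theorem le_mul_sub_one (he : 2 ≤ e) (hp5 : 5 ≤ p) : p + 1 ≤ e * (p - 1) := by
  have := Nat.mul_le_mul_right (p - 1) he
  omega

theorem inFamily_socleExtension (he : 2 ≤ e) (hp5 : 5 ≤ p) (ε : ZMod (p ^ e)) :
    InFamily (socleExtension p he ε) p (e * (p - 1) + 1) := by
  have := le_mul_sub_one he hp5
  exact TwistedProduct.inFamily (twistedAction_pow_single he (by omega) ε) (by omega) (by omega)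
    card_eq_pow (socle_ne_zero (by omega))

theorem mem_gOne_iff (he : 2 ≤ e) (hp5 : 5 ≤ p) (ε : ZMod (p ^ e)) (x : socleExtension p he ε) :
    x ∈ gOne (socleExtension p he ε) ↔ x.right = 0 := by
  have := le_mul_sub_one he hp5
  rw [TwistedProduct.gOne_eq_ker_rightHom (twistedAction_pow_single he (by omega) ε) (by omega)
    card_eq_pow (socle_ne_zero (by omega)), TwistedProduct.mem_ker_rightHom]

theorem gen_notMem_gOne (he : 2 ≤ e) (hp5 : 5 ≤ p) (ε : ZMod (p ^ e)) :
    TwistedProduct.gen _ ∉ gOne (socleExtension p he ε) := by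
  rw [mem_gOne_iff he hp5]
  exact one_ne_zero

/-- The coefficient of the `p`-th power of `inl a * gen`. -/
def powCoeff {N : ℕ} (a : NormalizedFun p N) : ZMod N :=
  ∑ j ∈ Finset.range p, ∑ i ∈ Finset.range j, pairing (shift (i : ZMod p) a) (shift (j : ZMod p) a) -
    ∑ x, a x

theorem inl_mul_gen_pow_prime (he : 2 ≤ e) (ε : ZMod (p ^ e)) (a : NormalizedFun p (p ^ e)) :
    (TwistedProduct.inl _ a * TwistedProduct.gen _ : socleExtension p he ε) ^ p =
      TwistedProduct.inl _ ((ε * powCoeff a) • socle p e) := by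
  rw [TwistedProduct.inl_mul_gen_pow, IsSmallInvariant.sum_twistedAction_T,
    IsSmallInvariant.sum_twistedAction_q, powCoeff, mul_sub, sub_smul, neg_add_eq_sub,
    TwistedProduct.inl, ZMod.natCast_self]

theorem caseA_socleExtension (he : 2 ≤ e) (hp5 : 5 ≤ p) : CaseA (socleExtension p he 0) p := by
  refine (inFamily_socleExtension he hp5 0).caseA_of_pow_prime hp5 (gen_notMem_gOne he hp5 0)
    fun x hx => ?_
  rw [← TwistedProduct.inl_left ((mem_gOne_iff he hp5 0 x).1 hx), inl_mul_gen_pow_prime, zero_mul,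
    zero_smul]
  rfl

theorem IsSmallInvariant.powCoeff_add_smul {N : ℕ} {z : NormalizedFun p N} (hz : IsSmallInvariant z)
    (a : NormalizedFun p N) (u : ZMod N) : powCoeff (a + u • z) • z = powCoeff a • z := by
  simp only [powCoeff, sub_smul, Finset.sum_smul, map_add, map_smul, hz.shift_eq,
    hz.pairing_add_smul, add_apply, smul_apply, add_smul, mul_smul, hz.apply_smul, smul_zero,
    add_zero]

/-- The pairing part contributes k² through its single nonzero term, and the total sum contributes
k. -/
theorem powCoeff_smul_single {N : ℕ} (hp3 : 3 ≤ p) (k : ZMod N) :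
    powCoeff (k • single p N) = k ^ 2 - k := by
  simp only [powCoeff, map_smul, pairing_smul_left, pairing_smul_right, ← Finset.mul_sum]
  rw [Finset.sum_congr rfl fun j hj => sum_pairing_shift_single hp3 (Finset.mem_range.1 hj),
    Finset.sum_ite_eq', if_pos (Finset.mem_range.2 (by omega))]
  simp only [smul_apply, ← Finset.mul_sum, single_apply, Finset.sum_ite_eq', Finset.mem_univ, if_true]
  ring

theorem caseB_socleExtension (he : 2 ≤ e) (hp5 : 5 ≤ p) :
    CaseB (socleExtension p he 1) p (e * (p - 1) + 1) := by
  have hz := isSmallInvariant_socle (p := p) he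
  -- Here n ≡ 1 modulo p - 1, which differs from 2 since p - 1 ≥ 4.
  have hmod : ¬ e * (p - 1) + 1 ≡ 2 [MOD p - 1] := by
    rw [Nat.ModEq, Nat.add_comm, Nat.add_mul_mod_self_right, Nat.mod_eq_of_lt (by omega),
      Nat.mod_eq_of_lt (by omega)]
    omega
  have hpow := fun k : ZMod (p ^ e) => inl_mul_gen_pow_prime he 1 (k • single p (p ^ e))
  simp only [powCoeff_smul_single (by omega : 3 ≤ p), one_mul] at hpow
  have h0 : (TwistedProduct.inl _ 0 : socleExtension p he 1) = 1 := rfl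
  refine (inFamily_socleExtension he hp5 1).caseB_of_pow_prime hp5 hmod (gen_notMem_gOne he hp5 1)
    (a := TwistedProduct.inl _ (single p (p ^ e))) ((mem_gOne_iff he hp5 1 _).2 rfl) ?_ ?_ ?_
  · have := hpow 0
    simpa [h0] using this
  · have := hpow 1
    simpa [h0] using this
  -- The square of inl(single) is inl(2 • single) up to a multiple of z, which does not affect the
  -- p-th power. The latter is therefore (2² - 2)z = 2z, nonzero because z has odd order p.
  · rw [sq, TwistedProduct.inl_mul_inl]
    have h1 : single p (p ^ e) + single p (p ^ e) = (2 : ZMod (p ^ e)) • single p (p ^ e) :=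
      (two_smul _ _).symm
    rw [h1, IsSmallInvariant.twistedAction_q_apply, inl_mul_gen_pow_prime, one_mul,
      hz.powCoeff_add_smul, powCoeff_smul_single (by omega)]
    intro h2
    refine two_smul_socle_ne_zero he (by omega : 3 ≤ p) ?_
    rw [← Nat.cast_smul_eq_nsmul (ZMod (p ^ e))]
    have h3 := congrArg TwistedProduct.left h2
    rwa [TwistedProduct.one_left, TwistedProduct.inl,
      show (2 : ZMod (p ^ e)) ^ 2 - 2 = ((2 : ℕ) : ZMod (p ^ e)) by push_cast; ring] at h3

end NormalizedFun

theorem infinite_setOf_exists {p : ℕ} [hp : Fact p.Prime] (hp5 : 5 ≤ p)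
    {P : (G : Type) → Group G → ℕ → Prop} {ε : (e : ℕ) → ZMod (p ^ e)}
    (hP : ∀ e (he : 2 ≤ e), P (NormalizedFun.socleExtension p he (ε e)) inferInstance
      (e * (p - 1) + 1)) :
    {n : ℕ | ∃ (G : Type) (_ : Group G), InFamily G p n ∧ P G inferInstance n}.Infinite := by
  refine Set.infinite_of_injective_forall_mem (f := fun e : ℕ => (e + 2) * (p - 1) + 1) ?_ fun e =>
    ⟨_, _, NormalizedFun.inFamily_socleExtension (Nat.le_add_left 2 e) hp5 (ε (e + 2)), hP _ _⟩
  intro e f hef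
  have h1 := Nat.eq_of_mul_eq_mul_right (by omega) (Nat.add_right_cancel hef)
  omega

theorem mainTheorem1 (p : ℕ) [hp : Fact p.Prime] :
    (∀ (n : ℕ) (G : Type*) [Group G], InFamily G p n →
      (IsBeauvilleGroup G ↔ 5 ≤ p ∧ (CaseA G p ∨ CaseB G p n)) ∧
      (5 ≤ p → (CaseA G p ↔ {g : G | g ∉ frattini G ∧ orderOf g = p} = (gOne G : Set G)ᶜ)) ∧
      (5 ≤ p → CaseA G p → IsTameBeauville G) ∧
      (5 ≤ p → CaseB G p n → IsWildBeauville G)) ∧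
    (5 ≤ p →
      {n : ℕ | ∃ (G : Type) (_ : Group G), InFamily G p n ∧ CaseA G p}.Infinite ∧
      {n : ℕ | ∃ (G : Type) (_ : Group G), InFamily G p n ∧ CaseB G p n}.Infinite) :=
  ⟨fun _ _ _ h => beauville_classification h, fun hp5 =>
    ⟨infinite_setOf_exists hp5 (P := fun G _ _ => CaseA G p) (ε := fun _ => 0) fun _ he =>
      NormalizedFun.caseA_socleExtension he hp5,
    infinite_setOf_exists hp5 (P := fun G _ n => CaseB G p n) (ε := fun _ => 1) fun _ he =>
      NormalizedFun.caseB_socleExtension he hp5⟩⟩
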